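/- **Setting.** $\Omega$ is a finite state space, $X:\Omega\to\mathbb R$ a security, $[\underline y,\overline y]=[\min X,\max X]$, and $\Pi=(\Pi_1,\dots,\Pi_n)$ are the traders' partitions of $\Omega$, with $\bigcap_i\Pi_i(\omega)=\{\omega\}$ for all $\omega$. A *scoring rule* is a function $s(y,x)$, continuous in $y\in[\underline y,\overline y]$ and strictly proper: for every distribution on $\Omega$ and every random variable with values in $[\underline y,\overline y]$, the expected score is maximized over $y\in[\underline y,\overline y]$ exactly at the expected value. A *signal* $\mathcal R$ is a family $(\mathcal R(\cdot|\omega))_{\omega}$ of Borel probability measures on a Polish metric space $T$; $\mathcal E$ is a compact set of available signals (for the product of the weak topologies). A *cost structure* is $\kappa=(K,c)$ with $c>0$ and $K:\mathcal E\to[0,\infty]$ continuous, such that some $\mathcal R_0\in\mathcal E$ is uninformative ($\mathcal R_0(\cdot|\omega)$ does not depend on $\omega$) with $K(\mathcal R_0)=0$ and $K(\mathcal R)=O(D(\mathcal R,\mathcal R_0)^2)$ as $\mathcal R\to\mathcal R_0$ ($D$ = maximum over $\omega$ of the Lévy–Prokhorov distances), and $K(\mathcal R')\le K(\mathcal R)$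 whenever $\mathcal R'$ is a garbling of $\mathcal R$. For $\nu\in\Delta(\Omega)$, $\mathcal R_\nu$ is the law of the Bayesian posterior obtained from the prior $\nu$ by observing $\mathcal R$. **Game.** A state $\omega$ is drawn from a common prior $\mu\in\Delta(\Omega)$ and the market maker announces $y_0\in[\underline y,\overline y]$. At times $k=1,2,\dots$ the traders move cyclically, starting with trader 1. The mover, knowing his cell $\Pi_i(\omega)$, his own past signals and realizations, all past announcements, and a fresh independent uniform draw from $[0,1]$, chooses a signal $\mathcal R_k\in\mathcal E$ and an announcement in $[\underline y,\overline y]$ for each realization (measurably); a realization is drawn from $\mathcal R_k(\cdot|\omega)$, independently of the past given $\omega$ and $\mathcal R_k$, and the resulting announcement $y_k$ becomes public, while $\mathcal R_k$ and its realization stay private. The mover's payoff at time $k$ is $\beta^k\big(s(y_k,X(\omega))-s(y_{k-1},X(\omega))-cK(\mathcal R_k)\big)$, where $0<\beta\le1$. A trader's total payoff is the limit in $[-\infty,\infty]$, as $m\to\infty$, of the expected sum of his payoffs up to time $m$ (for $\beta<1$ it always exists and is the expected discounted sum). A strategy profile is a *Nash equilibrium* if every trader's total payoff is well defined and no unilateral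 deviation with a well-defined total payoff gives him more. *Information aggregates* if $y_k\to X$ in probability. **Separability.** $X$ is *non-separable at* $\mu\in\Delta(\Omega)$ if there is $v\in\mathbb R$ with $X(\omega)\ne v$ for some $\omega\in\mathrm{Supp}(\mu)$ and $E_\mu[X|\Pi_i(\omega)]=v$ for all $i$ and all $\omega\in\mathrm{Supp}(\mu)$. There is *no information acquisition at $\mu$ under $s$* if, for all $\omega\in\mathrm{Supp}(\mu)$, all $i$ and all $\mathcal R\in\mathcal E$, with $\nu=\mu(\cdot|\Pi_i(\omega))$, $$\int\sum_{\omega'}\gamma(\omega')\big[s(E_\gamma[X],X(\omega'))-s(E_\nu[X],X(\omega'))\big]\,d\mathcal R_\nu(\gamma)-cK(\mathcal R)\le0 .$$ For a set $S$ of scoring rules, $X$ is *$\kappa$ non-separable for $S$* if there is $\mu\in\Delta(\Omega)$ such that $X$ is non-separable at $\mu$ and there is no information acquisition at $\mu$ under every $s\in S$. $X$ is *$\kappa$ separable for $s$* if it is not $\kappa$ non-separable for $\{s\}$. **Assumption 1.** For every $\mu\in\Delta(\Omega)$, every $\mathcal R\in\mathcal E$ and every measurable family $(\mathcal R^\tau)_{\tau\in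 T}$ in $\mathcal E$ there is $\mathcal R'\in\mathcal E$ such that $\mathcal R'_\mu$ equals the law of the posterior obtained from $\mu$ by observing the realization $\tau$ of $\mathcal R$ and then the realization of $\mathcal R^\tau$, and $K(\mathcal R')\le K(\mathcal R)+E_\mu[K(\mathcal R^\tau)]$. **Theorem.** Fix $\Omega$, $X$, $\Pi$, $\mathcal E$ and $\kappa=(K,c)$. 1. If $s$ is a scoring rule and $X$ is $\kappa$ separable for $s$, then for every prior $\mu\in\Delta(\Omega)$, every $y_0\in[\underline y,\overline y]$ and every $\beta\in(0,1]$, information aggregates in every Nash equilibrium of the game. 2. Suppose Assumption 1 holds. If $S$ is a set of scoring rules (for example $S=\{s\}$) and $X$ is $\kappa$ non-separable for $S$, then there is a prior $\mu\in\Delta(\Omega)$ such that for every $s\in S$, every $y_0\in[\underline y,\overline y]$ and every $\beta\in(0,1]$ the game has a Nash equilibrium in which information does not aggregate. -/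

import Mathlib

open MeasureTheory ProbabilityTheory Filter Topology
open scoped ENNReal

noncomputable section

namespace InfoMarket

/-! ### Beliefs and information structures -/

/-- The information structure of `n` traders on the state space `Ω`: the partition of each trader
(as an equivalence relation), such that the pooled information reveals the state. -/
structure InfoStructure (Ω : Type*) (n : ℕ) where
  part : Fin n → Setoid Ω
  join_eq_singletons : ∀ ω ω' : Ω, (∀ i, part i ω ω') → ω = ω'

section Beliefs

variable {Ω : Type*} [Fintype Ω]

/-- The expectation of `Z` under the belief (probability vector) `γ`. -/
def expect (γ : Ω → ℝ) (Z : Ω → ℝ) : ℝ := ∑ ω, γ ω * Z ω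

/-- The Bayesian update `μ_{Π(ω)}` of `μ` on the cell of `ω` in the partition `r`
(meaningful when `μ ω > 0`). -/
def condCell (μ : Ω → ℝ) (r : Setoid Ω) (ω : Ω) : Ω → ℝ := fun ω' =>
  {ω'' | r ω ω''}.indicator μ ω' / ∑ ω'', {ω''' | r ω ω'''}.indicator μ ω''

/-- The admissible predictions `[min X, max X]`. -/
def predictions {Ω : Type*} (X : Ω → ℝ) : Set ℝ := Set.Icc (⨅ ω, X ω) (⨆ ω, X ω)

/-- `s y x` is a strictly proper scoring rule, continuous in the prediction `y`, on the interval of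
admissible predictions: for every belief and every random variable with values in that interval, the
expected score is maximized exactly by the expected value. -/
structure IsScoringRule (X : Ω → ℝ) (s : ℝ → ℝ → ℝ) : Prop where
  continuousOn : ∀ x ∈ predictions X, ContinuousOn (fun y => s y x) (predictions X)
  strictlyProper : ∀ ν ∈ stdSimplex ℝ Ω, ∀ Z : Ω → ℝ, (∀ ω, Z ω ∈ predictions X) →
    ∀ y ∈ predictions X, y ≠ expect ν Z →
      expect ν (fun ω => s y (Z ω)) < expect ν (fun ω => s (expect ν Z) (Z ω))

/-- The security `X` is non-separable at `μ`: all traders agree on its expected value `v` at every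
state in the support, and yet `X` differs from `v` at some state of the support. -/
def NonSeparableAt {n : ℕ} (P : InfoStructure Ω n) (X : Ω → ℝ) (μ : Ω → ℝ) : Prop :=
  ∃ v : ℝ, (∃ ω, 0 < μ ω ∧ X ω ≠ v) ∧
    ∀ i ω, 0 < μ ω → expect (condCell μ (P.part i) ω) X = v

/-! ### Signals, posteriors and costs -/

/-- The law of the realization of an experiment `R` when the state has law `μ`. -/
def marginal {S : Type*} [MeasurableSpace S] (μ : Ω → ℝ) (R : Ω → Measure S) : Measure S :=
  ∑ ω, ENNReal.ofReal (μ ω) • R ω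

/-- Bayes' rule: the posterior probability of each state after the realization `τ`, where the
likelihoods are densities with respect to the law of the realization. -/
def posterior {S : Type*} [MeasurableSpace S] (μ : Ω → ℝ) (R : Ω → Measure S) (τ : S) : Ω → ℝ :=
  fun ω => μ ω * ((R ω).rnDeriv (marginal μ R) τ).toReal

/-- The random posterior `R_μ`: the law of the posterior. -/
def randomPosterior {S : Type*} [MeasurableSpace S] (μ : Ω → ℝ) (R : Ω → Measure S) :
    Measure (Ω → ℝ) :=
  (marginal μ R).map (posterior μ R)

end Beliefs

section Signals

variable {Ω T : Type*} [MeasurableSpace T]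

/-- The distributions `R(· | ω)` of a signal `R` of the collection `E`, as measures. -/
def law (E : Set (Ω → ProbabilityMeasure T)) (R : E) : Ω → Measure T :=
  fun ω => (R.1 ω : Measure T)

/-- The kernel sending a signal to the law of its realization in state `ω`. -/
def realize (E : Set (Ω → ProbabilityMeasure T)) (ω : Ω) : Kernel E T where
  toFun R := law E R ω
  measurable' := by
    unfold law
    exact measurable_subtype_coe.comp ((measurable_pi_apply ω).comp measurable_subtype_coe)

instance (E : Set (Ω → ProbabilityMeasure T)) (ω : Ω) :
    IsMarkovKernel (realize E ω) :=
  ⟨fun R => (R.1 ω).2⟩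

/-- The two-stage experiment: conduct `R`, and after the realization `τ` conduct `F τ`;
both realizations are observed. -/
def sequential {E : Set (Ω → ProbabilityMeasure T)} (R : E) (F : T → E)
    (hF : Measurable F) : Ω → Measure (T × T) :=
  fun ω => law E R ω ⊗ₘ (realize E ω).comap F hF

variable [MetricSpace T] [BorelSpace T]

/-- A cost structure `κ = (K, c)` on the collection `E` of available signals. `E` has the topology
of (statewise) weak convergence. -/
structure CostStructure (E : Set (Ω → ProbabilityMeasure T)) where
  K : E → ℝ≥0∞
  c : ℝ
  c_pos : 0 < c
  continuous_K : Continuous K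
  /-- There is a free uninformative signal `R₀`, and `K(R) = O(D(R, R₀)²)` as `R → R₀`, where `D` is
  the maximum over the states of the Lévy-Prokhorov distances. -/
  exists_free : ∃ R₀ : E, (∀ ω ω', R₀.1 ω = R₀.1 ω') ∧ K R₀ = 0 ∧
    ∃ C : ℝ≥0∞, C ≠ ∞ ∧ ∀ᶠ R in 𝓝 R₀,
      K R ≤ C * (⨆ ω, levyProkhorovEDist (law E R ω) (law E R₀ ω)) ^ 2
  /-- A garbling of a signal is not costlier than the signal. -/
  garbling : ∀ (R R' : E) (g : Kernel T T), IsMarkovKernel g →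
    (∀ ω, law E R' ω = (law E R ω).bind g) → K R' ≤ K R

/-- One signal is enough: whatever random posterior is generated from a prior by a two-stage
experiment is generated by a single available signal which is not costlier in expectation. -/
def OneSignalSuffices [Fintype Ω] {E : Set (Ω → ProbabilityMeasure T)} (κ : CostStructure E) :
    Prop :=
  ∀ μ ∈ stdSimplex ℝ Ω, ∀ (R : E) (F : T → E) (hF : Measurable F),
    ∃ R' : E, randomPosterior μ (sequential R F hF) = randomPosterior μ (law E R') ∧
      κ.K R' ≤ κ.K R + ∫⁻ τ, κ.K (F τ) ∂(marginal μ (law E R))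

/-- No trader is (myopically) willing to acquire any signal at the prior `μ`, under the scoring
rule `s`. -/
def NoInfoAcquisition [Fintype Ω] {E : Set (Ω → ProbabilityMeasure T)} (κ : CostStructure E)
    {n : ℕ} (P : InfoStructure Ω n) (X : Ω → ℝ) (s : ℝ → ℝ → ℝ) (μ : Ω → ℝ) : Prop :=
  ∀ ω, 0 < μ ω → ∀ (i : Fin n) (R : E),
    ((∫ γ, ∑ ω', γ ω' * (s (expect γ X) (X ω') - s (expect (condCell μ (P.part i) ω) X) (X ω'))
        ∂(randomPosterior (condCell μ (P.part i) ω) (law E R)) : ℝ) : EReal)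
      - ((ENNReal.ofReal κ.c * κ.K R : ℝ≥0∞) : EReal) ≤ 0

/-- `X` is `κ` non-separable for the scoring rules in `S`: at some prior `μ`, `X` is non-separable
and there is no information acquisition under any rule in `S`. -/
def KappaNonSeparable [Fintype Ω] {E : Set (Ω → ProbabilityMeasure T)} (κ : CostStructure E)
    {n : ℕ} (P : InfoStructure Ω n) (X : Ω → ℝ) (S : Set (ℝ → ℝ → ℝ)) : Prop :=
  ∃ μ ∈ stdSimplex ℝ Ω, NonSeparableAt P X μ ∧ ∀ s ∈ S, NoInfoAcquisition κ P X s μ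

/-- `X` is `κ` separable for the scoring rule `s`. -/
def KappaSeparable [Fintype Ω] {E : Set (Ω → ProbabilityMeasure T)} (κ : CostStructure E)
    {n : ℕ} (P : InfoStructure Ω n) (X : Ω → ℝ) (s : ℝ → ℝ → ℝ) : Prop :=
  ¬ KappaNonSeparable κ P X {s}

end Signals

/-! ### The game

Index `k : ℕ` stands for the time `t_{k+1}`, and `Fin n` numbers the traders from `0`. -/

/-- The trader who moves at index `k`. -/
def turn (n : ℕ) [NeZero n] (k : ℕ) : Fin n := Fin.ofNat n k

section Game

variable {Ω T : Type*} [MeasurableSpace T]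

/-- What happens at one date: the signal chosen, its realization, and the announcement. -/
abbrev Move (E : Set (Ω → ProbabilityMeasure T)) (X : Ω → ℝ) : Type _ :=
  (E × T) × predictions X

/-- What trader `i` has observed before index `k`: all announcements, and the signals chosen and the
realizations obtained by `i`. -/
abbrev View (E : Set (Ω → ProbabilityMeasure T)) (X : Ω → ℝ) (n : ℕ) [NeZero n] (i : Fin n)
    (k : ℕ) : Type _ :=
  (Fin k → predictions X) × ({j : Fin k // turn n j = i} → E × T)

/-- The part of the history `h` that trader `i` observes. -/
def view {E : Set (Ω → ProbabilityMeasure T)} {X : Ω → ℝ} {n : ℕ} [NeZero n] (i : Fin n) {k : ℕ}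
    (h : Fin k → Move E X) : View E X n i k :=
  (fun j => (h j).2, fun j => (h j.1).1)

/-- A mixed strategy of trader `i`: at each date, given the cell of the true state, the observed
history and a uniform draw, a signal and an announcement for each of its realizations.
(The values at dates when `i` does not move are irrelevant.) -/
structure Strategy (E : Set (Ω → ProbabilityMeasure T)) (X : Ω → ℝ) {n : ℕ} [NeZero n]
    (P : InfoStructure Ω n) (i : Fin n) where
  signal : (k : ℕ) → Quotient (P.part i) → View E X n i k × unitInterval → E
  announce : (k : ℕ) → Quotient (P.part i) → (View E X n i k × unitInterval) × T → predictions X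
  measurable_signal : ∀ k q, Measurable (signal k q)
  measurable_announce : ∀ k q, Measurable (announce k q)

variable {E : Set (Ω → ProbabilityMeasure T)} {X : Ω → ℝ} {n : ℕ} [NeZero n] {P : InfoStructure Ω n}

lemma measurable_view (i : Fin n) (k : ℕ) :
    Measurable (view i : (Fin k → Move E X) → View E X n i k) := by
  unfold view
  fun_prop

/-- The signal bought at index `k`, in state `ω`, after the history and the draw `p`. -/
def chosenSignal (σ : ∀ i, Strategy E X P i) (ω : Ω) (k : ℕ)
    (p : (Fin k → Move E X) × unitInterval) : E :=
  (σ (turn n k)).signal k (Quotient.mk _ ω) (view (turn n k) p.1, p.2)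

lemma measurable_chosenSignal (σ : ∀ i, Strategy E X P i) (ω : Ω) (k : ℕ) :
    Measurable (chosenSignal σ ω k) :=
  ((σ (turn n k)).measurable_signal k _).comp
    (((measurable_view _ k).comp measurable_fst).prodMk measurable_snd)

/-- The move resulting from a history, a draw and a signal realization. -/
def resultingMove (σ : ∀ i, Strategy E X P i) (ω : Ω) (k : ℕ)
    (p : (Fin k → Move E X) × (unitInterval × T)) : Move E X :=
  ((chosenSignal σ ω k (p.1, p.2.1), p.2.2),
    (σ (turn n k)).announce k (Quotient.mk _ ω) ((view (turn n k) p.1, p.2.1), p.2.2))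

lemma measurable_resultingMove (σ : ∀ i, Strategy E X P i) (ω : Ω) (k : ℕ) :
    Measurable (resultingMove σ ω k) := by
  have h1 : Measurable fun p : (Fin k → Move E X) × (unitInterval × T) =>
      view (turn n k) p.1 := (measurable_view _ k).comp measurable_fst
  exact (((measurable_chosenSignal σ ω k).comp (by fun_prop)).prodMk (by fun_prop)).prodMk
    (((σ (turn n k)).measurable_announce k _).comp ((h1.prodMk (by fun_prop)).prodMk (by fun_prop)))

/-- The law of the move at index `k` in state `ω` given the history: a uniform draw is made, the
mover's strategy picks a signal, nature draws its realization in state `ω`, and the announcement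
follows. -/
def stepKernel (σ : ∀ i, Strategy E X P i) (ω : Ω) (k : ℕ) :
    Kernel (Fin k → Move E X) (Move E X) :=
  ((Kernel.id : Kernel (Fin k → Move E X) (Fin k → Move E X)) ×ₖ
    ((Kernel.const _ (volume : Measure unitInterval)) ⊗ₖ
      (realize E ω).comap (chosenSignal σ ω k) (measurable_chosenSignal σ ω k))).map
    (resultingMove σ ω k)

instance (σ : ∀ i, Strategy E X P i) (ω : Ω) (k : ℕ) : IsMarkovKernel (stepKernel σ ω k) :=
  Kernel.IsMarkovKernel.map _ (measurable_resultingMove σ ω k)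

/-- `stepKernel` at index `k + 1`, with histories indexed by `{0, …, k}`. -/
def nextKernel (σ : ∀ i, Strategy E X P i) (ω : Ω) (k : ℕ) :
    Kernel ((_ : Finset.Iic k) → Move E X) (Move E X) :=
  (stepKernel σ ω (k + 1)).comap
    (fun h (j : Fin (k + 1)) => h ⟨j, Finset.mem_Iic.2 (Nat.lt_succ_iff.1 j.2)⟩)
    (by fun_prop)

instance (σ : ∀ i, Strategy E X P i) (ω : Ω) (k : ℕ) : IsMarkovKernel (nextKernel σ ω k) := by
  unfold nextKernel
  infer_instance

/-- The law of the infinite sequence of moves in state `ω`. -/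
def playLaw (σ : ∀ i, Strategy E X P i) (ω : Ω) : Measure (ℕ → Move E X) :=
  Kernel.trajMeasure (X := fun _ => Move E X) (stepKernel σ ω 0 Fin.elim0) (nextKernel σ ω)

/-- The joint law of the state, drawn from the prior `μ`, and of the play. -/
def gameLaw [Fintype Ω] [MeasurableSpace Ω] (μ : Ω → ℝ) (σ : ∀ i, Strategy E X P i) :
    Measure (Ω × (ℕ → Move E X)) :=
  ∑ ω, ENNReal.ofReal (μ ω) • (Measure.dirac ω).prod (playLaw σ ω)

/-- The announcement `y_k` at time `t_k`; `y_0` is the market maker's. -/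
def price (y₀ : ℝ) : ℕ → (ℕ → Move E X) → ℝ
  | 0, _ => y₀
  | k + 1, h => (h k).2

end Game

section Equilibrium

variable {Ω T : Type*} [Fintype Ω] [MeasurableSpace Ω] [MetricSpace T] [MeasurableSpace T]
  [BorelSpace T] {E : Set (Ω → ProbabilityMeasure T)} {X : Ω → ℝ} {n : ℕ} [NeZero n]
  {P : InfoStructure Ω n}

/-- Trader `i`'s expected discounted payoff up to time `t_m`: expected score improvements minus
expected signal costs (possibly infinite). -/
def payoffUpTo (κ : CostStructure E) (s : ℝ → ℝ → ℝ) (y₀ β : ℝ) (μ : Ω → ℝ)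
    (σ : ∀ i, Strategy E X P i) (i : Fin n) (m : ℕ) : EReal :=
  ((∫ p, ∑ k ∈ Finset.range m with turn n k = i,
      β ^ (k + 1) * (s (price y₀ (k + 1) p.2) (X p.1) - s (price y₀ k p.2) (X p.1))
      ∂(gameLaw μ σ) : ℝ) : EReal)
    - ((∫⁻ p, ∑ k ∈ Finset.range m with turn n k = i,
      ENNReal.ofReal (β ^ (k + 1) * κ.c) * κ.K (p.2 k).1.1 ∂(gameLaw μ σ) : ℝ≥0∞) : EReal)

/-- `u` is trader `i`'s total expected payoff. For `β < 1` it always exists in `[-∞, ∞)`. -/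
def HasPayoff (κ : CostStructure E) (s : ℝ → ℝ → ℝ) (y₀ β : ℝ) (μ : Ω → ℝ)
    (σ : ∀ i, Strategy E X P i) (i : Fin n) (u : EReal) : Prop :=
  Tendsto (payoffUpTo κ s y₀ β μ σ i) atTop (𝓝 u)

/-- Nash equilibrium: everybody's payoff is well defined, and no unilateral deviation yields more. -/
def IsNash (κ : CostStructure E) (s : ℝ → ℝ → ℝ) (y₀ β : ℝ) (μ : Ω → ℝ)
    (σ : ∀ i, Strategy E X P i) : Prop :=
  ∀ i, ∃ u, HasPayoff κ s y₀ β μ σ i u ∧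
    ∀ (d : Strategy E X P i) (u' : EReal),
      HasPayoff κ s y₀ β μ (Function.update σ i d) i u' → u' ≤ u

/-- Information aggregates: the announcements converge in probability to the security's value. -/
def Aggregates (y₀ : ℝ) (μ : Ω → ℝ) (σ : ∀ i, Strategy E X P i) : Prop :=
  TendstoInMeasure (gameLaw μ σ) (fun k p => price y₀ k p.2) atTop (fun p => X p.1)

end Equilibrium

end InfoMarket

end

open scoped NNReal BoundedContinuousFunction

/-! Aggregation. A trader may at any of his turns carry out one plan (a signal and announcements,
chosen from his cell, if the past announcements lie in a given set) and from then on repeat the last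
price for free. In equilibrium his continuation payoff is therefore nonnegative and at least the
gain from any such plan. The continuation payoffs of all traders together are bounded by discounted
increments of one bounded sequence, the expected scores of successive prices. Hence the gain
available at date `m`, per unit of the discount factor of that date, is at most some `ε m` tending
to `0` (`exists_gain_bound`).

The belief of an observer of the announcements converges almost surely. At a belief `γ` that does
not determine `X`, separability gives some trader a plan that beats every price
(`KappaSeparable.exists_plan`): if the traders disagree, announcing his cell means; if they agree,
buying a signal worth more than its cost. By compactness the advantage is bounded below near `γ`, so
a limit belief near `γ` with positive probability would keep gains away from `0` at infinitely many
turns of that trader. Thus the limit belief determines `X`, and a price far from `X` could then be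
corrected at a profit, so such prices have vanishing probability (`aggregates_of_edge`).

Non-aggregation. At the belief given by non-separability, let everyone announce the common value `v`
forever without buying information. Nobody reacts to a deviator, so he solves a one-person problem
of sequential experimentation. Backward induction with `OneSignalSuffices` reduces it to a single
plan (`sum_integral_hist_sub_cost_le`), which cannot beat announcing `v`, because no information is
worth acquiring. The bound holds at every horizon, and summation by parts carries it over to
discounted payoffs (`sum_discounted_nonpos`, `isNash_follow`). In a state where `X ≠ v` the price
stays wrong. -/

noncomputable section

namespace InfoMarket

/-! ### Measurability of the cost on a compact set of signals -/

/-- In a second countable space whose topology is induced by a family of measurable functions,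
the open sets are measurable. -/
lemma opensMeasurableSpace_of_eq_iInf_induced {α ι β : Type*} [t : TopologicalSpace α]
    [SecondCountableTopology α] [MeasurableSpace α] [TopologicalSpace β] [MeasurableSpace β]
    [OpensMeasurableSpace β] {f : ι → α → β}
    (hf : t = ⨅ i, TopologicalSpace.induced (f i) inferInstance)
    (hm : ∀ i, Measurable (f i)) : OpensMeasurableSpace α := by
  have htop : t = TopologicalSpace.generateFrom
      (⋃ i, {s | IsOpen[TopologicalSpace.induced (f i) inferInstance] s}) :=
    hf.trans (generateFrom_iUnion_isOpen _).symm
  have hbasis := TopologicalSpace.isTopologicalBasis_of_subbasis htop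
  refine ⟨MeasurableSpace.generateFrom_le fun s hs => ?_⟩
  obtain ⟨S, hS, rfl⟩ := hbasis.open_eq_sUnion hs
  -- The union of basic sets may be uncountable; second countability leaves a countable subfamily.
  obtain ⟨C, hCc, hCS, hC⟩ := TopologicalSpace.isOpen_sUnion_countable S
    (fun t ht => hbasis.isOpen (hS ht))
  rw [← hC]
  refine MeasurableSet.sUnion hCc fun t ht => ?_
  obtain ⟨F, ⟨hFf, hF⟩, rfl⟩ := hS (hCS ht)
  refine MeasurableSet.sInter hFf.countable fun u hu => ?_
  obtain ⟨i, V, hV, rfl⟩ := Set.mem_iUnion.1 (hF hu)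
  exact hm i hV.measurableSet

variable {Ω T : Type*} [Fintype Ω] [MetricSpace T] [SecondCountableTopology T]
  [MeasurableSpace T] [BorelSpace T] {E : Set (Ω → ProbabilityMeasure T)}

/-- The weak topology over a separable metric space is metrizable, so the compact set `E` is second
countable. Its topology is induced by integrals of bounded continuous functions, and these are
measurable for the σ-algebra that `E` inherits from the measures. -/
lemma opensMeasurableSpace_of_isCompact (hE : IsCompact E) : OpensMeasurableSpace E := by
  have : CompactSpace E := isCompact_iff_compactSpace.1 hE
  let _ : MetricSpace E := TopologicalSpace.metrizableSpaceMetric E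
  have : SecondCountableTopology E := inferInstance
  have h1 : (instTopologicalSpaceSubtype : TopologicalSpace E) =
      ⨅ p : Ω × (T →ᵇ ℝ≥0), TopologicalSpace.induced
        (fun R : E => (R.1 p.1).toFiniteMeasure.testAgainstNN p.2) inferInstance := by
    have h2 : (inferInstance : TopologicalSpace (ProbabilityMeasure T)) =
        ⨅ f : T →ᵇ ℝ≥0, TopologicalSpace.induced
          (fun ν : ProbabilityMeasure T => ν.toFiniteMeasure.testAgainstNN f) inferInstance := by
      have h3 : IsInducing (fun (ν : ProbabilityMeasure T) (f : T →ᵇ ℝ≥0) =>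
          ν.toFiniteMeasure.testAgainstNN f) :=
        IsInducing.comp (g := fun (x : WeakDual ℝ≥0 (T →ᵇ ℝ≥0)) (f : T →ᵇ ℝ≥0) => x f) ⟨rfl⟩
          (IsInducing.comp (g := FiniteMeasure.toWeakDualBCNN (Ω := T))
            (f := ProbabilityMeasure.toFiniteMeasure (Ω := T)) ⟨rfl⟩ ⟨rfl⟩)
      refine h3.eq_induced.trans ?_
      simp only [Pi.topologicalSpace, induced_iInf, induced_compose]
      rfl
    rw [iInf_prod]
    change TopologicalSpace.induced _ (⨅ ω, TopologicalSpace.induced _ inferInstance) = _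
    rw [h2]
    simp only [induced_iInf, induced_compose]
    rfl
  refine opensMeasurableSpace_of_eq_iInf_induced h1 fun p => ?_
  have h4 : Measurable fun R : E => law E R p.1 := (realize E p.1).measurable
  exact (Measurable.ennreal_toNNReal (Measure.measurable_lintegral
    (f := fun x => (p.2 x : ℝ≥0∞)) (by fun_prop))).comp h4

lemma CostStructure.measurable_K (κ : CostStructure E) (hE : IsCompact E) : Measurable κ.K := by
  have := opensMeasurableSpace_of_isCompact hE
  exact κ.continuous_K.measurable

/-! ### The law of the play, one move at a time -/

section Play

variable {Ω T : Type*} [MeasurableSpace T] {E : Set (Ω → ProbabilityMeasure T)} {X : Ω → ℝ}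
  {n : ℕ} [NeZero n] {P : InfoStructure Ω n}

/-- The first `k` terms of a sequence. -/
def hist {α : Type*} (k : ℕ) (h : ℕ → α) : Fin k → α := fun j => h j

@[fun_prop]
lemma measurable_hist {α : Type*} [MeasurableSpace α] (k : ℕ) :
    Measurable (hist k : (ℕ → α) → Fin k → α) := by
  unfold hist
  fun_prop

lemma hist_succ {α : Type*} (k : ℕ) (h : ℕ → α) :
    hist (k + 1) h = Fin.snoc (α := fun _ => α) (hist k h) (h k) := by
  ext j
  refine Fin.lastCases ?_ (fun j => ?_) j <;> simp [hist]

@[fun_prop]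
lemma measurable_snoc {α : Type*} [MeasurableSpace α] (k : ℕ) :
    Measurable fun p : (Fin k → α) × α =>
      (Fin.snoc (α := fun _ => α) p.1 p.2 : Fin (k + 1) → α) := by
  refine measurable_pi_iff.2 fun j => ?_
  refine Fin.lastCases ?_ (fun j => ?_) j
  · simpa using measurable_snd
  · simp only [Fin.snoc_castSucc]
    fun_prop

instance (σ : ∀ i, Strategy E X P i) (ω : Ω) : IsProbabilityMeasure (playLaw σ ω) := by
  unfold playLaw
  infer_instance

lemma map_eval_zero_playLaw (σ : ∀ i, Strategy E X P i) (ω : Ω) :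
    (playLaw σ ω).map (fun h => h 0) = stepKernel σ ω 0 Fin.elim0 := by
  have h0 : (fun h : ℕ → Move E X => h 0) =
      (fun x : ((_ : Finset.Iic 0) → Move E X) => x ⟨0, by simp⟩) ∘
        Preorder.frestrictLe (π := fun _ => Move E X) 0 := rfl
  rw [h0, ← Measure.map_map (by fun_prop) (by fun_prop), playLaw, Kernel.trajMeasure,
    Measure.map_comp _ _ (by fun_prop), Kernel.traj_map_frestrictLe, Kernel.partialTraj_self,
    Measure.id_comp, Measure.map_map (by fun_prop) (by fun_prop)]
  convert Measure.map_id
  rfl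

/-- Index `0` is separate because its move comes from the initial law of `trajMeasure`. Later moves
come from the Ionescu-Tulcea kernels, whose histories are indexed by `Finset.Iic k` and are
translated to `Fin (k + 1)`. -/
lemma lintegral_playLaw_step (σ : ∀ i, Strategy E X P i) (ω : Ω) (k : ℕ)
    {F : (Fin k → Move E X) × Move E X → ℝ≥0∞} (hF : Measurable F) :
    ∫⁻ h, F (hist k h, h k) ∂(playLaw σ ω) =
      ∫⁻ h, ∫⁻ x, F (hist k h, x) ∂(stepKernel σ ω k (hist k h)) ∂(playLaw σ ω) := by
  rcases k with _ | k
  · have h1 : ∀ h : ℕ → Move E X, hist 0 h = Fin.elim0 := fun h => Subsingleton.elim _ _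
    simp only [h1, lintegral_const, measure_univ, mul_one]
    rw [← map_eval_zero_playLaw, lintegral_map (by fun_prop) (by fun_prop)]
  · let e : ((_ : Finset.Iic k) → Move E X) → (Fin (k + 1) → Move E X) :=
      fun h j => h ⟨j, Finset.mem_Iic.2 (Nat.lt_succ_iff.1 j.2)⟩
    have he : Measurable e := by fun_prop
    have h1 := Kernel.map_frestrictLe_trajMeasure_compProd_eq_map_trajMeasure
      (X := fun _ => Move E X) (μ₀ := stepKernel σ ω 0 Fin.elim0) (κ := nextKernel σ ω) (a := k)
    have h2 := congrArg (fun ν => ∫⁻ p, F (e p.1, p.2) ∂ν) h1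
    beta_reduce at h2
    rw [Measure.lintegral_compProd (by fun_prop),
      lintegral_map (Measurable.lintegral_kernel_prod_right (f := fun a b => F (e a, b))
        (by fun_prop)) (by fun_prop), lintegral_map (by fun_prop) (by fun_prop)] at h2
    exact h2.symm

lemma map_hist_step (σ : ∀ i, Strategy E X P i) (ω : Ω) (k : ℕ) :
    (playLaw σ ω).map (fun h => (hist k h, h k)) =
      ((playLaw σ ω).map (hist k)) ⊗ₘ stepKernel σ ω k := by
  refine Measure.ext_of_lintegral _ fun F hF => ?_
  rw [lintegral_map hF (by fun_prop), Measure.lintegral_compProd hF,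
    lintegral_map (Measurable.lintegral_kernel_prod_right (f := fun a b => F (a, b)) hF)
      (by fun_prop)]
  exact lintegral_playLaw_step σ ω k hF

lemma integral_playLaw_step (σ : ∀ i, Strategy E X P i) (ω : Ω) (k : ℕ)
    {F : (Fin k → Move E X) × Move E X → ℝ} (hF : Measurable F) {B : ℝ} (hB : ∀ p, |F p| ≤ B) :
    ∫ h, F (hist k h, h k) ∂(playLaw σ ω) =
      ∫ h, ∫ x, F (hist k h, x) ∂(stepKernel σ ω k (hist k h)) ∂(playLaw σ ω) := by
  have hi : ∀ ν : Measure ((Fin k → Move E X) × Move E X), IsFiniteMeasure ν → Integrable F ν :=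
    fun ν _ => Integrable.of_bound hF.aestronglyMeasurable B (.of_forall hB)
  rw [← integral_map (φ := fun h => (hist k h, h k)) (f := F) (by fun_prop)
    hF.aestronglyMeasurable, map_hist_step, Measure.integral_compProd (hi _ inferInstance),
    integral_map (by fun_prop)]
  exact (StronglyMeasurable.integral_kernel_prod_right (f := fun a b => F (a, b))
    hF.stronglyMeasurable).aestronglyMeasurable

/-- The law of a move, as the image of the uniform draw and the signal realization. -/
lemma stepKernel_apply (σ : ∀ i, Strategy E X P i) (ω : Ω) (k : ℕ) (h : Fin k → Move E X) :
    stepKernel σ ω k h =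
      ((volume : Measure unitInterval) ⊗ₘ (realize E ω).comap (fun u => chosenSignal σ ω k (h, u))
        ((measurable_chosenSignal σ ω k).comp measurable_prodMk_left)).map
        (fun p => resultingMove σ ω k (h, p)) := by
  have hm := measurable_resultingMove σ ω k
  refine Measure.ext_of_lintegral _ fun F hF => ?_
  rw [stepKernel, Kernel.lintegral_map _ hm _ hF, lintegral_map hF (by fun_prop),
    Kernel.prod_apply, Kernel.id_apply, lintegral_prod _ (by fun_prop),
    lintegral_dirac' _ (by fun_prop)]
  rw [Kernel.lintegral_compProd _ _ _ (by fun_prop), Measure.lintegral_compProd (by fun_prop)]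
  rfl

lemma integral_stepKernel (σ : ∀ i, Strategy E X P i) (ω : Ω) (k : ℕ) (h : Fin k → Move E X)
    {F : Move E X → ℝ} (hF : Measurable F) {B : ℝ} (hB : ∀ p, |F p| ≤ B) :
    ∫ x, F x ∂(stepKernel σ ω k h) =
      ∫ u : unitInterval, ∫ τ, F (resultingMove σ ω k (h, (u, τ)))
        ∂(law E (chosenSignal σ ω k (h, u)) ω) := by
  have hm := measurable_resultingMove σ ω k
  rw [stepKernel_apply, integral_map (by fun_prop) hF.aestronglyMeasurable,
    Measure.integral_compProd (Integrable.of_bound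
      (Measurable.aestronglyMeasurable (by fun_prop)) B (.of_forall fun _ => hB _))]
  rfl

lemma lintegral_stepKernel (σ : ∀ i, Strategy E X P i) (ω : Ω) (k : ℕ) (h : Fin k → Move E X)
    {F : Move E X → ℝ≥0∞} (hF : Measurable F) :
    ∫⁻ x, F x ∂(stepKernel σ ω k h) =
      ∫⁻ u : unitInterval, ∫⁻ τ, F (resultingMove σ ω k (h, (u, τ)))
        ∂(law E (chosenSignal σ ω k (h, u)) ω) := by
  have hm := measurable_resultingMove σ ω k
  rw [stepKernel_apply, lintegral_map hF (by fun_prop), Measure.lintegral_compProd (by fun_prop)]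
  rfl

lemma stepKernel_congr {σ σ' : ∀ i, Strategy E X P i} {ω : Ω} {k : ℕ}
    (h1 : ∀ p, chosenSignal σ ω k p = chosenSignal σ' ω k p)
    (h2 : ∀ p, resultingMove σ ω k p = resultingMove σ' ω k p) :
    stepKernel σ ω k = stepKernel σ' ω k := by
  ext1 g
  refine Measure.ext_of_lintegral _ fun F hF => ?_
  simp only [lintegral_stepKernel _ _ _ _ hF, h1, h2]

/-- The first `m` moves are built from the first `m` kernels only. Hence a deviation starting at
index `m` leaves the law of the past unchanged. -/
lemma map_hist_congr {σ σ' : ∀ i, Strategy E X P i} {ω : Ω} {m : ℕ}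
    (h : ∀ k < m, stepKernel σ ω k = stepKernel σ' ω k) :
    (playLaw σ ω).map (hist m) = (playLaw σ' ω).map (hist m) := by
  induction m with
  | zero =>
    have h1 : (hist 0 : (ℕ → Move E X) → _) = fun _ => Fin.elim0 :=
      funext fun h => Subsingleton.elim _ _
    simp [h1, Measure.map_const]
  | succ m ih =>
    have h2 : (hist (m + 1) : (ℕ → Move E X) → _) =
        (fun p : (Fin m → Move E X) × Move E X => (Fin.snoc p.1 p.2 : Fin (m + 1) → Move E X)) ∘
          fun h => (hist m h, h m) :=
      funext fun h => hist_succ m h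
    have h3 := measurable_snoc (α := Move E X) m
    rw [h2, ← Measure.map_map h3 (by fun_prop), ← Measure.map_map h3 (by fun_prop),
      map_hist_step, map_hist_step, ih fun k hk => h k (by lia), h m (by lia)]

/-- What holds surely for the move at index `k` holds almost surely along the play. -/
lemma ae_playLaw_of_resultingMove (σ : ∀ i, Strategy E X P i) (ω : Ω) (k : ℕ)
    {S : Set ((Fin k → Move E X) × Move E X)} (hS : MeasurableSet S)
    (h : ∀ g u τ, (g, resultingMove σ ω k (g, (u, τ))) ∈ S) :
    ∀ᵐ x ∂(playLaw σ ω), (hist k x, x k) ∈ S := by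
  have h1 : ∫⁻ x, Sᶜ.indicator 1 (hist k x, x k) ∂(playLaw σ ω) = 0 := by
    rw [lintegral_playLaw_step σ ω k (measurable_one.indicator hS.compl)]
    refine lintegral_eq_zero_of_ae_eq_zero (.of_forall fun x => ?_)
    simp only [Pi.zero_apply]
    rw [lintegral_stepKernel σ ω k _ (F := fun y => Sᶜ.indicator 1 (hist k x, y))
      ((measurable_one.indicator hS.compl).comp measurable_prodMk_left)]
    simp [h]
  rw [lintegral_eq_zero_iff (f := fun x => Sᶜ.indicator 1 (hist k x, x k))
    ((measurable_one.indicator hS.compl).comp (by fun_prop))] at h1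
  filter_upwards [h1] with x hx
  by_contra hc
  simp [Set.indicator_of_mem, hc] at hx

end Play

/-! ### Continuity and boundedness of scores -/

section Scores

variable {Ω : Type*} [Fintype Ω] {X : Ω → ℝ} {s : ℝ → ℝ → ℝ}

lemma mem_predictions (X : Ω → ℝ) (ω : Ω) : X ω ∈ predictions X :=
  ⟨ciInf_le (Set.finite_range X).bddBelow ω, le_ciSup (Set.finite_range X).bddAbove ω⟩

instance : CompactSpace (predictions X) := isCompact_iff_compactSpace.1 isCompact_Icc

lemma expect_mem_predictions {γ : Ω → ℝ} (hγ : γ ∈ stdSimplex ℝ Ω) :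
    expect γ X ∈ predictions X := by
  have h := (convex_Icc (⨅ ω, X ω) (⨆ ω, X ω)).sum_mem (t := Finset.univ) (w := γ) (z := X)
    (fun ω _ => hγ.1 ω) hγ.2 (fun ω _ => mem_predictions X ω)
  simpa [expect, predictions] using h

lemma IsScoringRule.continuous (hs : IsScoringRule X s) (ω : Ω) :
    Continuous fun y : predictions X => s y (X ω) :=
  continuousOn_iff_continuous_domRestrict.1 (hs.continuousOn _ (mem_predictions X ω))

lemma IsScoringRule.exists_bound (hs : IsScoringRule X s) :
    ∃ A : ℝ, 0 ≤ A ∧ ∀ (y : predictions X) (ω : Ω), |s y (X ω)| ≤ A := by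
  have h1 : ∀ ω, ∃ A : ℝ, ∀ y : predictions X, |s y (X ω)| ≤ A := fun ω => by
    obtain ⟨A, hA⟩ := isCompact_univ.exists_bound_of_continuousOn (hs.continuous ω).continuousOn
    exact ⟨A, fun y => hA y trivial⟩
  choose A hA using h1
  refine ⟨∑ ω, |A ω|, Finset.sum_nonneg fun _ _ => abs_nonneg _, fun y ω => ?_⟩
  exact ((hA ω y).trans (le_abs_self _)).trans
    (Finset.single_le_sum (f := fun ω => |A ω|) (fun _ _ => abs_nonneg _) (Finset.mem_univ ω))

end Scores

/-! ### Payoffs in terms of expected scores and expected costs -/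

section Payoffs

variable {Ω T : Type*} [MeasurableSpace T] {E : Set (Ω → ProbabilityMeasure T)} {X : Ω → ℝ}
  {n : ℕ} [NeZero n] {P : InfoStructure Ω n}

/-- The current price after the announcements `z`, when the market maker started with `y₀`. -/
def lastPrice (y₀ : predictions X) : (k : ℕ) → (Fin k → predictions X) → predictions X
  | 0, _ => y₀
  | k + 1, z => z (Fin.last k)

@[fun_prop]
lemma measurable_lastPrice (y₀ : predictions X) (k : ℕ) : Measurable (lastPrice y₀ k) := by
  cases k <;> unfold lastPrice <;> fun_prop

/-- The public part of a history. -/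
def announcements {k : ℕ} (h : Fin k → Move E X) : Fin k → predictions X := fun j => (h j).2

@[fun_prop]
lemma measurable_announcements (k : ℕ) :
    Measurable (announcements : (Fin k → Move E X) → Fin k → predictions X) := by
  unfold announcements
  fun_prop

lemma price_eq_lastPrice (y₀ : predictions X) (k : ℕ) (h : ℕ → Move E X) :
    price (y₀ : ℝ) k h = lastPrice y₀ k (announcements (hist k h)) := by
  cases k <;> rfl

/-- If the mover at index `k` surely repeats the previous announcement, then the price does not
change. -/
lemma ae_price_succ_of_repeat (y₀ : predictions X) {σ : ∀ i, Strategy E X P i} {ω : Ω} {k : ℕ}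
    (h : ∀ g u τ, (resultingMove σ ω k (g, (u, τ))).2 = lastPrice y₀ k (announcements g)) :
    ∀ᵐ x ∂(playLaw σ ω), price (y₀ : ℝ) (k + 1) x = price (y₀ : ℝ) k x := by
  have := ae_playLaw_of_resultingMove σ ω k
    (S := {p | p.2.2 = lastPrice y₀ k (announcements p.1)})
    (measurableSet_eq_fun (by fun_prop) (by fun_prop)) h
  filter_upwards [this] with x hx
  rw [price_eq_lastPrice y₀ k]
  exact congrArg Subtype.val hx

variable [Fintype Ω]

lemma lintegral_gameLaw [MeasurableSpace Ω] [MeasurableSingletonClass Ω] (μ : Ω → ℝ)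
    (σ : ∀ i, Strategy E X P i) {f : Ω × (ℕ → Move E X) → ℝ≥0∞} (hf : Measurable f) :
    ∫⁻ p, f p ∂(gameLaw μ σ) = ∑ ω, ENNReal.ofReal (μ ω) * ∫⁻ h, f (ω, h) ∂(playLaw σ ω) := by
  rw [gameLaw, lintegral_finsetSum_measure]
  refine Finset.sum_congr rfl fun ω _ => ?_
  rw [lintegral_smul_measure, Measure.dirac_prod, lintegral_map hf (by fun_prop), smul_eq_mul]

lemma integral_gameLaw [MeasurableSpace Ω] [MeasurableSingletonClass Ω] {μ : Ω → ℝ}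
    (hμ : μ ∈ stdSimplex ℝ Ω) (σ : ∀ i, Strategy E X P i) {f : Ω × (ℕ → Move E X) → ℝ}
    (hf : Measurable f) {B : ℝ} (hB : ∀ p, |f p| ≤ B) :
    ∫ p, f p ∂(gameLaw μ σ) = ∑ ω, μ ω * ∫ h, f (ω, h) ∂(playLaw σ ω) := by
  rw [gameLaw, integral_finsetSum_measure]
  · refine Finset.sum_congr rfl fun ω _ => ?_
    rw [integral_smul_measure, Measure.dirac_prod,
      integral_map (by fun_prop) hf.aestronglyMeasurable, smul_eq_mul,
      ENNReal.toReal_ofReal (hμ.1 ω)]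
  · intro ω _
    exact (Integrable.of_bound hf.aestronglyMeasurable B (.of_forall hB)).smul_measure
      ENNReal.ofReal_ne_top

lemma isProbabilityMeasure_gameLaw [MeasurableSpace Ω] {μ : Ω → ℝ} (hμ : μ ∈ stdSimplex ℝ Ω)
    (σ : ∀ i, Strategy E X P i) : IsProbabilityMeasure (gameLaw μ σ) := by
  refine ⟨?_⟩
  simp only [gameLaw, Measure.coe_finsetSum, Finset.sum_apply, Measure.smul_apply, measure_univ,
    smul_eq_mul, mul_one]
  rw [← ENNReal.ofReal_sum_of_nonneg fun ω _ => hμ.1 ω, hμ.2, ENNReal.ofReal_one]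

/-- The expected score of the price at time `k`. -/
def meanScore (s : ℝ → ℝ → ℝ) (y₀ : ℝ) (μ : Ω → ℝ) (σ : ∀ i, Strategy E X P i) (k : ℕ) : ℝ :=
  ∑ ω, μ ω * ∫ h, s (price y₀ k h) (X ω) ∂(playLaw σ ω)

lemma meanScore_zero (s : ℝ → ℝ → ℝ) (y₀ : ℝ) (μ : Ω → ℝ) (σ : ∀ i, Strategy E X P i) :
    meanScore s y₀ μ σ 0 = ∑ ω, μ ω * s y₀ (X ω) := by
  simp [meanScore, price]

lemma measurable_score_price {s : ℝ → ℝ → ℝ} (hs : IsScoringRule X s) (y₀ : predictions X) (k : ℕ)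
    (ω : Ω) : Measurable fun h : ℕ → Move E X => s (price (y₀ : ℝ) k h) (X ω) := by
  simp only [price_eq_lastPrice]
  exact (hs.continuous ω).measurable.comp (by fun_prop)

lemma measurable_score_price_prod [MeasurableSpace Ω] [MeasurableSingletonClass Ω]
    {s : ℝ → ℝ → ℝ} (hs : IsScoringRule X s) (y₀ : predictions X) (k : ℕ) :
    Measurable fun p : Ω × (ℕ → Move E X) => s (price (y₀ : ℝ) k p.2) (X p.1) :=
  measurable_from_prod_countable_right fun ω => measurable_score_price hs y₀ k ω

lemma meanScore_congr (y₀ : predictions X) {s : ℝ → ℝ → ℝ} (hs : IsScoringRule X s) (μ : Ω → ℝ)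
    {σ σ' : ∀ i, Strategy E X P i} {m : ℕ}
    (h : ∀ ω, ∀ k < m, stepKernel σ ω k = stepKernel σ' ω k) :
    meanScore s y₀ μ σ m = meanScore s y₀ μ σ' m := by
  unfold meanScore
  refine Finset.sum_congr rfl fun ω _ => ?_
  have hm : ∀ σ : ∀ i, Strategy E X P i, ∫ h, s (price (y₀ : ℝ) m h) (X ω) ∂(playLaw σ ω) =
      ∫ g, s (lastPrice y₀ m (announcements g)) (X ω) ∂((playLaw σ ω).map (hist m)) := fun σ => by
    rw [integral_map (by fun_prop)]
    · simp only [price_eq_lastPrice]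
    · exact ((hs.continuous ω).measurable.comp
        (g := fun y : predictions X => s y (X ω)) (by fun_prop)).aestronglyMeasurable
  rw [hm, hm, map_hist_congr (h ω)]

lemma abs_meanScore_le {s : ℝ → ℝ → ℝ} {A : ℝ}
    (hA : ∀ (y : predictions X) (ω : Ω), |s y (X ω)| ≤ A) (y₀ : predictions X)
    {μ : Ω → ℝ} (hμ : μ ∈ stdSimplex ℝ Ω) (σ : ∀ i, Strategy E X P i) (k : ℕ) :
    |meanScore s y₀ μ σ k| ≤ A := by
  have h1 : ∀ ω, |∫ h, s (price (y₀ : ℝ) k h) (X ω) ∂(playLaw σ ω)| ≤ A := fun ω => by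
    have := norm_integral_le_of_norm_le_const (μ := playLaw σ ω) (C := A)
      (f := fun h => s (price (y₀ : ℝ) k h) (X ω))
      (.of_forall fun h => by rw [price_eq_lastPrice]; exact hA _ _)
    simpa using this
  calc |meanScore s y₀ μ σ k| ≤ ∑ ω, μ ω * A := by
        refine (Finset.abs_sum_le_sum_abs _ _).trans (Finset.sum_le_sum fun ω _ => ?_)
        rw [abs_mul, abs_of_nonneg (hμ.1 ω)]
        exact mul_le_mul_of_nonneg_left (h1 ω) (hμ.1 ω)
    _ = A := by rw [← Finset.sum_mul, hμ.2, one_mul]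

lemma meanScore_succ_of_repeat (s : ℝ → ℝ → ℝ) (y₀ : predictions X) (μ : Ω → ℝ)
    {σ : ∀ i, Strategy E X P i} {k : ℕ}
    (h : ∀ ω g u τ, (resultingMove σ ω k (g, (u, τ))).2 = lastPrice y₀ k (announcements g)) :
    meanScore s y₀ μ σ (k + 1) = meanScore s y₀ μ σ k := by
  refine Finset.sum_congr rfl fun ω _ => ?_
  congr 1
  refine integral_congr_ae ?_
  filter_upwards [ae_price_succ_of_repeat y₀ (h ω)] with x hx
  rw [hx]

variable [MetricSpace T] [SecondCountableTopology T] [BorelSpace T]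

/-- The expected cost (per unit of `c`) of the signal bought at index `k`. -/
def meanCost (κ : CostStructure E) (μ : Ω → ℝ) (σ : ∀ i, Strategy E X P i) (k : ℕ) : ℝ≥0∞ :=
  ∑ ω, ENNReal.ofReal (μ ω) * ∫⁻ h, κ.K (h k).1.1 ∂(playLaw σ ω)

/-- Scores are bounded, so expectations can be taken date by date. Payoffs thus depend on the play
only through the sequences `meanScore` and `meanCost`; the latter stays in `[0, ∞]`, since an
arbitrary strategy may be infinitely costly. -/
lemma payoffUpTo_eq [MeasurableSpace Ω] [MeasurableSingletonClass Ω] {κ : CostStructure E}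
    (hE : IsCompact E) {s : ℝ → ℝ → ℝ} (hs : IsScoringRule X s) (y₀ : predictions X) (β : ℝ)
    {μ : Ω → ℝ} (hμ : μ ∈ stdSimplex ℝ Ω) (σ : ∀ i, Strategy E X P i) (i : Fin n) (m : ℕ) :
    payoffUpTo κ s y₀ β μ σ i m =
      ((∑ k ∈ Finset.range m with turn n k = i,
        β ^ (k + 1) * (meanScore s y₀ μ σ (k + 1) - meanScore s y₀ μ σ k) : ℝ) : EReal) -
      ((∑ k ∈ Finset.range m with turn n k = i,
        ENNReal.ofReal (β ^ (k + 1) * κ.c) * meanCost κ μ σ k : ℝ≥0∞) : EReal) := by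
  have := isProbabilityMeasure_gameLaw hμ σ
  have hK := κ.measurable_K hE
  obtain ⟨A, hA0, hA⟩ := hs.exists_bound
  have hA' : ∀ k (p : Ω × (ℕ → Move E X)), |s (price (y₀ : ℝ) k p.2) (X p.1)| ≤ A := fun k p => by
    rw [price_eq_lastPrice]
    exact hA _ _
  have hinteg : ∀ k, Integrable (fun p : Ω × (ℕ → Move E X) => s (price (y₀ : ℝ) k p.2) (X p.1))
      (gameLaw μ σ) := fun k =>
    Integrable.of_bound (measurable_score_price_prod hs y₀ k).aestronglyMeasurable A
      (.of_forall (hA' k))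
  have hmean : ∀ k, ∫ p, s (price (y₀ : ℝ) k p.2) (X p.1) ∂(gameLaw μ σ) =
      meanScore s y₀ μ σ k := fun k =>
    integral_gameLaw hμ σ (measurable_score_price_prod hs y₀ k) (hA' k)
  unfold payoffUpTo
  congr 2
  · rw [integral_finsetSum]
    swap
    · exact fun k _ => ((hinteg _).sub (hinteg _)).const_mul _
    refine Finset.sum_congr rfl fun k _ => ?_
    rw [integral_const_mul, integral_sub (hinteg _) (hinteg _), hmean, hmean]
  · rw [lintegral_finsetSum _ fun k _ => by fun_prop]
    refine Finset.sum_congr rfl fun k _ => ?_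
    rw [lintegral_const_mul _ (by fun_prop), lintegral_gameLaw _ _ (by fun_prop)]
    rfl

end Payoffs

/-! ### One-shot plans -/

section Plans

variable {Ω T : Type*} [MeasurableSpace T] [MetricSpace T] [BorelSpace T]
  {E : Set (Ω → ProbabilityMeasure T)} {X : Ω → ℝ}

/-- A one-shot plan: a signal of finite cost and an announcement for each of its realizations. -/
structure Plan (κ : CostStructure E) (X : Ω → ℝ) where
  signal : E
  announce : T → predictions X
  measurable_announce : Measurable announce
  cost_ne_top : κ.K signal ≠ ∞

/-- The expected score of a plan in the state `ω`, net of the cost of its signal. -/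
def Plan.value {κ : CostStructure E} (θ : Plan κ X) (s : ℝ → ℝ → ℝ) (ω : Ω) : ℝ :=
  ∫ τ, s (θ.announce τ) (X ω) ∂(law E θ.signal ω) - κ.c * (κ.K θ.signal).toReal

/-- A free uninformative signal. -/
def CostStructure.free (κ : CostStructure E) : E := κ.exists_free.choose

lemma CostStructure.K_free (κ : CostStructure E) : κ.K κ.free = 0 :=
  κ.exists_free.choose_spec.2.1

instance (R : E) (ω : Ω) : IsProbabilityMeasure (law E R ω) := (R.1 ω).2

/-- The plan announcing `y` without acquiring information. -/
def Plan.const (κ : CostStructure E) (y : predictions X) : Plan κ X where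
  signal := κ.free
  announce _ := y
  measurable_announce := measurable_const
  cost_ne_top := by simp [κ.K_free]

@[simp]
lemma Plan.value_const (κ : CostStructure E) (y : predictions X) (s : ℝ → ℝ → ℝ) (ω : Ω) :
    (Plan.const κ y).value s ω = s y (X ω) := by
  simp [Plan.value, Plan.const, κ.K_free]

lemma Plan.abs_integral_le {κ : CostStructure E} {s : ℝ → ℝ → ℝ} {A : ℝ}
    (hA : ∀ (y : predictions X) (ω : Ω), |s y (X ω)| ≤ A) (θ : Plan κ X) (ω : Ω) :
    |∫ τ, s (θ.announce τ) (X ω) ∂(law E θ.signal ω)| ≤ A := by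
  simpa using norm_integral_le_of_norm_le_const (μ := law E θ.signal ω) (C := A)
      (f := fun τ => s (θ.announce τ) (X ω)) (.of_forall fun τ => hA _ _)

end Plans

/-! ### Deviations that carry out one plan and then stop -/

section Deviation

variable {Ω T : Type*} [MeasurableSpace T] [MetricSpace T] [BorelSpace T]
  {E : Set (Ω → ProbabilityMeasure T)} {X : Ω → ℝ} {n : ℕ} [NeZero n] {P : InfoStructure Ω n}
  {κ : CostStructure E}

/-- The strategy which follows `d` before index `m`, carries out the plan `θ` at index `m` if the
past announcements are in `W m`, and otherwise repeats the previous announcement without acquiring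
information. -/
def deviate {i : Fin n} (d : Strategy E X P i) (y₀ : predictions X) (m : ℕ)
    (W : ∀ k, Set (Fin k → predictions X)) (hW : ∀ k, MeasurableSet (W k))
    (θ : Quotient (P.part i) → Plan κ X) : Strategy E X P i := by
  classical
  exact
  { signal := fun k q p =>
      if k < m then d.signal k q p else if k = m ∧ p.1.1 ∈ W k then (θ q).signal else κ.free
    announce := fun k q p =>
      if k < m then d.announce k q p else if k = m ∧ p.1.1.1 ∈ W k then (θ q).announce p.2
      else lastPrice y₀ k p.1.1.1
    measurable_signal := fun k q => by
      have := d.measurable_signal k q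
      refine Measurable.ite (.const _) this (Measurable.ite ?_ measurable_const measurable_const)
      exact (MeasurableSet.const _).inter (measurableSet_preimage (by fun_prop) (hW k))
    measurable_announce := fun k q => by
      have h1 := d.measurable_announce k q
      have h2 := (θ q).measurable_announce
      refine Measurable.ite (.const _) h1 (Measurable.ite ?_ (by fun_prop) (by fun_prop))
      exact (MeasurableSet.const _).inter (measurableSet_preimage (by fun_prop) (hW k)) }

variable (σ : ∀ i, Strategy E X P i) {i : Fin n} (y₀ : predictions X) {m : ℕ}
    {W : ∀ k, Set (Fin k → predictions X)} (hW : ∀ k, MeasurableSet (W k))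
    (θ : Quotient (P.part i) → Plan κ X)

lemma stepKernel_deviate_of_lt (ω : Ω) {k : ℕ} (hk : k < m) :
    stepKernel (Function.update σ i (deviate (σ i) y₀ m W hW θ)) ω k = stepKernel σ ω k := by
  by_cases h : turn n k = i
  · subst h
    refine stepKernel_congr (fun p => ?_) fun p => ?_
    · simp [chosenSignal, deviate, hk]
    · simp [resultingMove, chosenSignal, deviate, hk]
  · refine stepKernel_congr (fun p => ?_) fun p => ?_
    · simp [chosenSignal, h]
    · simp [resultingMove, chosenSignal, h]

lemma chosenSignal_deviate_of_not {ω : Ω} {k : ℕ} (hk : m ≤ k) (hi : turn n k = i)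
    {g : Fin k → Move E X} (hg : ¬ (k = m ∧ announcements g ∈ W k)) (u : unitInterval) :
    chosenSignal (Function.update σ i (deviate (σ i) y₀ m W hW θ)) ω k (g, u) = κ.free := by
  subst hi
  unfold announcements at hg
  simp [chosenSignal, deviate, view, hk.not_gt, hg]

lemma resultingMove_deviate_of_not {ω : Ω} {k : ℕ} (hk : m ≤ k) (hi : turn n k = i)
    {g : Fin k → Move E X} (hg : ¬ (k = m ∧ announcements g ∈ W k)) (u : unitInterval) (τ : T) :
    resultingMove (Function.update σ i (deviate (σ i) y₀ m W hW θ)) ω k (g, (u, τ)) =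
      ((κ.free, τ), lastPrice y₀ k (announcements g)) := by
  rw [resultingMove, chosenSignal_deviate_of_not σ y₀ hW θ hk hi hg]
  subst hi
  unfold announcements at *
  simp [deviate, view, hk.not_gt, hg]

lemma chosenSignal_deviate_of_mem {ω : Ω} (hi : turn n m = i)
    {g : Fin m → Move E X} (hg : announcements g ∈ W m) (u : unitInterval) :
    chosenSignal (Function.update σ i (deviate (σ i) y₀ m W hW θ)) ω m (g, u) =
      (θ (Quotient.mk _ ω)).signal := by
  subst hi
  unfold announcements at hg
  simp [chosenSignal, deviate, view, hg]

lemma resultingMove_deviate_of_mem {ω : Ω} (hi : turn n m = i)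
    {g : Fin m → Move E X} (hg : announcements g ∈ W m) (u : unitInterval) (τ : T) :
    resultingMove (Function.update σ i (deviate (σ i) y₀ m W hW θ)) ω m (g, (u, τ)) =
      (((θ (Quotient.mk _ ω)).signal, τ), (θ (Quotient.mk _ ω)).announce τ) := by
  rw [resultingMove, chosenSignal_deviate_of_mem σ y₀ hW θ hi hg]
  subst hi
  unfold announcements at hg
  simp [deviate, view, hg]

/-- If the mover at index `k` surely buys a costless signal, then there is almost surely no cost. -/
lemma ae_cost_eq_zero_of_chosenSignal (hK : Measurable κ.K) {σ : ∀ i, Strategy E X P i} {ω : Ω}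
    {k : ℕ} (h : ∀ p, κ.K (chosenSignal σ ω k p) = 0) :
    ∀ᵐ x ∂(playLaw σ ω), κ.K (x k).1.1 = 0 :=
  ae_playLaw_of_resultingMove σ ω k (S := {p | κ.K p.2.1.1 = 0})
    (measurableSet_eq_fun (by fun_prop) (by fun_prop)) fun g u τ => h (g, u)

variable [Fintype Ω]

lemma meanCost_congr (hK : Measurable κ.K) (μ : Ω → ℝ) {σ σ' : ∀ i, Strategy E X P i} {m : ℕ}
    (h : ∀ ω, ∀ k ≤ m, stepKernel σ ω k = stepKernel σ' ω k) :
    meanCost κ μ σ m = meanCost κ μ σ' m := by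
  unfold meanCost
  refine Finset.sum_congr rfl fun ω _ => ?_
  have hm : ∀ σ : ∀ i, Strategy E X P i, ∫⁻ h, κ.K (h m).1.1 ∂(playLaw σ ω) =
      ∫⁻ g, κ.K (g (Fin.last m)).1.1 ∂((playLaw σ ω).map (hist (m + 1))) := fun σ => by
    rw [lintegral_map (by fun_prop) (by fun_prop)]
    simp [hist]
  rw [hm, hm, map_hist_congr fun k hk => h ω k (by lia)]

lemma meanCost_eq_zero (hK : Measurable κ.K) (μ : Ω → ℝ) {σ : ∀ i, Strategy E X P i} {k : ℕ}
    (h : ∀ ω p, κ.K (chosenSignal σ ω k p) = 0) : meanCost κ μ σ k = 0 := by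
  refine Finset.sum_eq_zero fun ω _ => ?_
  rw [lintegral_congr_ae (ae_cost_eq_zero_of_chosenSignal hK (h ω))]
  simp

/-- The expected payoff at index `m` from carrying out the plan `θ` if the announcements so far
are in `W`, instead of repeating the previous announcement. -/
def gain (s : ℝ → ℝ → ℝ) (μ : Ω → ℝ) (m : ℕ) (W : Set (Fin m → predictions X)) : ℝ :=
  ∑ ω, μ ω * ∫ h, W.indicator
    (fun z => (θ (Quotient.mk _ ω)).value s ω - s (lastPrice y₀ m z) (X ω))
    (announcements (hist m h)) ∂(playLaw σ ω)

/-- Where the announcements are in `W m` the plan is carried out; elsewhere the price is repeated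
for free and nothing is earned. The cost is finite because signals of plans have finite cost. -/
lemma deviate_at_gain {s : ℝ → ℝ → ℝ} (hs : IsScoringRule X s) (hK : Measurable κ.K) {μ : Ω → ℝ}
    (hμ : μ ∈ stdSimplex ℝ Ω) (hi : turn n m = i) :
    meanCost κ μ (Function.update σ i (deviate (σ i) y₀ m W hW θ)) m ≠ ∞ ∧
    meanScore s y₀ μ (Function.update σ i (deviate (σ i) y₀ m W hW θ)) (m + 1) -
      meanScore s y₀ μ (Function.update σ i (deviate (σ i) y₀ m W hW θ)) m -
      κ.c * (meanCost κ μ (Function.update σ i (deviate (σ i) y₀ m W hW θ)) m).toReal =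
      gain σ y₀ θ s μ m (W m) := by
  classical
  set σ' := Function.update σ i (deviate (σ i) y₀ m W hW θ) with hσ'
  obtain ⟨A, hA0, hA⟩ := hs.exists_bound
  have hstep : ∀ ω, ∀ k < m, stepKernel σ' ω k = stepKernel σ ω k := fun ω k hk =>
    stepKernel_deviate_of_lt σ y₀ hW θ ω hk
  let D : Set (ℕ → Move E X) := {h | announcements (hist m h) ∈ W m}
  have hD : MeasurableSet D := measurableSet_preimage (by fun_prop) (hW m)
  let pl : Ω → Plan κ X := fun ω => θ (Quotient.mk _ ω)
  let q : Ω → ℝ := fun ω => ∫ τ, s ((pl ω).announce τ) (X ω) ∂(law E (pl ω).signal ω)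
  have hcost : ∀ ω, ∫⁻ h, κ.K (h m).1.1 ∂(playLaw σ' ω) =
      κ.K (pl ω).signal * playLaw σ' ω D := fun ω => by
    rw [lintegral_playLaw_step σ' ω m (F := fun p => κ.K p.2.1.1) (by fun_prop)]
    have h1 : ∀ h : ℕ → Move E X, ∫⁻ x, κ.K x.1.1 ∂(stepKernel σ' ω m (hist m h)) =
        D.indicator (fun _ => κ.K (pl ω).signal) h := fun h => by
      rw [lintegral_stepKernel σ' ω m _ (F := fun x => κ.K x.1.1) (by fun_prop)]
      by_cases hh : h ∈ D
      · simp only [hσ', resultingMove_deviate_of_mem σ y₀ hW θ hi hh, Set.indicator_of_mem hh]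
        simp [pl]
      · have hh' : ¬ (m = m ∧ announcements (hist m h) ∈ W m) := fun hc => hh hc.2
        simp only [hσ', resultingMove_deviate_of_not σ y₀ hW θ le_rfl hi hh',
          Set.indicator_of_notMem hh]
        simp [κ.K_free]
    simp only [h1]
    rw [lintegral_indicator hD, setLIntegral_const]
  have hscore : ∀ ω, ∫ h, s (price (y₀ : ℝ) (m + 1) h) (X ω) ∂(playLaw σ' ω) =
      ∫ h, s (price (y₀ : ℝ) m h) (X ω) ∂(playLaw σ' ω) +
      ∫ h, D.indicator (fun h => q ω - s (price (y₀ : ℝ) m h) (X ω)) h ∂(playLaw σ' ω) := by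
    intro ω
    have hm := (hs.continuous ω).measurable
    have hp := measurable_score_price (E := E) hs y₀ m ω
    have hpA : ∀ h : ℕ → Move E X, |s (price (y₀ : ℝ) m h) (X ω)| ≤ A := fun h => by
      rw [price_eq_lastPrice]; exact hA _ _
    have h0 : ∫ h, s (price (y₀ : ℝ) (m + 1) h) (X ω) ∂(playLaw σ' ω) =
        ∫ h, ∫ x, s (x.2 : ℝ) (X ω) ∂(stepKernel σ' ω m (hist m h)) ∂(playLaw σ' ω) :=
      integral_playLaw_step σ' ω m (F := fun p => s p.2.2 (X ω))
        (hm.comp (g := fun y : predictions X => s y (X ω)) (by fun_prop)) fun p => hA _ _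
    rw [h0, ← integral_add]
    · refine integral_congr_ae (.of_forall fun h => ?_)
      beta_reduce
      rw [integral_stepKernel σ' ω m _ (F := fun x => s x.2 (X ω))
        (hm.comp (g := fun y : predictions X => s y (X ω)) (by fun_prop)) fun p => hA _ _]
      by_cases hh : h ∈ D
      · simp only [hσ', resultingMove_deviate_of_mem σ y₀ hW θ hi hh, Set.indicator_of_mem hh,
          chosenSignal_deviate_of_mem σ y₀ hW θ hi hh]
        simp [pl, q]
      · have hh' : ¬ (m = m ∧ announcements (hist m h) ∈ W m) := fun hc => hh hc.2
        simp only [hσ', resultingMove_deviate_of_not σ y₀ hW θ le_rfl hi hh',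
          Set.indicator_of_notMem hh]
        simp [price_eq_lastPrice]
    · exact Integrable.of_bound hp.aestronglyMeasurable A (.of_forall hpA)
    · refine Integrable.indicator (Integrable.of_bound
        (measurable_const.sub hp).aestronglyMeasurable (A + A) (.of_forall fun h => ?_)) hD
      exact (abs_sub _ _).trans (add_le_add ((pl ω).abs_integral_le hA ω) (hpA h))
  have hcostne : meanCost κ μ σ' m ≠ ∞ := by
    refine (ENNReal.sum_lt_top.2 fun ω _ => ?_).ne
    rw [hcost]
    exact ENNReal.mul_lt_top ENNReal.ofReal_lt_top
      (ENNReal.mul_lt_top (pl ω).cost_ne_top.lt_top (measure_lt_top _ _))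
  refine ⟨hcostne, ?_⟩
  have hcostreal : (meanCost κ μ σ' m).toReal =
      ∑ ω, μ ω * ((κ.K (pl ω).signal).toReal * (playLaw σ' ω).real D) := by
    rw [meanCost, ENNReal.toReal_sum]
    · refine Finset.sum_congr rfl fun ω _ => ?_
      rw [hcost, ENNReal.toReal_mul, ENNReal.toReal_mul, ENNReal.toReal_ofReal (hμ.1 ω)]
      rfl
    · exact fun ω _ => (ENNReal.sum_ne_top.1 hcostne) ω (Finset.mem_univ _)
  rw [hcostreal, meanScore, meanScore, gain, ← Finset.sum_sub_distrib, Finset.mul_sum,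
    ← Finset.sum_sub_distrib]
  refine Finset.sum_congr rfl fun ω _ => ?_
  have hp := measurable_score_price (E := E) hs y₀ m ω
  -- The two profiles agree before index `m`, so the history has the same law under both.
  have hmap : ∫ h, (W m).indicator
      (fun z => (θ (Quotient.mk _ ω)).value s ω - s (lastPrice y₀ m z) (X ω))
      (announcements (hist m h)) ∂(playLaw σ ω) = ∫ h, (W m).indicator
      (fun z => (θ (Quotient.mk _ ω)).value s ω - s (lastPrice y₀ m z) (X ω))
      (announcements (hist m h)) ∂(playLaw σ' ω) := by
    have hmeas : Measurable ((W m).indicator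
        (fun z => (θ (Quotient.mk _ ω)).value s ω - s (lastPrice y₀ m z) (X ω))) :=
      (measurable_const.sub ((hs.continuous ω).measurable.comp
        (g := fun y : predictions X => s y (X ω)) (by fun_prop))).indicator (hW m)
    have h1 : ∀ σ : ∀ i, Strategy E X P i, ∫ h, (W m).indicator
        (fun z => (θ (Quotient.mk _ ω)).value s ω - s (lastPrice y₀ m z) (X ω))
        (announcements (hist m h)) ∂(playLaw σ ω) = ∫ g, (W m).indicator
        (fun z => (θ (Quotient.mk _ ω)).value s ω - s (lastPrice y₀ m z) (X ω))
        (announcements g) ∂((playLaw σ ω).map (hist m)) := fun σ => by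
      rw [integral_map (by fun_prop)]
      exact (hmeas.comp (by fun_prop)).aestronglyMeasurable
    rw [h1, h1, map_hist_congr (hstep ω)]
  rw [hscore, hmap]
  have hsplit : ∫ h, (W m).indicator
      (fun z => (θ (Quotient.mk _ ω)).value s ω - s (lastPrice y₀ m z) (X ω))
      (announcements (hist m h)) ∂(playLaw σ' ω) =
      ∫ h, D.indicator (fun h => q ω - s (price (y₀ : ℝ) m h) (X ω)) h ∂(playLaw σ' ω) -
      κ.c * ((κ.K (pl ω).signal).toReal * (playLaw σ' ω).real D) := by
    have h2 : κ.c * ((κ.K (pl ω).signal).toReal * (playLaw σ' ω).real D) =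
        ∫ h, D.indicator (fun _ => κ.c * (κ.K (pl ω).signal).toReal) h ∂(playLaw σ' ω) := by
      rw [integral_indicator hD, setIntegral_const, smul_eq_mul]
      ring
    rw [h2, ← integral_sub]
    · refine integral_congr_ae (.of_forall fun h => ?_)
      by_cases hh : h ∈ D
      · have hh' : announcements (hist m h) ∈ W m := hh
        simp only [Set.indicator_of_mem hh, Set.indicator_of_mem hh', Plan.value,
          price_eq_lastPrice, q, pl]
        ring
      · have hh' : announcements (hist m h) ∉ W m := hh
        simp [Set.indicator_of_notMem hh, Set.indicator_of_notMem hh']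
    · refine Integrable.indicator (Integrable.of_bound
        (measurable_const.sub hp).aestronglyMeasurable (A + A) (.of_forall fun h => ?_)) hD
      refine (abs_sub _ _).trans (add_le_add ((pl ω).abs_integral_le hA ω) ?_)
      rw [price_eq_lastPrice]
      exact hA _ _
    · exact (integrable_const _).indicator hD
  rw [hsplit]
  ring

end Deviation

/-- `C` is allowed to be infinite: it will be the cost incurred before a deviation, not yet known to
be finite. -/
lemma ereal_sub_add_split {a b : ℝ} {C D : ℝ≥0∞} (hD : D ≠ ∞) :
    ((a + b : ℝ) : EReal) - ((C + D : ℝ≥0∞) : EReal) =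
      ((a : ℝ) : EReal) - ((C : ℝ≥0∞) : EReal) + ((b - D.toReal : ℝ) : EReal) := by
  lift D to NNReal using hD
  induction C with
  | top => simp
  | coe C =>
    simp only [ENNReal.coe_toReal, EReal.coe_ennreal_add, EReal.coe_nnreal_eq_coe_real]
    norm_cast
    push_cast
    ring

/-! ### The payoff of a one-plan deviation -/

section DeviationPayoff

variable {Ω T : Type*} [Fintype Ω] [MeasurableSpace Ω] [MeasurableSingletonClass Ω]
  [MeasurableSpace T] [MetricSpace T] [BorelSpace T] [SecondCountableTopology T]
  {E : Set (Ω → ProbabilityMeasure T)} {X : Ω → ℝ} {n : ℕ} [NeZero n] {P : InfoStructure Ω n}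
  {κ : CostStructure E}

/-- Payoffs before `m` are unchanged and nothing accrues to the deviator after `m`. The value does
not depend on `M`, so the total payoff of the deviation is well defined even if `β = 1`. -/
lemma payoffUpTo_deviate (hE : IsCompact E) {s : ℝ → ℝ → ℝ} (hs : IsScoringRule X s)
    (y₀ : predictions X) {β : ℝ} (hβ : 0 < β) {μ : Ω → ℝ} (hμ : μ ∈ stdSimplex ℝ Ω)
    (σ : ∀ i, Strategy E X P i) {i : Fin n} {m : ℕ}
    {W : ∀ k, Set (Fin k → predictions X)} (hW : ∀ k, MeasurableSet (W k))
    (θ : Quotient (P.part i) → Plan κ X) {M : ℕ} (hM : m < M) :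
    payoffUpTo κ s y₀ β μ (Function.update σ i (deviate (σ i) y₀ m W hW θ)) i M =
      payoffUpTo κ s y₀ β μ σ i m +
        ((if turn n m = i then β ^ (m + 1) * gain σ y₀ θ s μ m (W m) else 0 : ℝ) : EReal) := by
  have hK := κ.measurable_K hE
  set σ' := Function.update σ i (deviate (σ i) y₀ m W hW θ) with hσ'
  have hstep : ∀ ω, ∀ k < m, stepKernel σ' ω k = stepKernel σ ω k := fun ω k hk =>
    stepKernel_deviate_of_lt σ y₀ hW θ ω hk
  have hscore : ∀ k ≤ m, meanScore s y₀ μ σ' k = meanScore s y₀ μ σ k := fun k hk =>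
    meanScore_congr y₀ hs μ fun ω j hj => hstep ω j (hj.trans_le hk)
  have hcost : ∀ k < m, meanCost κ μ σ' k = meanCost κ μ σ k := fun k hk =>
    meanCost_congr hK μ fun ω j hj => hstep ω j (hj.trans_lt hk)
  have hlate : ∀ k, m < k → turn n k = i →
      meanScore s y₀ μ σ' (k + 1) = meanScore s y₀ μ σ' k ∧ meanCost κ μ σ' k = 0 := by
    intro k hk hi
    have hn : ∀ g : Fin k → Move E X, ¬ (k = m ∧ announcements g ∈ W k) := fun g hg => by lia
    refine ⟨meanScore_succ_of_repeat s y₀ μ fun ω g u τ => ?_, meanCost_eq_zero hK μ fun ω p => ?_⟩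
    · rw [hσ', resultingMove_deviate_of_not σ y₀ hW θ hk.le hi (hn g)]
    · rw [hσ', chosenSignal_deviate_of_not σ y₀ hW θ hk.le hi (hn p.1), κ.K_free]
  have hmid := deviate_at_gain (m := m) σ y₀ hW θ hs hK hμ
  rw [payoffUpTo_eq hE hs y₀ β hμ, payoffUpTo_eq hE hs y₀ β hμ]
  -- Stated for a general monoid because it serves both the real scores and the costs in `[0, ∞]`.
  have key : ∀ {N : Type _} [AddCommMonoid N] (f f' : ℕ → N), (∀ k < m, f' k = f k) →
      (∀ k, m < k → turn n k = i → f' k = 0) →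
      ∑ k ∈ Finset.range M with turn n k = i, f' k =
        ∑ k ∈ Finset.range m with turn n k = i, f k + if turn n m = i then f' m else 0 := by
    intro N _ f f' h1 h2
    obtain ⟨r, rfl⟩ : ∃ r, M = (m + 1) + r := ⟨M - (m + 1), by lia⟩
    rw [Finset.sum_filter, Finset.sum_filter, Finset.sum_range_add, Finset.sum_range_succ,
      Finset.sum_eq_zero (s := Finset.range r), add_zero]
    · congr 1
      refine Finset.sum_congr rfl fun k hk => ?_
      rw [h1 k (Finset.mem_range.1 hk)]
    · intro k _
      split_ifs with h
      · exact h2 _ (by lia) h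
      · rfl
  rw [key (fun k => β ^ (k + 1) * (meanScore s y₀ μ σ (k + 1) - meanScore s y₀ μ σ k))
    _ (fun k hk => by rw [hscore k hk.le, hscore (k + 1) hk])
    (fun k hk hi => by rw [(hlate k hk hi).1]; simp),
    key (fun k => ENNReal.ofReal (β ^ (k + 1) * κ.c) * meanCost κ μ σ k)
    _ (fun k hk => by rw [hcost k hk]) (fun k hk hi => by rw [(hlate k hk hi).2]; simp)]
  rw [ereal_sub_add_split]
  · congr 2
    split_ifs with hi
    · rw [← (hmid hi).2, ENNReal.toReal_mul, ENNReal.toReal_ofReal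
        (mul_nonneg (by positivity) κ.c_pos.le)]
      ring
    · simp
  · split_ifs with hi
    · exact ENNReal.mul_ne_top ENNReal.ofReal_ne_top (hmid hi).1
    · simp

end DeviationPayoff

/-! ### Vanishing continuation gains -/

section Sequences

/-- Partial sums of discounted increments of a bounded sequence are bounded. -/
lemma sum_discounted_le {a : ℕ → ℝ} {A β : ℝ} (ha : ∀ k, |a k| ≤ A) (hβ : 0 < β) (hβ1 : β ≤ 1)
    (m : ℕ) : ∑ k ∈ Finset.range m, β ^ (k + 1) * (a (k + 1) - a k) ≤ 2 * A := by
  -- Summation by parts leaves `β ^ m * a m - a 0` and the sum of `(β ^ k - β ^ (k + 1)) * a k`,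
  -- whose nonnegative weights add up to `1 - β ^ m`.
  have h : ∑ k ∈ Finset.range m, β ^ (k + 1) * (a (k + 1) - a k) ≤
      β ^ m * a m - a 0 + (1 - β ^ m) * A := by
    induction m with
    | zero => simp
    | succ m ih =>
      rw [Finset.sum_range_succ]
      have h1 : a m ≤ A := (abs_le.1 (ha m)).2
      have h2 : β ^ (m + 1) ≤ β ^ m := pow_le_pow_of_le_one hβ.le hβ1 (Nat.le_succ m)
      nlinarith
  have h1 := abs_le.1 (ha m)
  have h2 := abs_le.1 (ha 0)
  have h3 : 0 < β ^ m := pow_pos hβ m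
  nlinarith

/-- If every trader's continuation payoff is nonnegative, then the gains available from a
one-shot deviation vanish asymptotically. -/
lemma exists_gain_bound {n : ℕ} [NeZero n] {a w : ℕ → ℝ} {A β : ℝ} (ha : ∀ k, |a k| ≤ A)
    (hβ : 0 < β) (hβ1 : β ≤ 1) (hw : ∀ k, w k ≤ β ^ (k + 1) * (a (k + 1) - a k))
    {u : Fin n → EReal}
    (hu : ∀ i, Tendsto (fun m => ((∑ k ∈ Finset.range m with turn n k = i, w k : ℝ) : EReal))
      atTop (𝓝 (u i)))
    (hle : ∀ i m, ((∑ k ∈ Finset.range m with turn n k = i, w k : ℝ) : EReal) ≤ u i) :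
    ∃ ε : ℕ → ℝ, Tendsto ε atTop (𝓝 0) ∧ ∀ m g,
      ((∑ k ∈ Finset.range m with turn n k = turn n m, w k : ℝ) : EReal) +
        ((β ^ (m + 1) * g : ℝ) : EReal) ≤ u (turn n m) → g ≤ ε m := by
  set p : Fin n → ℕ → ℝ := fun i m => ∑ k ∈ Finset.range m with turn n k = i, w k with hp
  set S : ℕ → ℝ := fun m => ∑ k ∈ Finset.range m, w k with hS
  have hsum : ∀ m, ∑ i, p i m = S m := fun m =>
    Finset.sum_fiberwise (Finset.range m) (turn n) w
  have hdisc : ∀ m r, ∑ j ∈ Finset.range r, w (m + j) ≤ β ^ m * (2 * A) := fun m r => by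
    calc ∑ j ∈ Finset.range r, w (m + j)
        ≤ ∑ j ∈ Finset.range r, β ^ m * (β ^ (j + 1) * (a (m + (j + 1)) - a (m + j))) := by
          refine Finset.sum_le_sum fun j _ => (hw _).trans (le_of_eq ?_)
          rw [← mul_assoc, ← pow_add]
          rfl
      _ ≤ β ^ m * (2 * A) := by
          rw [← Finset.mul_sum]
          exact mul_le_mul_of_nonneg_left
            (sum_discounted_le (a := fun k => a (m + k)) (fun k => ha _) hβ hβ1 r) (by positivity)
  have h0 : ∀ i, 0 ≤ u i := fun i => by simpa using hle i 0
  -- Eventually every trader has more than `-1`. If one of them exceeded `2 * A + n`, the sum over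
  -- all traders would exceed its bound `2 * A`.
  have htop : ∀ i, u i ≠ ⊤ := by
    intro i hi
    have h1 : ∀ j, ∀ᶠ m in atTop, (-1 : ℝ) < p j m := fun j => by
      have := (hu j).eventually (lt_mem_nhds (a := ((-1 : ℝ) : EReal))
        (lt_of_lt_of_le (by norm_cast) (h0 j)))
      filter_upwards [this] with m hm using by exact_mod_cast hm
    have h2 : ∀ᶠ m in atTop, 2 * A + n < p i m := by
      have := (hu i).eventually (lt_mem_nhds (a := ((2 * A + n : ℝ) : EReal))
        (hi ▸ EReal.coe_lt_top _))
      filter_upwards [this] with m hm using by exact_mod_cast hm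
    obtain ⟨m, hm1, hm2⟩ := ((eventually_all.2 h1).and h2).exists
    have h3 := hdisc 0 m
    simp only [zero_add, pow_zero, one_mul] at h3
    have h4 : ∑ j, p j m + n ≤ 2 * A + n := by rw [hsum]; linarith
    have h5 : ∑ j, (p j m + 1) ≤ 2 * A + n := by simpa [Finset.sum_add_distrib] using h4
    have h6 : p i m + 1 ≤ ∑ j, (p j m + 1) :=
      Finset.single_le_sum (f := fun j => p j m + 1) (fun j _ => by linarith [hm1 j])
        (Finset.mem_univ i)
    linarith
  have hbot : ∀ i, u i ≠ ⊥ := fun i => ((EReal.bot_lt_zero).trans_le (h0 i)).ne'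
  obtain ⟨v, hv⟩ : ∃ v : Fin n → ℝ, ∀ i, u i = v i :=
    ⟨fun i => (u i).toReal, fun i => (EReal.coe_toReal (htop i) (hbot i)).symm⟩
  simp only [hv] at hu hle ⊢
  have hu' : ∀ i, Tendsto (p i) atTop (𝓝 (v i)) := fun i => EReal.tendsto_coe.1 (hu i)
  have hle' : ∀ i m, p i m ≤ v i := fun i m => by exact_mod_cast hle i m
  set U : ℝ := ∑ i, v i with hU
  have hSU : Tendsto S atTop (𝓝 U) := by
    have := tendsto_finsetSum Finset.univ fun i (_ : i ∈ Finset.univ) => hu' i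
    exact this.congr hsum
  have hpow : ∀ m : ℕ, 0 < β ^ m := fun m => pow_pos hβ m
  have hSle : ∀ m, S m ≤ U := fun m => by
    rw [← hsum]
    exact Finset.sum_le_sum fun i _ => hle' i m
  -- `U - S m` is the sum of the traders' remaining payoffs. Each is nonnegative, so this sum
  -- dominates the remaining payoff of the mover alone.
  refine ⟨fun m => (U - S m) / β ^ (m + 1), ?_, fun m g hg => ?_⟩
  swap
  · have hg' : p (turn n m) m + β ^ (m + 1) * g ≤ v (turn n m) := by exact_mod_cast hg
    rw [le_div_iff₀ (hpow _)]
    have : v (turn n m) - p (turn n m) m ≤ ∑ i, (v i - p i m) :=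
      Finset.single_le_sum (f := fun i => v i - p i m) (fun i _ => by linarith [hle' i m])
        (Finset.mem_univ _)
    rw [Finset.sum_sub_distrib, hsum] at this
    linarith
  -- For `β < 1` the denominator tends to `0` as well, so convergence of `S` is not enough; instead
  -- `ε` is shown to be summable. For `β = 1` it is enough.
  rcases hβ1.lt_or_eq with hlt | rfl
  · set ε : ℕ → ℝ := fun m => (U - S m) / β ^ (m + 1) with hε
    have hε0 : ∀ m, 0 ≤ ε m := fun m => div_nonneg (by linarith [hSle m]) (hpow _).le
    have hεB : ∀ m, β * ε m ≤ 2 * A := fun m => by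
      have h1 : U - S m ≤ β ^ m * (2 * A) := by
        refine le_of_tendsto (hSU.sub_const (S m)) ?_
        filter_upwards [eventually_ge_atTop m] with M hM
        obtain ⟨r, rfl⟩ := Nat.exists_eq_add_of_le hM
        have := hdisc m r
        rw [hS]
        simp only [Finset.sum_range_add]
        linarith
      have h2 : β * ε m = (U - S m) / β ^ m := by
        rw [hε]
        have := (hpow m).ne'
        have := hβ.ne'
        field_simp
        ring
      rw [h2, div_le_iff₀ (hpow m)]
      linarith
    have hrec : ∀ m, ε m ≤ (a (m + 1) - a m) + β * ε (m + 1) := fun m => by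
      have h1 : U - S m = w m + (U - S (m + 1)) := by
        rw [hS]; simp only [Finset.sum_range_succ]; ring
      have h2 : β * ε (m + 1) = (U - S (m + 1)) / β ^ (m + 1) := by
        rw [hε]
        have := (hpow m).ne'
        have := hβ.ne'
        field_simp
        ring
      rw [h2, hε]
      simp only
      rw [h1, add_div]
      gcongr
      rw [div_le_iff₀ (hpow _)]
      linarith [hw m]
    have hbd : ∀ M, ∑ m ∈ Finset.range M, ε m ≤ 4 * A / (1 - β) := fun M => by
      -- Adding up `hrec` telescopes `a` and leaves the fraction `1 - β` of each `ε m`. The right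
      -- side is at most `2 * A + 2 * A`.
      have h1 : ∀ M, (1 - β) * ∑ m ∈ Finset.range M, ε m ≤ a M - a 0 + β * ε M := by
        intro M
        induction M with
        | zero => simpa using mul_nonneg hβ.le (hε0 0)
        | succ M ih =>
          rw [Finset.sum_range_succ]
          linarith [hrec M]
      rw [le_div_iff₀ (by linarith)]
      have h2 := abs_le.1 (ha M)
      have h3 := abs_le.1 (ha 0)
      linarith [h1 M, hεB M]
    exact (summable_of_sum_range_le hε0 hbd).tendsto_atTop_zero
  · simpa using hSU.const_sub U

end Sequences

/-! ### Conditional beliefs and their convergence -/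

section Learning

/-- The conditional law of the random state `st`, given the information `m`. -/
def belief {Ω 𝓧 : Type*} {m₀ : MeasurableSpace 𝓧} (ρ : Measure 𝓧) (st : 𝓧 → Ω)
    (m : MeasurableSpace 𝓧) (p : 𝓧) (ω : Ω) : ℝ :=
  (ρ[(st ⁻¹' {ω}).indicator (fun _ => (1 : ℝ)) | m]) p

variable {Ω 𝓧 : Type*} {m m₀ : MeasurableSpace 𝓧} {ρ : Measure 𝓧} {st : 𝓧 → Ω}

lemma measurable_belief (ω : Ω) : Measurable[m] fun p => belief ρ st m p ω :=
  stronglyMeasurable_condExp.measurable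

lemma measurable_belief_pi (hm : m ≤ m₀) : Measurable (belief ρ st m) :=
  measurable_pi_lambda _ fun ω => (measurable_belief ω).mono hm le_rfl

variable [IsProbabilityMeasure ρ]

/-- Lévy's upward theorem in each of the finitely many coordinates. -/
lemma tendsto_belief [Fintype Ω] (ℱ : Filtration ℕ m₀) :
    ∀ᵐ p ∂ρ, Tendsto (fun k => belief ρ st (ℱ k) p) atTop
      (𝓝 (belief ρ st (⨆ k, ℱ k) p)) := by
  filter_upwards [ae_all_iff.2 fun ω => tendsto_ae_condExp (μ := ρ) (ℱ := ℱ)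
    ((st ⁻¹' {ω}).indicator (fun _ => (1 : ℝ)))] with p hp
  exact tendsto_pi_nhds.2 hp

variable [MeasurableSpace Ω] [MeasurableSingletonClass Ω]

lemma integrable_indicator_state (hst : Measurable st) (ω : Ω) :
    Integrable ((st ⁻¹' {ω}).indicator (fun _ => (1 : ℝ))) ρ :=
  (integrable_const _).indicator (hst (measurableSet_singleton ω))

variable [Fintype Ω]

lemma belief_mem_stdSimplex (hst : Measurable st) (hm : m ≤ m₀) :
    ∀ᵐ p ∂ρ, belief ρ st m p ∈ stdSimplex ℝ Ω := by
  have h1 : ∀ᵐ p ∂ρ, ∀ ω, 0 ≤ belief ρ st m p ω := ae_all_iff.2 fun ω =>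
    condExp_nonneg (.of_forall fun p => Set.indicator_nonneg (fun _ _ => zero_le_one) p)
  have h2 : ρ[∑ ω, (st ⁻¹' {ω}).indicator (fun _ => (1 : ℝ)) | m] =ᵐ[ρ]
      ∑ ω, ρ[(st ⁻¹' {ω}).indicator (fun _ => (1 : ℝ)) | m] :=
    condExp_finsetSum (fun ω _ => integrable_indicator_state hst ω) m
  have h3 : ∑ ω, (st ⁻¹' {ω}).indicator (fun _ => (1 : ℝ)) = fun _ => 1 := by
    classical
    funext p
    simp [Finset.sum_apply, Set.indicator_apply]
  rw [h3, condExp_const hm] at h2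
  filter_upwards [h1, h2] with p hp1 hp2
  refine ⟨hp1, ?_⟩
  rw [hp2, Finset.sum_apply]
  rfl

/-- The belief in `ω` integrates, over the event where it vanishes, to the probability that this
event occurs and the state is `ω`; so that probability is `0`. -/
lemma belief_state_pos (hst : Measurable st) (hm : m ≤ m₀) :
    ∀ᵐ p ∂ρ, 0 < belief ρ st m p (st p) := by
  have h1 : ∀ ω, ∀ᵐ p ∂ρ, st p = ω → belief ρ st m p ω ≠ 0 := fun ω => by
    have hS : MeasurableSet[m] {p | belief ρ st m p ω = 0} :=
      measurable_belief ω (measurableSet_singleton 0)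
    have h2 := setIntegral_condExp hm (integrable_indicator_state (ρ := ρ) hst ω) hS
    change ∫ p in _, belief ρ st m p ω ∂ρ = _ at h2
    rw [setIntegral_congr_fun (g := fun _ => (0 : ℝ)) (hm _ hS) (fun p hp => hp), integral_zero,
      setIntegral_indicator (hst (measurableSet_singleton ω)), setIntegral_const, smul_eq_mul,
      mul_one] at h2
    have h3 := (measureReal_eq_zero_iff).1 h2.symm
    rw [← compl_mem_ae_iff] at h3
    filter_upwards [h3] with p hp hpω h0
    exact hp ⟨h0, hpω⟩
  filter_upwards [ae_all_iff.2 h1, belief_mem_stdSimplex hst hm] with p hp hps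
  exact lt_of_le_of_ne (hps.1 _) (hp _ rfl).symm

/-- Each `g ω` is known given `m` and factors out of the conditional expectation of the indicator of
the state. -/
lemma integral_belief (hst : Measurable st) (hm : m ≤ m₀) {g : Ω → 𝓧 → ℝ}
    (hg : ∀ ω, Measurable[m] (g ω)) {B : ℝ} (hB : ∀ ω p, |g ω p| ≤ B) :
    ∫ p, g (st p) p ∂ρ = ∫ p, ∑ ω, belief ρ st m p ω * g ω p ∂ρ := by
  classical
  have hinteg : ∀ ω, Integrable ((st ⁻¹' {ω}).indicator (fun _ => (1 : ℝ)) * g ω) ρ := fun ω => by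
    refine (integrable_indicator_state hst ω).mul_bdd (c := B) ?_ (.of_forall (hB ω))
    exact ((hg ω).mono hm le_rfl).aestronglyMeasurable
  have hpull : ∀ ω, ρ[(st ⁻¹' {ω}).indicator (fun _ => (1 : ℝ)) * g ω | m] =ᵐ[ρ]
      fun p => belief ρ st m p ω * g ω p := fun ω =>
    condExp_mul_of_stronglyMeasurable_right (hg ω).stronglyMeasurable (hinteg ω)
      (integrable_indicator_state hst ω)
  have h1 : ∀ p, g (st p) p =
      ∑ ω, ((st ⁻¹' {ω}).indicator (fun _ => (1 : ℝ)) * g ω) p := fun p => by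
    simp [Set.indicator_apply]
  simp only [h1]
  rw [integral_finsetSum _ fun ω _ => hinteg ω, integral_finsetSum]
  · refine Finset.sum_congr rfl fun ω _ => ?_
    rw [← integral_condExp hm, integral_congr_ae (hpull ω)]
  · exact fun ω _ => integrable_condExp.congr (hpull ω)

end Learning

/-! ### The information in the announcements -/

section PublicBelief

variable {Ω T : Type*} [MeasurableSpace Ω] [MeasurableSpace T]
  {E : Set (Ω → ProbabilityMeasure T)} {X : Ω → ℝ} {n : ℕ} [NeZero n] {P : InfoStructure Ω n}

/-- The filtration generated by the announcements. -/
def publicFiltration (E : Set (Ω → ProbabilityMeasure T)) (X : Ω → ℝ) :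
    Filtration ℕ (inferInstance : MeasurableSpace (Ω × (ℕ → Move E X))) where
  seq k := MeasurableSpace.comap (fun p => announcements (hist k p.2)) inferInstance
  mono' := by
    intro k l hkl
    have h : (fun p : Ω × (ℕ → Move E X) => announcements (hist k p.2)) =
        (fun (z : Fin l → predictions X) (j : Fin k) => z (Fin.castLE hkl j)) ∘
          fun p => announcements (hist l p.2) := rfl
    beta_reduce
    rw [h, ← MeasurableSpace.comap_comp]
    exact MeasurableSpace.comap_mono (Measurable.comap_le (by fun_prop))
  le' k := Measurable.comap_le (by fun_prop)

end PublicBelief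

/-! ### Equilibrium bounds on profitable events -/

section Aggregation

variable {Ω T : Type*} [Fintype Ω] [MeasurableSpace Ω] [MeasurableSingletonClass Ω]
  [MeasurableSpace T] [MetricSpace T] [BorelSpace T] [SecondCountableTopology T]
  {E : Set (Ω → ProbabilityMeasure T)} {X : Ω → ℝ} {n : ℕ} [NeZero n] {P : InfoStructure Ω n}
  {κ : CostStructure E}

/-- In an equilibrium the gains from one-shot deviations vanish asymptotically. -/
lemma IsNash.exists_gain_bound (hE : IsCompact E) {s : ℝ → ℝ → ℝ} (hs : IsScoringRule X s)
    {y₀ : predictions X} {β : ℝ} (hβ : 0 < β) (hβ1 : β ≤ 1) {μ : Ω → ℝ} (hμ : μ ∈ stdSimplex ℝ Ω)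
    {σ : ∀ i, Strategy E X P i} (hN : IsNash κ s y₀ β μ σ) :
    ∃ ε : ℕ → ℝ, Tendsto ε atTop (𝓝 0) ∧
      ∀ (m : ℕ) (W : Set (Fin m → predictions X)), MeasurableSet W →
        ∀ θ : Quotient (P.part (turn n m)) → Plan κ X, gain σ y₀ θ s μ m W ≤ ε m := by
  classical
  choose u hu hdev using hN
  have hdev' : ∀ (i : Fin n) (m : ℕ) (W : ∀ k, Set (Fin k → predictions X)),
      (∀ k, MeasurableSet (W k)) → ∀ θ : Quotient (P.part i) → Plan κ X,
      payoffUpTo κ s y₀ β μ σ i m +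
        ((if turn n m = i then β ^ (m + 1) * gain σ y₀ θ s μ m (W m) else 0 : ℝ) : EReal) ≤
          u i := by
    intro i m W hW θ
    refine hdev i (deviate (σ i) y₀ m W hW θ) _ (tendsto_const_nhds.congr' ?_)
    filter_upwards [eventually_gt_atTop m] with M hM
    exact (payoffUpTo_deviate hE hs y₀ hβ hμ σ hW θ hM).symm
  -- The empty trigger set describes quitting at `m`, so continuation payoffs are nonnegative.
  have hquit : ∀ i m, payoffUpTo κ s y₀ β μ σ i m ≤ u i := by
    intro i m
    have h := hdev' i m (fun _ => ∅) (fun _ => .empty) (fun _ => Plan.const κ y₀)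
    have h0 : gain σ y₀ (fun _ : Quotient (P.part i) => Plan.const κ y₀) s μ m ∅ = 0 := by
      simp [gain]
    simpa [h0] using h
  have hu0 : ∀ i, 0 ≤ u i := fun i => by
    have := hquit i 0
    rw [payoffUpTo_eq hE hs y₀ β hμ] at this
    simpa using this
  have hpos : ∀ k, 0 < β ^ (k + 1) * κ.c := fun k => mul_pos (pow_pos hβ _) κ.c_pos
  -- An infinite expected cost at one date would make the mover's payoff `-∞`, while quitting at
  -- once yields `0`.
  have hcost : ∀ k, meanCost κ μ σ k ≠ ∞ := by
    intro k hk
    have h1 : Tendsto (payoffUpTo κ s y₀ β μ σ (turn n k)) atTop (𝓝 ⊥) := by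
      refine tendsto_const_nhds.congr' ?_
      filter_upwards [eventually_gt_atTop k] with M hM
      rw [payoffUpTo_eq hE hs y₀ β hμ]
      have h2 : ∑ j ∈ Finset.range M with turn n j = turn n k,
          ENNReal.ofReal (β ^ (j + 1) * κ.c) * meanCost κ μ σ j = ∞ := by
        refine ENNReal.sum_eq_top.2 ⟨k, by simp [hM], ?_⟩
        rw [hk, ENNReal.mul_top]
        simpa using hpos k
      rw [h2]
      simp
    have h3 := tendsto_nhds_unique (hu (turn n k)) h1
    exact absurd (h3 ▸ hu0 (turn n k)) (by simp)
  obtain ⟨A, hA0, hA⟩ := hs.exists_bound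
  set a := meanScore s y₀ μ σ with ha
  set w : ℕ → ℝ := fun k =>
    β ^ (k + 1) * (a (k + 1) - a k) - β ^ (k + 1) * κ.c * (meanCost κ μ σ k).toReal with hw
  have hpay : ∀ i m, payoffUpTo κ s y₀ β μ σ i m =
      ((∑ k ∈ Finset.range m with turn n k = i, w k : ℝ) : EReal) := by
    intro i m
    have h1 : ∑ k ∈ Finset.range m with turn n k = i,
        ENNReal.ofReal (β ^ (k + 1) * κ.c) * meanCost κ μ σ k ≠ ∞ :=
      ENNReal.sum_ne_top.2 fun k _ => ENNReal.mul_ne_top ENNReal.ofReal_ne_top (hcost k)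
    rw [payoffUpTo_eq hE hs y₀ β hμ, ← EReal.coe_ennreal_toReal h1, ENNReal.toReal_sum
      fun k _ => ENNReal.mul_ne_top ENNReal.ofReal_ne_top (hcost k), ← EReal.coe_sub,
      ← Finset.sum_sub_distrib]
    congr 1
    refine Finset.sum_congr rfl fun k _ => ?_
    rw [ENNReal.toReal_mul, ENNReal.toReal_ofReal (hpos k).le]
  have hpay' : ∀ i, payoffUpTo κ s y₀ β μ σ i = fun m =>
      ((∑ k ∈ Finset.range m with turn n k = i, w k : ℝ) : EReal) := fun i => funext (hpay i)
  obtain ⟨ε, hε, hgain⟩ := InfoMarket.exists_gain_bound (n := n) (a := a) (w := w) (u := u)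
    (fun k => abs_meanScore_le hA y₀ hμ σ k) hβ hβ1
    (fun k => sub_le_self _ (mul_nonneg (hpos k).le ENNReal.toReal_nonneg))
    (fun i => hpay' i ▸ hu i) (fun i m => hpay i m ▸ hquit i m)
  refine ⟨ε, hε, fun m W hW θ => hgain m _ ?_⟩
  have h := hdev' (turn n m) m (fun k => if h : k = m then h ▸ W else ∅)
    (fun k => by
      by_cases h : k = m
      · subst h
        simpa using hW
      · simp [h]) θ
  rw [hpay] at h
  simpa using h

/-- The expected gain, at the belief `γ`, of the state-dependent payoff `a` over the score of the
price `y`. -/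
def edge (s : ℝ → ℝ → ℝ) (X a γ : Ω → ℝ) (y : predictions X) : ℝ :=
  ∑ ω, γ ω * (a ω - s y (X ω))

-- `edge` is jointly continuous, hence bounded away from `0` on the compact product. The tube lemma
-- extends the bound to a neighbourhood of `C`, uniformly over `Y`.
omit [MeasurableSpace Ω] [MeasurableSingletonClass Ω] in
lemma exists_open_edge_ge {s : ℝ → ℝ → ℝ} (hs : IsScoringRule X s) (a : Ω → ℝ)
    {C : Set (Ω → ℝ)} (hC : IsCompact C) {Y : Set (predictions X)} (hY : IsCompact Y)
    (hpos : ∀ γ ∈ C, ∀ y ∈ Y, 0 < edge s X a γ y) :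
    ∃ η > 0, ∃ U, IsOpen U ∧ C ⊆ U ∧ ∀ γ ∈ U, ∀ y ∈ Y, η ≤ edge s X a γ y := by
  have hcont : Continuous fun p : (Ω → ℝ) × predictions X => edge s X a p.1 p.2 := by
    unfold edge
    refine continuous_finsetSum _ fun ω _ => ?_
    have := hs.continuous ω
    exact ((continuous_apply ω).comp continuous_fst).mul
      (continuous_const.sub (this.comp continuous_snd))
  obtain ⟨η, hη, hη'⟩ : ∃ η > 0, ∀ p ∈ C ×ˢ Y, η < edge s X a p.1 p.2 := by
    rcases (C ×ˢ Y).eq_empty_or_nonempty with h | h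
    · exact ⟨1, one_pos, by simp [h]⟩
    · obtain ⟨p, hp, hmin⟩ := (hC.prod hY).exists_isMinOn h hcont.continuousOn
      have h1 := hpos p.1 hp.1 p.2 hp.2
      exact ⟨_, half_pos h1, fun q hq => (half_lt_self h1).trans_le (hmin hq)⟩
  obtain ⟨U, V, hU, -, hCU, hYV, hUV⟩ := generalized_tube_lemma hC hY
    (isOpen_lt continuous_const hcont) hη'
  exact ⟨η, hη, U, hU, hCU, fun γ hγ y hy => (hUV (Set.mk_mem_prod hγ (hYV hy))).le⟩

/-- The belief of an outside observer who has seen the announcements before index `k`. -/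
def publicBelief (μ : Ω → ℝ) (σ : ∀ i, Strategy E X P i) (k : ℕ) :
    Ω × (ℕ → Move E X) → Ω → ℝ :=
  belief (gameLaw μ σ) Prod.fst (publicFiltration E X k)

omit [Fintype Ω] [MeasurableSingletonClass Ω] [MetricSpace T] [BorelSpace T]
  [SecondCountableTopology T] in
lemma measurable_of_announcements {k : ℕ} {β : Type*} [MeasurableSpace β]
    {f : (Fin k → predictions X) → β} (hf : Measurable f) :
    Measurable[publicFiltration E X k] fun p : Ω × (ℕ → Move E X) =>
      f (announcements (hist k p.2)) :=
  hf.comp (comap_measurable _)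

-- The event depends on the announcements only, so it can trigger the plan. Conditionally on the
-- announcements the plan gains exactly `edge` at the public belief. The trader's own past signals
-- are not needed for this lower bound on what he can earn.
omit [SecondCountableTopology T] in
lemma edge_event_le {s : ℝ → ℝ → ℝ} (hs : IsScoringRule X s) {y₀ : predictions X} {μ : Ω → ℝ}
    (hμ : μ ∈ stdSimplex ℝ Ω) (σ : ∀ i, Strategy E X P i) {m : ℕ} {ε : ℝ} {i : Fin n}
    (hε : ∀ W : Set (Fin m → predictions X), MeasurableSet W →
        ∀ θ : Quotient (P.part i) → Plan κ X, gain σ y₀ θ s μ m W ≤ ε)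
    (θ : Quotient (P.part i) → Plan κ X) {U : Set (Ω → ℝ)} (hU : IsOpen U)
    {Y : Set (predictions X)} (hY : MeasurableSet Y) {η : ℝ}
    (hη : ∀ γ ∈ U, ∀ y ∈ Y,
      η ≤ edge s X (fun ω => (θ (Quotient.mk _ ω)).value s ω) γ y) :
    η * (gameLaw μ σ).real {p | publicBelief μ σ m p ∈ U ∧
      lastPrice y₀ m (announcements (hist m p.2)) ∈ Y} ≤ ε := by
  have := isProbabilityMeasure_gameLaw hμ σ
  obtain ⟨A, hA0, hA⟩ := hs.exists_bound
  have hm := (publicFiltration E X).le m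
  -- Doob-Dynkin: the public belief is a measurable function of the announcements.
  obtain ⟨φ, hφ, hφ'⟩ : ∃ φ : (Fin m → predictions X) → Ω → ℝ, Measurable φ ∧
      publicBelief μ σ m = φ ∘ fun p => announcements (hist m p.2) := by
    have h : Measurable[publicFiltration E X m] (publicBelief μ σ m) :=
      @measurable_pi_lambda _ _ _ (publicFiltration E X m) _ _ fun ω => measurable_belief ω
    exact h.exists_eq_measurable_comp
  set W : Set (Fin m → predictions X) := {z | φ z ∈ U ∧ lastPrice y₀ m z ∈ Y} with hWdef
  have hW : MeasurableSet W := (hφ hU.measurableSet).inter (measurable_lastPrice y₀ m hY)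
  set D : Set (Ω × (ℕ → Move E X)) := {p | publicBelief μ σ m p ∈ U ∧
      lastPrice y₀ m (announcements (hist m p.2)) ∈ Y} with hD
  have hDW : ∀ p, p ∈ D ↔ announcements (hist m p.2) ∈ W := fun p => by
    simp [hD, hWdef, hφ']
  have hDm : MeasurableSet D := by
    have : D = (fun p => announcements (hist m p.2)) ⁻¹' W := Set.ext hDW
    rw [this]
    exact measurableSet_preimage (by fun_prop) hW
  set a : Ω → ℝ := fun ω => (θ (Quotient.mk _ ω)).value s ω with ha
  let g : Ω → Ω × (ℕ → Move E X) → ℝ := fun ω p => W.indicator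
    (fun z => a ω - s (lastPrice y₀ m z) (X ω)) (announcements (hist m p.2))
  have hgm : ∀ ω, Measurable[publicFiltration E X m] (g ω) := fun ω =>
    measurable_of_announcements ((measurable_const.sub ((hs.continuous ω).measurable.comp
        (g := fun y : predictions X => s y (X ω)) (by fun_prop))).indicator hW)
  obtain ⟨B, hB⟩ : ∃ B, ∀ ω p, |g ω p| ≤ B := by
    refine ⟨∑ ω, |a ω| + A, fun ω p => ?_⟩
    have h1 : |a ω| ≤ ∑ ω, |a ω| :=
      Finset.single_le_sum (f := fun ω => |a ω|) (fun _ _ => abs_nonneg _) (Finset.mem_univ ω)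
    by_cases hp : announcements (hist m p.2) ∈ W
    · simp only [g, Set.indicator_of_mem hp]
      exact (abs_sub _ _).trans (add_le_add h1 (hA _ _))
    · simp only [g, Set.indicator_of_notMem hp, abs_zero]
      exact add_nonneg ((abs_nonneg _).trans h1) hA0
  have hgain : gain σ y₀ θ s μ m W = ∫ p, g p.1 p ∂(gameLaw μ σ) := by
    rw [integral_gameLaw hμ σ _ (fun p => hB p.1 p)]
    · rfl
    · exact measurable_from_prod_countable_right fun ω =>
        ((hgm ω).mono hm le_rfl).comp measurable_prodMk_left
  have h2 := hε W hW θ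
  rw [hgain, integral_belief measurable_fst hm hgm hB] at h2
  refine le_trans ?_ h2
  have h3 : η * (gameLaw μ σ).real D = ∫ p, D.indicator (fun _ => η) p ∂(gameLaw μ σ) := by
    rw [integral_indicator hDm, setIntegral_const, smul_eq_mul, mul_comm]
  rw [h3]
  refine integral_mono ((integrable_const _).indicator hDm) ?_ fun p => ?_
  · refine integrable_finsetSum _ fun ω _ => ?_
    exact integrable_condExp.mul_bdd (c := B)
      ((hgm ω).mono hm le_rfl).aestronglyMeasurable (.of_forall (hB ω))
  · by_cases hp : p ∈ D
    · have hp' := (hDW p).1 hp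
      simp only [Set.indicator_of_mem hp, g, Set.indicator_of_mem hp']
      exact hη _ hp.1 _ hp.2
    · have hp' : announcements (hist m p.2) ∉ W := fun h => hp ((hDW p).2 h)
      simp [Set.indicator_of_notMem hp, g, Set.indicator_of_notMem hp']

end Aggregation

lemma exists_turn_eq {n : ℕ} [NeZero n] (i : Fin n) (J : ℕ) : ∃ m ≥ J, turn n m = i := by
  refine ⟨i + n * J, ?_, ?_⟩
  · nlinarith [NeZero.one_le (n := n)]
  · ext
    simp [turn, Nat.mod_eq_of_lt i.2]

/-- The beliefs under which `X` equals `x`. -/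
def knownValue {Ω : Type*} [Fintype Ω] (X : Ω → ℝ) (x : ℝ) : Set (Ω → ℝ) :=
  stdSimplex ℝ Ω ∩ {γ | ∀ ω, X ω ≠ x → γ ω = 0}

lemma isCompact_knownValue {Ω : Type*} [Fintype Ω] (X : Ω → ℝ) (x : ℝ) :
    IsCompact (knownValue X x) := by
  refine (isCompact_stdSimplex ℝ Ω).inter_right ?_
  simp only [Set.ofPred_forall]
  exact isClosed_iInter fun ω => isClosed_iInter fun _ =>
    isClosed_eq (continuous_apply ω) continuous_const

lemma expect_of_knownValue {Ω : Type*} [Fintype Ω] {X : Ω → ℝ} {x : ℝ} {γ : Ω → ℝ}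
    (hγ : γ ∈ knownValue X x) : expect γ X = x := by
  have : ∀ ω, γ ω * X ω = γ ω * x := fun ω => by
    by_cases h : X ω = x
    · rw [h]
    · rw [hγ.2 ω h]; simp
  simp only [expect, this]
  rw [← Finset.sum_mul, hγ.1.2, one_mul]

lemma IsScoringRule.edge_pos {Ω : Type*} [Fintype Ω] {X : Ω → ℝ} {s : ℝ → ℝ → ℝ}
    (hs : IsScoringRule X s) {γ : Ω → ℝ} (hγ : γ ∈ stdSimplex ℝ Ω) {y : predictions X}
    (hy : (y : ℝ) ≠ expect γ X) : 0 < edge s X (fun ω => s (expect γ X) (X ω)) γ y := by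
  have := hs.strictlyProper γ hγ X (mem_predictions X) y y.2 hy
  simp only [edge, mul_sub, Finset.sum_sub_distrib]
  exact sub_pos.2 this

lemma IsScoringRule.edge_nonneg {Ω : Type*} [Fintype Ω] {X : Ω → ℝ} {s : ℝ → ℝ → ℝ}
    (hs : IsScoringRule X s) {γ : Ω → ℝ} (hγ : γ ∈ stdSimplex ℝ Ω) (y : predictions X) :
    0 ≤ edge s X (fun ω => s (expect γ X) (X ω)) γ y := by
  by_cases hy : (y : ℝ) = expect γ X
  · simp [edge, hy]
  · exact (hs.edge_pos hγ hy).le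

/-! ### From vanishing gains to convergence of the price -/

section Aggregation

variable {Ω T : Type*} [Fintype Ω] [MeasurableSpace Ω] [MeasurableSingletonClass Ω]
  [MeasurableSpace T] [MetricSpace T] [BorelSpace T] [SecondCountableTopology T]
  {E : Set (Ω → ProbabilityMeasure T)} {X : Ω → ℝ} {n : ℕ} [NeZero n] {P : InfoStructure Ω n}
  {κ : CostStructure E}

/-- Vanishing gains rule out limit beliefs at which some plan beats every price, so the limit belief
determines `X`. They also rule out persistent prices away from `X`, since any mover could correct
them. -/
lemma aggregates_of_edge (hE : IsCompact E) {s : ℝ → ℝ → ℝ} (hs : IsScoringRule X s)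
    (hsep : ∀ γ ∈ stdSimplex ℝ Ω, (¬ ∃ x, ∀ ω, 0 < γ ω → X ω = x) →
      ∃ (i : Fin n) (θ : Quotient (P.part i) → Plan κ X), ∀ y : predictions X,
        0 < edge s X (fun ω => (θ (Quotient.mk _ ω)).value s ω) γ y)
    {y₀ : predictions X} {β : ℝ} (hβ : 0 < β) (hβ1 : β ≤ 1) {μ : Ω → ℝ} (hμ : μ ∈ stdSimplex ℝ Ω)
    {σ : ∀ i, Strategy E X P i} (hN : IsNash κ s y₀ β μ σ) : Aggregates (y₀ : ℝ) μ σ := by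
  have := isProbabilityMeasure_gameLaw hμ σ
  obtain ⟨ε, hε, hgain⟩ := hN.exists_gain_bound hE hs hβ hβ1 hμ
  set ρ := gameLaw μ σ with hρ
  set bel := belief ρ Prod.fst (⨆ k, publicFiltration E X k) with hbel
  have hle : (⨆ k, publicFiltration E X k) ≤
      (inferInstance : MeasurableSpace (Ω × (ℕ → Move E X))) :=
    iSup_le (publicFiltration E X).le
  have hlim : ∀ᵐ p ∂ρ, Tendsto (fun k => publicBelief μ σ k p) atTop (𝓝 (bel p)) :=
    tendsto_belief _
  have hevent : ∀ (m : ℕ) (i : Fin n), turn n m = i → ∀ (θ : Quotient (P.part i) → Plan κ X)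
      (U : Set (Ω → ℝ)), IsOpen U → ∀ Y : Set (predictions X), MeasurableSet Y → ∀ η : ℝ,
      (∀ γ ∈ U, ∀ y ∈ Y, η ≤ edge s X (fun ω => (θ (Quotient.mk _ ω)).value s ω) γ y) →
      η * ρ.real {p | publicBelief μ σ m p ∈ U ∧
        lastPrice y₀ m (announcements (hist m p.2)) ∈ Y} ≤ ε m := by
    rintro m i rfl θ U hU Y hY η hη
    exact edge_event_le hs hμ σ (hgain m) θ hU hY hη
  have hnull : ∀ γ ∈ stdSimplex ℝ Ω, (¬ ∃ x, ∀ ω, 0 < γ ω → X ω = x) →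
      ∃ U, IsOpen U ∧ γ ∈ U ∧ ρ (bel ⁻¹' U) = 0 := by
    intro γ hγ hne
    obtain ⟨i, θ, hθ⟩ := hsep γ hγ hne
    obtain ⟨η, hη, U, hU, hγU, hedge⟩ := exists_open_edge_ge hs
      (fun ω => (θ (Quotient.mk _ ω)).value s ω) (isCompact_singleton (x := γ)) isCompact_univ
      (by rintro _ rfl y -; exact hθ y)
    refine ⟨U, hU, hγU rfl, ?_⟩
    have hJ : ∀ J, ρ {p | ∀ m ≥ J, publicBelief μ σ m p ∈ U} = 0 := by
      intro J
      by_contra hpos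
      have hpos' : 0 < ρ.real {p | ∀ m ≥ J, publicBelief μ σ m p ∈ U} :=
        ENNReal.toReal_pos hpos (measure_ne_top _ _)
      obtain ⟨M, hM⟩ := eventually_atTop.1 (hε.eventually (gt_mem_nhds (mul_pos hη hpos')))
      -- The trader `i` with the profitable plan has a turn so late that `ε m` is below `η` times
      -- the supposed probability.
      obtain ⟨m, hm, hmi⟩ := exists_turn_eq i (max J M)
      have h1 := hevent m i hmi θ U hU Set.univ .univ η hedge
      have h2 := hM m (le_of_max_le_right hm)
      have h3 : ρ.real {p | ∀ m ≥ J, publicBelief μ σ m p ∈ U} ≤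
          ρ.real {p | publicBelief μ σ m p ∈ U ∧
            lastPrice y₀ m (announcements (hist m p.2)) ∈ Set.univ} :=
        measureReal_mono fun p hp => ⟨hp m (le_of_max_le_left hm), trivial⟩
      nlinarith
    have hJ' := measure_iUnion_null hJ
    refine measure_mono_null_ae ?_ hJ'
    filter_upwards [hlim] with p hp hpU
    obtain ⟨J, hJp⟩ := eventually_atTop.1 (hp.eventually (hU.mem_nhds hpU))
    exact Set.mem_iUnion.2 ⟨J, hJp⟩
  have hknown : ∀ᵐ p ∂ρ, bel p ∈ knownValue X (X p.1) := by
    have hbad : ρ (bel ⁻¹' {γ | γ ∈ stdSimplex ℝ Ω ∧ ¬ ∃ x, ∀ ω, 0 < γ ω → X ω = x}) = 0 := by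
      refine Measure.preimage_null_of_map_null (measurable_belief_pi hle).aemeasurable ?_
      -- The bad beliefs are uncountably many, but the space of beliefs is second countable, so null
      -- neighbourhoods suffice.
      refine measure_null_of_locally_null _ fun γ hγ => ?_
      obtain ⟨U, hU, hγU, hU0⟩ := hnull γ hγ.1 hγ.2
      refine ⟨U, mem_nhdsWithin_of_mem_nhds (hU.mem_nhds hγU), ?_⟩
      rw [Measure.map_apply (measurable_belief_pi hle) hU.measurableSet]
      exact hU0
    filter_upwards [measure_eq_zero_iff_ae_notMem.1 hbad,
      belief_mem_stdSimplex (ρ := ρ) measurable_fst hle,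
      belief_state_pos (ρ := ρ) measurable_fst hle] with p hp1 hp2 hp3
    obtain ⟨x, hx⟩ : ∃ x, ∀ ω, 0 < bel p ω → X ω = x := by
      by_contra h
      exact hp1 ⟨hp2, h⟩
    refine ⟨hp2, fun ω hω => ?_⟩
    by_contra h0
    exact hω ((hx ω (lt_of_le_of_ne (hp2.1 ω) (Ne.symm h0))).trans (hx _ hp3).symm)
  have hstate : ∀ (ω : Ω) (δ : ℝ), 0 < δ →
      Tendsto (fun k => ρ {p | p.1 = ω ∧ δ ≤ dist (price (y₀ : ℝ) k p.2) (X ω)}) atTop (𝓝 0) := by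
    intro ω δ hδ
    let x : predictions X := ⟨X ω, mem_predictions X ω⟩
    let Y : Set (predictions X) := {y | δ ≤ dist (y : ℝ) (X ω)}
    have hYc : IsClosed Y := isClosed_le continuous_const (by fun_prop)
    -- The correcting plan announces `X ω` without a signal and beats any price at distance at least
    -- `δ`, for beliefs near those under which `X` equals `X ω`.
    obtain ⟨η, hη, U, hU, hCU, hedge⟩ := exists_open_edge_ge hs
      (fun ω => (Plan.const κ x).value s ω) (isCompact_knownValue X (X ω)) hYc.isCompact (by
        intro γ hγ y hy
        have hex := expect_of_knownValue hγ
        have hne : (y : ℝ) ≠ expect γ X := by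
          rw [hex]
          intro h
          have : δ ≤ dist (y : ℝ) (X ω) := hy
          rw [h, dist_self] at this
          linarith
        have := hs.edge_pos hγ.1 hne
        rw [hex] at this
        simpa using this)
    have h1 : Tendsto (fun k => ρ {p | p.1 = ω ∧ publicBelief μ σ k p ∉ U}) atTop (𝓝 0) := by
      rw [← measure_empty (μ := ρ)]
      refine tendsto_measure_of_ae_tendsto_indicator_of_isFiniteMeasure atTop .empty
        (fun k => ?_) ?_
      · exact (measurable_fst (measurableSet_singleton ω)).inter
          (measurable_belief_pi ((publicFiltration E X).le k) hU.measurableSet.compl)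
      · filter_upwards [hlim, hknown] with p hp hpk
        by_cases hpω : p.1 = ω
        · rw [hpω] at hpk
          filter_upwards [hp.eventually (hU.mem_nhds (hCU hpk))] with k hk
          have hk' : publicBelief μ σ k p ∈ U := hk
          simp [hk']
        · simp [hpω]
    have h2 : Tendsto (fun k => ρ {p | publicBelief μ σ k p ∈ U ∧
        lastPrice y₀ k (announcements (hist k p.2)) ∈ Y}) atTop (𝓝 0) := by
      have h3 : Tendsto (fun k => ENNReal.ofReal (ε k / η)) atTop (𝓝 0) := by
        have := (ENNReal.continuous_ofReal.tendsto _).comp (hε.div_const η)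
        simpa [Function.comp_def] using this
      refine tendsto_of_tendsto_of_tendsto_of_le_of_le tendsto_const_nhds h3
        (fun _ => zero_le) fun k => ?_
      have h4 := hevent k _ rfl (fun _ => Plan.const κ x) U hU Y hYc.measurableSet η hedge
      refine (ENNReal.le_ofReal_iff_toReal_le (measure_ne_top _ _) ?_).2 ?_
      · exact div_nonneg ((mul_nonneg hη.le measureReal_nonneg).trans h4) hη.le
      · rw [le_div_iff₀ hη, mul_comm]
        exact h4
    have h5 := h1.add h2
    rw [add_zero] at h5
    refine tendsto_of_tendsto_of_tendsto_of_le_of_le tendsto_const_nhds h5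
      (fun _ => zero_le) fun k => ?_
    refine (measure_mono fun p hp => ?_).trans (measure_union_le _ _)
    by_cases hpU : publicBelief μ σ k p ∈ U
    · refine Or.inr ⟨hpU, ?_⟩
      have := hp.2
      rw [price_eq_lastPrice] at this
      exact this
    · exact Or.inl ⟨hp.1, hpU⟩
  rw [Aggregates, tendstoInMeasure_iff_dist]
  intro δ hδ
  have hsum := tendsto_finsetSum Finset.univ fun ω (_ : ω ∈ Finset.univ) => hstate ω δ hδ
  rw [Finset.sum_const_zero] at hsum
  refine tendsto_of_tendsto_of_tendsto_of_le_of_le tendsto_const_nhds hsum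
    (fun _ => zero_le) fun k => ?_
  refine (measure_mono fun p hp => ?_).trans (measure_biUnion_finset_le _ _)
  exact Set.mem_biUnion (Finset.mem_coe.2 (Finset.mem_univ p.1)) ⟨rfl, hp⟩

end Aggregation

/-! ### Bayes' rule and the value of an experiment -/

section Posteriors

variable {Ω S : Type*} [Fintype Ω] [MeasurableSpace S] {γ : Ω → ℝ} {R : Ω → Measure S}

lemma isProbabilityMeasure_marginal (hγ : γ ∈ stdSimplex ℝ Ω) [∀ ω, IsProbabilityMeasure (R ω)] :
    IsProbabilityMeasure (marginal γ R) := by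
  refine ⟨?_⟩
  simp only [marginal, Measure.coe_finsetSum, Finset.sum_apply, Measure.smul_apply, measure_univ,
    smul_eq_mul, mul_one]
  rw [← ENNReal.ofReal_sum_of_nonneg fun ω _ => hγ.1 ω, hγ.2, ENNReal.ofReal_one]

@[fun_prop]
lemma measurable_posterior : Measurable (posterior γ R) :=
  measurable_pi_lambda _ fun _ =>
    measurable_const.mul (Measure.measurable_rnDeriv _ _).ennreal_toReal

lemma absolutelyContinuous_marginal {ω : Ω} (h : 0 < γ ω) : R ω ≪ marginal γ R := by
  intro B hB
  simp only [marginal, Measure.coe_finsetSum, Finset.sum_apply, Measure.smul_apply, smul_eq_mul,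
    Finset.sum_eq_zero_iff, Finset.mem_univ, true_imp_iff, mul_eq_zero] at hB
  exact (hB ω).resolve_left (by simpa using h)

variable {X : Ω → ℝ} {s : ℝ → ℝ → ℝ}

/-- The admissible prediction closest to `y`. -/
def project [Nonempty Ω] (X : Ω → ℝ) (y : ℝ) : predictions X :=
  Set.projIcc _ _ ((mem_predictions X (Classical.arbitrary Ω)).1.trans
    (mem_predictions X (Classical.arbitrary Ω)).2) y

lemma continuous_project [Nonempty Ω] : Continuous (project X) := by
  unfold project
  exact continuous_projIcc

lemma project_of_mem [Nonempty Ω] {y : ℝ} (hy : y ∈ predictions X) : (project X y : ℝ) = y := by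
  rw [project, Set.projIcc_of_mem _ hy]

/-- The posterior mean of `X`, as an admissible prediction. -/
def posteriorMean [Nonempty Ω] (X : Ω → ℝ) (γ : Ω → ℝ) (R : Ω → Measure S) (τ : S) :
    predictions X :=
  project X (expect (posterior γ R τ) X)

lemma measurable_posteriorMean [Nonempty Ω] : Measurable (posteriorMean X γ R) := by
  have : Measurable fun τ => expect (posterior γ R τ) X := by
    unfold expect
    fun_prop
  exact continuous_project.measurable.comp this

variable [∀ ω, IsProbabilityMeasure (R ω)]

/-- The posterior is `γ ω` times the density of `R ω`. Absolute continuity may fail when `γ ω = 0`,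
but then both sides vanish. -/
lemma integral_posterior_mul (hγ : γ ∈ stdSimplex ℝ Ω) (ω : Ω) (g : S → ℝ) :
    ∫ τ, posterior γ R τ ω * g τ ∂(marginal γ R) = γ ω * ∫ τ, g τ ∂(R ω) := by
  have := isProbabilityMeasure_marginal (R := R) hγ
  rcases (hγ.1 ω).eq_or_lt with h | h
  · simp [posterior, ← h]
  · have h1 := integral_rnDeriv_smul (absolutelyContinuous_marginal (R := R) h) (f := g)
    simp only [posterior, mul_assoc, smul_eq_mul] at h1 ⊢
    rw [integral_const_mul, h1]

lemma integrable_posterior (hγ : γ ∈ stdSimplex ℝ Ω) (ω : Ω) :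
    Integrable (fun τ => posterior γ R τ ω) (marginal γ R) := by
  have := isProbabilityMeasure_marginal (R := R) hγ
  exact Measure.integrable_toReal_rnDeriv.const_mul _

/-- Over any measurable set the coordinates integrate to masses that add up to that of the marginal,
so they sum to `1` almost everywhere. -/
lemma posterior_mem_stdSimplex (hγ : γ ∈ stdSimplex ℝ Ω) :
    ∀ᵐ τ ∂(marginal γ R), posterior γ R τ ∈ stdSimplex ℝ Ω := by
  have := isProbabilityMeasure_marginal (R := R) hγ
  have h1 : (fun τ => ∑ ω, posterior γ R τ ω) =ᵐ[marginal γ R] fun _ => (1 : ℝ) := by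
    refine Integrable.ae_eq_of_forall_setIntegral_eq _ _
      (integrable_finsetSum _ fun ω _ => integrable_posterior hγ ω) (integrable_const _)
      fun B hB _ => ?_
    rw [integral_finsetSum _ fun ω _ => (integrable_posterior hγ ω).integrableOn]
    have h2 : ∀ ω, ∫ τ in B, posterior γ R τ ω ∂(marginal γ R) = γ ω * (R ω).real B := fun ω => by
      have h3 := integral_posterior_mul (R := R) hγ ω (B.indicator fun _ => 1)
      rw [integral_indicator hB, setIntegral_const, smul_eq_mul, mul_one] at h3
      rw [← h3, ← integral_indicator hB]
      congr with τ
      by_cases hτ : τ ∈ B <;> simp [hτ]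
    simp only [h2]
    rw [setIntegral_const, smul_eq_mul, mul_one, measureReal_def, marginal]
    simp only [Measure.coe_finsetSum, Finset.sum_apply, Measure.smul_apply, smul_eq_mul]
    rw [ENNReal.toReal_sum fun ω _ => ENNReal.mul_ne_top ENNReal.ofReal_ne_top (measure_ne_top _ _)]
    refine Finset.sum_congr rfl fun ω _ => ?_
    rw [ENNReal.toReal_mul, ENNReal.toReal_ofReal (hγ.1 ω)]
    rfl
  filter_upwards [h1] with τ hτ
  exact ⟨fun ω => mul_nonneg (hγ.1 ω) ENNReal.toReal_nonneg, hτ⟩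

/-- The rule of Bayes, in integrated form. -/
lemma sum_integral_eq_integral_posterior (hγ : γ ∈ stdSimplex ℝ Ω) {g : Ω → S → ℝ}
    (hg : ∀ ω, Measurable (g ω)) {B : ℝ} (hB : ∀ ω τ, |g ω τ| ≤ B) :
    ∑ ω, γ ω * ∫ τ, g ω τ ∂(R ω) = ∫ τ, ∑ ω, posterior γ R τ ω * g ω τ ∂(marginal γ R) := by
  rw [integral_finsetSum]
  · exact Finset.sum_congr rfl fun ω _ => (integral_posterior_mul hγ ω _).symm
  · exact fun ω _ => (integrable_posterior hγ ω).mul_bdd (c := B) (hg ω).aestronglyMeasurable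
      (.of_forall (hB ω))

variable [Nonempty Ω]

/-- The expected score of the posterior mean depends on the experiment only through the law of the
posterior. This permits replacing an experiment by another one with the same random posterior. -/
lemma integral_randomPosterior (hs : IsScoringRule X s) (hγ : γ ∈ stdSimplex ℝ Ω) (b : Ω → ℝ) :
    ∫ γ', ∑ ω, γ' ω * (s (expect γ' X) (X ω) - b ω) ∂(randomPosterior γ R) =
      ∑ ω, γ ω * ∫ τ, s (posteriorMean X γ R τ) (X ω) ∂(R ω) - ∑ ω, γ ω * b ω := by
  have := isProbabilityMeasure_marginal (R := R) hγ
  obtain ⟨A, hA0, hA⟩ := hs.exists_bound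
  have hmeas : ∀ ω, Measurable fun τ => s (posteriorMean X γ R τ) (X ω) := fun ω =>
    (hs.continuous ω).measurable.comp measurable_posteriorMean
  have hF : Measurable fun γ' : Ω → ℝ =>
      ∑ ω, γ' ω * (s (project X (expect γ' X)) (X ω) - b ω) := by
    have h1 : Measurable fun γ' : Ω → ℝ => expect γ' X := by
      unfold expect
      fun_prop
    refine Finset.measurable_sum _ fun ω _ => ?_
    exact (measurable_pi_apply ω).mul
      (((hs.continuous ω).measurable.comp (continuous_project.measurable.comp h1)).sub_const _)
  have hae : (fun γ' : Ω → ℝ => ∑ ω, γ' ω * (s (expect γ' X) (X ω) - b ω)) =ᵐ[randomPosterior γ R]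
      fun γ' => ∑ ω, γ' ω * (s (project X (expect γ' X)) (X ω) - b ω) := by
    have h2 : ∀ᵐ γ' ∂(randomPosterior γ R), γ' ∈ stdSimplex ℝ Ω :=
      (ae_map_iff measurable_posterior.aemeasurable
        (isClosed_stdSimplex ℝ Ω).measurableSet).2 (posterior_mem_stdSimplex hγ)
    filter_upwards [h2] with γ' hγ'
    rw [project_of_mem (expect_mem_predictions hγ')]
  rw [integral_congr_ae hae, randomPosterior, integral_map measurable_posterior.aemeasurable
    hF.aestronglyMeasurable]
  have h3 := sum_integral_eq_integral_posterior (R := R) hγ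
    (g := fun ω τ => s (posteriorMean X γ R τ) (X ω) - b ω)
    (fun ω => (hmeas ω).sub_const _) (B := A + ∑ ω, |b ω|) (fun ω τ => by
      refine (abs_sub _ _).trans (add_le_add (hA _ _) ?_)
      exact Finset.single_le_sum (f := fun ω => |b ω|) (fun _ _ => abs_nonneg _)
        (Finset.mem_univ ω))
  refine h3.symm.trans ?_
  rw [← Finset.sum_sub_distrib]
  refine Finset.sum_congr rfl fun ω _ => ?_
  rw [integral_sub (Integrable.of_bound (hmeas ω).aestronglyMeasurable A
    (.of_forall fun τ => hA _ _)) (integrable_const _)]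
  simp [mul_sub]

/-- Announcing the posterior mean is optimal. -/
lemma sum_integral_score_le (hs : IsScoringRule X s) (hγ : γ ∈ stdSimplex ℝ Ω)
    {a : S → predictions X} (ha : Measurable a) :
    ∑ ω, γ ω * ∫ τ, s (a τ) (X ω) ∂(R ω) ≤
      ∑ ω, γ ω * ∫ τ, s (posteriorMean X γ R τ) (X ω) ∂(R ω) := by
  have := isProbabilityMeasure_marginal (R := R) hγ
  obtain ⟨A, hA0, hA⟩ := hs.exists_bound
  have hmeas : ∀ a : S → predictions X, Measurable a → ∀ ω, Measurable fun τ => s (a τ) (X ω) :=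
    fun a ha ω => (hs.continuous ω).measurable.comp ha
  have hinteg : ∀ a : S → predictions X, Measurable a →
      Integrable (fun τ => ∑ ω, posterior γ R τ ω * s (a τ) (X ω)) (marginal γ R) := fun a ha =>
    integrable_finsetSum _ fun ω _ => (integrable_posterior hγ ω).mul_bdd (c := A)
      (hmeas a ha ω).aestronglyMeasurable (.of_forall fun τ => hA _ _)
  rw [sum_integral_eq_integral_posterior hγ (hmeas a ha) (fun ω τ => hA _ _),
    sum_integral_eq_integral_posterior hγ (hmeas _ measurable_posteriorMean) (fun ω τ => hA _ _)]
  refine integral_mono_ae (hinteg a ha) (hinteg _ measurable_posteriorMean) ?_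
  filter_upwards [posterior_mem_stdSimplex (R := R) hγ] with τ hτ
  have h1 := hs.edge_nonneg hτ (a τ)
  simp only [edge, mul_sub, Finset.sum_sub_distrib, sub_nonneg] at h1
  simpa only [posteriorMean, project_of_mem (expect_mem_predictions hτ)] using h1

end Posteriors

/-! ### Conditioning on the cells of a partition -/

section Cells

variable {Ω : Type*} [Fintype Ω] {μ : Ω → ℝ} (r : Setoid Ω)

lemma condCell_congr {ω ω' : Ω} (h : r ω ω') : condCell μ r ω = condCell μ r ω' := by
  have : {ω'' | r ω ω''} = {ω'' | r ω' ω''} := Set.ext fun ω'' =>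
    ⟨fun h' => r.trans (r.symm h) h', fun h' => r.trans h h'⟩
  unfold condCell
  rw [this]

lemma sum_cell_pos (hμ : μ ∈ stdSimplex ℝ Ω) {ω : Ω} (hω : 0 < μ ω) :
    0 < ∑ ω', {ω'' | r ω ω''}.indicator μ ω' := by
  refine Finset.sum_pos' (fun ω' _ => Set.indicator_nonneg (fun ω'' _ => hμ.1 ω'') ω')
    ⟨ω, Finset.mem_univ _, ?_⟩
  rwa [Set.indicator_of_mem (show ω ∈ {ω'' | r ω ω''} from r.refl ω)]

lemma condCell_mem_stdSimplex (hμ : μ ∈ stdSimplex ℝ Ω) {ω : Ω} (hω : 0 < μ ω) :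
    condCell μ r ω ∈ stdSimplex ℝ Ω := by
  have h := sum_cell_pos r hμ hω
  refine ⟨fun ω' => div_nonneg (Set.indicator_nonneg (fun ω'' _ => hμ.1 ω'') ω') h.le, ?_⟩
  simp only [condCell]
  rw [← Finset.sum_div, div_self h.ne']

/-- The law of iterated expectations. -/
lemma sum_mul_condCell (hμ : μ ∈ stdSimplex ℝ Ω) {G : Ω → Ω → ℝ}
    (hG : ∀ ω ω', r ω ω' → G ω = G ω') :
    ∑ ω, μ ω * ∑ ω', condCell μ r ω ω' * G ω ω' = ∑ ω, μ ω * G ω ω := by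
  classical
  -- Within a cell both weights are `μ ω * μ ω'` divided by the mass of the cell, hence symmetric.
  have h1 : ∀ ω ω', μ ω * (condCell μ r ω ω' * G ω ω') =
      condCell μ r ω' ω * (μ ω' * G ω' ω') := by
    intro ω ω'
    by_cases h : r ω ω'
    · rw [condCell_congr r (r.symm h), hG ω ω' h]
      have e1 : ω' ∈ {ω'' | r ω ω''} := h
      have e2 : ω ∈ {ω'' | r ω ω''} := r.refl ω
      simp only [condCell, Set.indicator_of_mem e1, Set.indicator_of_mem e2]
      ring
    · have e1 : ω' ∉ {ω'' | r ω ω''} := h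
      have e2 : ω ∉ {ω'' | r ω' ω''} := fun h' => h (r.symm h')
      simp [condCell, Set.indicator_of_notMem e1, Set.indicator_of_notMem e2]
  simp only [Finset.mul_sum, h1]
  rw [Finset.sum_comm]
  refine Finset.sum_congr rfl fun ω _ => ?_
  rw [← Finset.sum_mul]
  rcases (hμ.1 ω).eq_or_lt with h | h
  · simp [← h]
  · rw [(condCell_mem_stdSimplex r hμ h).2, one_mul]

end Cells

/-! ### Profitable plans from separability -/

section Separable

variable {Ω T : Type*} [Fintype Ω] [MeasurableSpace T] [MetricSpace T] [BorelSpace T]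
  {E : Set (Ω → ProbabilityMeasure T)} {X : Ω → ℝ} {n : ℕ} {P : InfoStructure Ω n}
  {κ : CostStructure E} {s : ℝ → ℝ → ℝ}

/-- Acquiring the signal `R` and announcing the posterior mean, for the prior `γ`. -/
def Plan.bayes [Nonempty Ω] (X : Ω → ℝ) (γ : Ω → ℝ) (R : E) (hR : κ.K R ≠ ∞) : Plan κ X where
  signal := R
  announce := posteriorMean X γ (law E R)
  measurable_announce := measurable_posteriorMean
  cost_ne_top := hR

lemma sum_mul_value (θ : Plan κ X) {γ : Ω → ℝ} (hγ : γ ∈ stdSimplex ℝ Ω) :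
    ∑ ω, γ ω * θ.value s ω =
      ∑ ω, γ ω * ∫ τ, s (θ.announce τ) (X ω) ∂(law E θ.signal ω) -
        κ.c * (κ.K θ.signal).toReal := by
  simp only [Plan.value, mul_sub, Finset.sum_sub_distrib, ← Finset.sum_mul, hγ.2, one_mul]

/-- The net value of information of a signal, in terms of plans. -/
lemma noInfo_iff [Nonempty Ω] (hs : IsScoringRule X s) {γ : Ω → ℝ} (hγ : γ ∈ stdSimplex ℝ Ω)
    (R : E) :
    ((∫ γ', ∑ ω', γ' ω' * (s (expect γ' X) (X ω') - s (expect γ X) (X ω'))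
        ∂(randomPosterior γ (law E R)) : ℝ) : EReal)
      - ((ENNReal.ofReal κ.c * κ.K R : ℝ≥0∞) : EReal) ≤ 0 ↔
    ∀ hR : κ.K R ≠ ∞, ∑ ω, γ ω * (Plan.bayes X γ R hR).value s ω ≤
      ∑ ω, γ ω * s (expect γ X) (X ω) := by
  rw [integral_randomPosterior hs hγ]
  by_cases hR : κ.K R = ∞
  · have hc : ENNReal.ofReal κ.c ≠ 0 := by simpa using κ.c_pos
    simp [hR, ENNReal.mul_top hc]
  · have h1 : ENNReal.ofReal κ.c * κ.K R ≠ ∞ := ENNReal.mul_ne_top ENNReal.ofReal_ne_top hR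
    rw [← EReal.coe_ennreal_toReal h1, ← EReal.coe_sub, ENNReal.toReal_mul,
      ENNReal.toReal_ofReal κ.c_pos.le, EReal.coe_nonpos]
    simp only [ne_eq, hR, not_false_eq_true, forall_true_left]
    rw [sum_mul_value _ hγ]
    simp only [Plan.bayes]
    constructor <;> intro h <;> linarith

/-- At a belief under which the value of `X` is not known, separability gives some trader a
profitable plan, whatever the price. -/
lemma KappaSeparable.exists_plan (hs : IsScoringRule X s) (hsep : KappaSeparable κ P X s)
    {γ : Ω → ℝ} (hγ : γ ∈ stdSimplex ℝ Ω) (hne : ¬ ∃ x, ∀ ω, 0 < γ ω → X ω = x) :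
    ∃ (i : Fin n) (θ : Quotient (P.part i) → Plan κ X), ∀ y : predictions X,
      0 < edge s X (fun ω => (θ (Quotient.mk _ ω)).value s ω) γ y := by
  classical
  have : Nonempty Ω := by
    by_contra h
    rw [not_nonempty_iff] at h
    exact hne ⟨0, fun ω => isEmptyElim ω⟩
  have hout : ∀ i ω, condCell γ (P.part i) (Quotient.mk (P.part i) ω).out =
      condCell γ (P.part i) ω := fun i ω =>
    condCell_congr _ (Quotient.exact (Quotient.out_eq (Quotient.mk (P.part i) ω)))
  have htower : ∀ (i : Fin n) (θ : Quotient (P.part i) → Plan κ X) (y : predictions X),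
      edge s X (fun ω => (θ (Quotient.mk _ ω)).value s ω) γ y =
        ∑ ω, γ ω * edge s X ((θ (Quotient.mk _ ω)).value s) (condCell γ (P.part i) ω) y :=
    fun i θ y => (sum_mul_condCell (P.part i) hγ
      (G := fun ω ω' => (θ (Quotient.mk _ ω)).value s ω' - s y (X ω'))
      (fun ω ω' h => by rw [Quotient.sound h])).symm
  have hpos : ∀ (i : Fin n) (θ : Quotient (P.part i) → Plan κ X) (y : predictions X),
      (∀ ω, 0 < γ ω →
        0 ≤ edge s X ((θ (Quotient.mk _ ω)).value s) (condCell γ (P.part i) ω) y) →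
      (∃ ω, 0 < γ ω ∧
        0 < edge s X ((θ (Quotient.mk _ ω)).value s) (condCell γ (P.part i) ω) y) →
      0 < edge s X (fun ω => (θ (Quotient.mk _ ω)).value s ω) γ y := by
    rintro i θ y h1 ⟨ω, hω, h2⟩
    rw [htower]
    refine Finset.sum_pos' (fun ω' _ => ?_) ⟨ω, Finset.mem_univ _, mul_pos hω h2⟩
    rcases (hγ.1 ω').eq_or_lt with h | h
    · simp [← h]
    · exact mul_nonneg h.le (h1 ω' h)
  by_cases hns : NonSeparableAt P X γ
  · have hinfo : ¬ NoInfoAcquisition κ P X s γ := fun h =>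
      hsep ⟨γ, hγ, hns, fun s' hs' => by rw [Set.mem_singleton_iff.1 hs']; exact h⟩
    simp only [NoInfoAcquisition, not_forall] at hinfo
    obtain ⟨ω₀, hω₀, i, R, hR⟩ := hinfo
    have hc₀ := condCell_mem_stdSimplex (P.part i) hγ hω₀
    rw [noInfo_iff hs hc₀] at hR
    push Not at hR
    obtain ⟨hRK, hR⟩ := hR
    obtain ⟨θ, hθ₀, hθ⟩ : ∃ θ : Quotient (P.part i) → Plan κ X,
        θ (Quotient.mk _ ω₀) = Plan.bayes X (condCell γ (P.part i) ω₀) R hRK ∧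
        ∀ q, q ≠ Quotient.mk _ ω₀ →
          θ q = Plan.const κ (project X (expect (condCell γ (P.part i) q.out) X)) :=
      ⟨fun q => if q = Quotient.mk _ ω₀ then Plan.bayes X (condCell γ (P.part i) ω₀) R hRK
        else Plan.const κ (project X (expect (condCell γ (P.part i) q.out) X)), if_pos rfl,
        fun q hq => if_neg hq⟩
    refine ⟨i, θ, fun y => ?_⟩
    have hq₀ : 0 < edge s X ((Plan.bayes X (condCell γ (P.part i) ω₀) R hRK).value s)
        (condCell γ (P.part i) ω₀) y := by
      have := hs.edge_nonneg hc₀ y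
      simp only [edge, mul_sub, Finset.sum_sub_distrib] at this ⊢
      linarith
    refine hpos i θ y (fun ω hω => ?_) ⟨ω₀, hω₀, by rw [hθ₀]; exact hq₀⟩
    by_cases h : Quotient.mk (P.part i) ω = Quotient.mk _ ω₀
    · have h' : P.part i ω ω₀ := Quotient.exact h
      rw [condCell_congr (P.part i) h', h, hθ₀]
      exact hq₀.le
    · have hc := condCell_mem_stdSimplex (P.part i) hγ hω
      have := hs.edge_nonneg hc y
      rw [hθ _ h, hout]
      simpa only [edge, Plan.value_const, project_of_mem (expect_mem_predictions hc)] using this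
  · have hv : ∃ ω, 0 < γ ω ∧ X ω ≠ expect γ X := by
      by_contra! h
      exact hne ⟨_, h⟩
    obtain ⟨i, ω₀, hω₀, hneq⟩ :
        ∃ i ω, 0 < γ ω ∧ expect (condCell γ (P.part i) ω) X ≠ expect γ X := by
      by_contra! h
      exact hns ⟨_, hv, h⟩
    obtain ⟨θ, hθ⟩ : ∃ θ : Quotient (P.part i) → Plan κ X,
        ∀ q, θ q = Plan.const κ (project X (expect (condCell γ (P.part i) q.out) X)) :=
      ⟨_, fun _ => rfl⟩
    refine ⟨i, θ, fun y => ?_⟩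
    have hval : ∀ ω, 0 < γ ω →
        edge s X ((θ (Quotient.mk _ ω)).value s) (condCell γ (P.part i) ω) y =
        edge s X (fun ω' => s (expect (condCell γ (P.part i) ω) X) (X ω'))
          (condCell γ (P.part i) ω) y := fun ω hω => by
      rw [hθ, hout]
      simp only [edge, Plan.value_const,
        project_of_mem (expect_mem_predictions (condCell_mem_stdSimplex (P.part i) hγ hω))]
    refine hpos i θ y (fun ω hω => ?_) ?_
    · rw [hval ω hω]
      exact hs.edge_nonneg (condCell_mem_stdSimplex (P.part i) hγ hω) y
    -- If all cell means of this trader equalled `y`, iterated expectations would make them equal to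
    -- the mean under `γ`, against the choice of `ω₀`.
    · obtain ⟨ω, hω, hy⟩ : ∃ ω, 0 < γ ω ∧ (y : ℝ) ≠ expect (condCell γ (P.part i) ω) X := by
        by_contra! h
        have h1 := sum_mul_condCell (P.part i) hγ (G := fun _ => X) fun _ _ _ => rfl
        have h2 : ∀ ω, γ ω * ∑ ω', condCell γ (P.part i) ω ω' * X ω' = γ ω * y := fun ω => by
          rcases (hγ.1 ω).eq_or_lt with h0 | h0
          · simp [← h0]
          · rw [h ω h0]
            rfl
        simp only [h2] at h1
        rw [← Finset.sum_mul, hγ.2, one_mul] at h1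
        exact hneq ((h ω₀ hω₀).symm.trans h1)
      refine ⟨ω, hω, ?_⟩
      rw [hval ω hω]
      exact hs.edge_pos (condCell_mem_stdSimplex (P.part i) hγ hω) hy

end Separable

/-! ### The optimal one-shot value as a function of the belief -/

section OptimalValue

variable {Ω T : Type*} [Fintype Ω] [MeasurableSpace T] [MetricSpace T] [BorelSpace T]
  {E : Set (Ω → ProbabilityMeasure T)} {X : Ω → ℝ} {κ : CostStructure E} {s : ℝ → ℝ → ℝ}

/-- The maximal expected score, net of costs, that a plan gives at the belief `γ`. -/
def optimalValue (κ : CostStructure E) (X : Ω → ℝ) (s : ℝ → ℝ → ℝ) (γ : Ω → ℝ) : ℝ :=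
  ⨆ θ : Plan κ X, ∑ ω, γ ω * θ.value s ω

lemma abs_sum_mul_le {γ : Ω → ℝ} (hγ : γ ∈ stdSimplex ℝ Ω) {f : Ω → ℝ} {A : ℝ}
    (hf : ∀ ω, |f ω| ≤ A) : |∑ ω, γ ω * f ω| ≤ A :=
  calc |∑ ω, γ ω * f ω| ≤ ∑ ω, γ ω * A := by
        refine (Finset.abs_sum_le_sum_abs _ _).trans (Finset.sum_le_sum fun ω _ => ?_)
        rw [abs_mul, abs_of_nonneg (hγ.1 ω)]
        exact mul_le_mul_of_nonneg_left (hf ω) (hγ.1 ω)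
    _ = A := by rw [← Finset.sum_mul, hγ.2, one_mul]

variable {A : ℝ} (hA : ∀ (y : predictions X) (ω : Ω), |s y (X ω)| ≤ A)

include hA

lemma sum_mul_value_add_cost_le (θ : Plan κ X) {γ : Ω → ℝ} (hγ : γ ∈ stdSimplex ℝ Ω) :
    ∑ ω, γ ω * θ.value s ω + κ.c * (κ.K θ.signal).toReal ≤ A := by
  rw [sum_mul_value θ hγ, sub_add_cancel]
  exact (abs_le.1 (abs_sum_mul_le hγ fun ω => θ.abs_integral_le hA ω)).2

lemma sum_mul_value_le (θ : Plan κ X) {γ : Ω → ℝ} (hγ : γ ∈ stdSimplex ℝ Ω) :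
    ∑ ω, γ ω * θ.value s ω ≤ A := by
  have := sum_mul_value_add_cost_le hA θ hγ
  have : 0 ≤ κ.c * (κ.K θ.signal).toReal := mul_nonneg κ.c_pos.le ENNReal.toReal_nonneg
  linarith

lemma sum_mul_value_le_optimalValue (θ : Plan κ X) {γ : Ω → ℝ} (hγ : γ ∈ stdSimplex ℝ Ω) :
    ∑ ω, γ ω * θ.value s ω ≤ optimalValue κ X s γ :=
  le_ciSup (f := fun θ : Plan κ X => ∑ ω, γ ω * θ.value s ω)
    ⟨A, by rintro _ ⟨θ, rfl⟩; exact sum_mul_value_le hA θ hγ⟩ θ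

/-- The cost is the same at all beliefs and the score is bounded by `A`. The Lipschitz constant is
thus uniform over plans and passes to the supremum. -/
lemma sum_mul_value_sub_le (θ : Plan κ X) {γ γ' : Ω → ℝ} (hγ : γ ∈ stdSimplex ℝ Ω)
    (hγ' : γ' ∈ stdSimplex ℝ Ω) :
    ∑ ω, γ ω * θ.value s ω ≤ ∑ ω, γ' ω * θ.value s ω + A * ∑ ω, |γ ω - γ' ω| := by
  rw [sum_mul_value θ hγ, sum_mul_value θ hγ', Finset.mul_sum]
  have : ∑ ω, γ ω * ∫ τ, s (θ.announce τ) (X ω) ∂(law E θ.signal ω) ≤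
      ∑ ω, γ' ω * ∫ τ, s (θ.announce τ) (X ω) ∂(law E θ.signal ω) + ∑ ω, A * |γ ω - γ' ω| := by
    rw [← Finset.sum_add_distrib]
    refine Finset.sum_le_sum fun ω _ => ?_
    have h1 := θ.abs_integral_le hA ω
    set I := ∫ τ, s (θ.announce τ) (X ω) ∂(law E θ.signal ω)
    have h2 : (γ ω - γ' ω) * I ≤ |γ ω - γ' ω| * A :=
      (le_abs_self _).trans (by rw [abs_mul]; exact mul_le_mul_of_nonneg_left h1 (abs_nonneg _))
    linarith
  linarith

variable [Nonempty Ω]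

omit hA in
lemma nonempty_plan : Nonempty (Plan κ X) := ⟨Plan.const κ (project X 0)⟩

lemma optimalValue_le {γ : Ω → ℝ} (hγ : γ ∈ stdSimplex ℝ Ω) : optimalValue κ X s γ ≤ A :=
  have : Nonempty (Plan κ X) := nonempty_plan
  ciSup_le fun θ => sum_mul_value_le hA θ hγ

lemma neg_le_optimalValue {γ : Ω → ℝ} (hγ : γ ∈ stdSimplex ℝ Ω) : -A ≤ optimalValue κ X s γ := by
  refine le_trans ?_ (sum_mul_value_le_optimalValue hA (Plan.const κ (project X 0)) hγ)
  simp only [Plan.value_const]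
  exact (abs_le.1 (abs_sum_mul_le hγ fun ω => hA _ ω)).1

lemma optimalValue_le_add {γ γ' : Ω → ℝ} (hγ : γ ∈ stdSimplex ℝ Ω) (hγ' : γ' ∈ stdSimplex ℝ Ω) :
    optimalValue κ X s γ ≤ optimalValue κ X s γ' + A * ∑ ω, |γ ω - γ' ω| := by
  have : Nonempty (Plan κ X) := nonempty_plan
  refine ciSup_le fun θ => (sum_mul_value_sub_le hA θ hγ hγ').trans ?_
  have := sum_mul_value_le_optimalValue hA θ hγ'
  linarith

/-- Nearly optimal plans can be selected measurably from a countable family of plans with bounded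
costs. -/
lemma exists_measurable_selection {ε : ℝ} (hε : 0 < ε) :
    ∃ (θ : ℕ → Plan κ X) (N : (Ω → ℝ) → ℕ), Measurable N ∧
      (∀ k, κ.c * (κ.K (θ k).signal).toReal ≤ 2 * A + ε) ∧
      ∀ γ ∈ stdSimplex ℝ Ω, optimalValue κ X s γ ≤ ∑ ω, γ ω * (θ (N γ)).value s ω + ε := by
  classical
  have : Nonempty (Plan κ X) := nonempty_plan
  have hA0 : 0 ≤ A := (abs_nonneg _).trans (hA (project X 0) (Classical.arbitrary Ω))
  have : Nonempty (stdSimplex ℝ Ω) := ⟨_, single_mem_stdSimplex ℝ (Classical.arbitrary Ω)⟩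
  let d : ℕ → stdSimplex ℝ Ω := TopologicalSpace.denseSeq _
  have hd : DenseRange d := TopologicalSpace.denseRange_denseSeq _
  have hθ : ∀ k, ∃ θ : Plan κ X, optimalValue κ X s (d k).1 - ε / 2 <
      ∑ ω, (d k).1 ω * θ.value s ω := fun k => exists_lt_of_lt_ciSup (by
    rw [← optimalValue]; linarith)
  choose θ hθ using hθ
  -- Near the dense belief `d k`, the optimal value and the value of `θ k` each move by less than `ε
  -- / 4`, so `θ k` remains `ε`-optimal. Off the simplex the condition is vacuous, which makes the
  -- selection total.
  let p : (Ω → ℝ) → ℕ → Prop := fun γ k =>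
    γ ∈ stdSimplex ℝ Ω → 2 * A * ∑ ω, |γ ω - (d k).1 ω| < ε / 2
  have hp : ∀ γ, ∃ k, p γ k := by
    intro γ
    by_cases hγ : γ ∈ stdSimplex ℝ Ω
    · have hopen : IsOpen {x : stdSimplex ℝ Ω | 2 * A * ∑ ω, |γ ω - x.1 ω| < ε / 2} :=
        (isOpen_lt (f := fun f : Ω → ℝ => 2 * A * ∑ ω, |γ ω - f ω|) (by fun_prop)
          continuous_const).preimage continuous_subtype_val
      obtain ⟨k, hk⟩ := hd.exists_mem_open hopen ⟨⟨γ, hγ⟩, by simpa using hε⟩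
      exact ⟨k, fun _ => hk⟩
    · exact ⟨0, fun h => absurd h hγ⟩
  refine ⟨θ, fun γ => Nat.find (hp γ), ?_, fun k => ?_, fun γ hγ => ?_⟩
  · refine measurable_find hp fun k => ?_
    have h1 : MeasurableSet {γ : Ω → ℝ | 2 * A * ∑ ω, |γ ω - (d k).1 ω| < ε / 2} :=
      (isOpen_lt (by fun_prop) continuous_const).measurableSet
    have h2 : {γ | p γ k} = (stdSimplex ℝ Ω)ᶜ ∪
        {γ : Ω → ℝ | 2 * A * ∑ ω, |γ ω - (d k).1 ω| < ε / 2} := by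
      ext γ
      exact imp_iff_not_or
    rw [h2]
    exact (isClosed_stdSimplex ℝ Ω).measurableSet.compl.union h1
  · have h1 := sum_mul_value_add_cost_le hA (θ k) (d k).2
    have h2 := neg_le_optimalValue (κ := κ) hA (d k).2
    linarith [hθ k]
  · have h1 : 2 * A * ∑ ω, |γ ω - (d (Nat.find (hp γ))).1 ω| < ε / 2 := Nat.find_spec (hp γ) hγ
    set k := Nat.find (hp γ)
    have h2 := optimalValue_le_add (κ := κ) hA hγ (d k).2
    have h3 := sum_mul_value_sub_le hA (θ k) (d k).2 hγ
    have h4 : ∑ ω, |(d k).1 ω - γ ω| = ∑ ω, |γ ω - (d k).1 ω| :=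
      Finset.sum_congr rfl fun ω _ => abs_sub_comm _ _
    rw [h4] at h3
    linarith [hθ k]

end OptimalValue

/-! ### Truncated costs -/

section TruncatedCost

variable {Ω T : Type*} [MeasurableSpace T] [MetricSpace T] [BorelSpace T]
  {E : Set (Ω → ProbabilityMeasure T)} {κ : CostStructure E}

/-- The cost of a signal, truncated at `L`. -/
def truncCost (κ : CostStructure E) (L : ℝ) (R : E) : ℝ := (min (κ.K R) (ENNReal.ofReal L)).toReal

lemma truncCost_nonneg (L : ℝ) (R : E) : 0 ≤ truncCost κ L R := ENNReal.toReal_nonneg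

lemma truncCost_le {L : ℝ} (hL : 0 ≤ L) (R : E) : truncCost κ L R ≤ L := by
  rw [truncCost]
  exact (ENNReal.toReal_mono ENNReal.ofReal_ne_top (min_le_right _ _)).trans
    (ENNReal.toReal_ofReal hL).le

lemma ofReal_truncCost_le (L : ℝ) (R : E) : ENNReal.ofReal (truncCost κ L R) ≤ κ.K R := by
  rw [truncCost, ENNReal.ofReal_toReal (min_lt_of_right_lt ENNReal.ofReal_lt_top).ne]
  exact min_le_left _ _

lemma measurable_truncCost (hK : Measurable κ.K) (L : ℝ) : Measurable (truncCost κ L) :=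
  (hK.min measurable_const).ennreal_toReal

end TruncatedCost

/-! ### One more signal does not help -/

section OneStep

variable {Ω T : Type*} [Fintype Ω] [Nonempty Ω] [MeasurableSpace T] [MetricSpace T] [BorelSpace T]
  {E : Set (Ω → ProbabilityMeasure T)} {X : Ω → ℝ} {κ : CostStructure E} {s : ℝ → ℝ → ℝ}

/-- The beliefs concentrated on `C`. -/
def face (C : Set Ω) : Set (Ω → ℝ) := stdSimplex ℝ Ω ∩ {γ | ∀ ω ∉ C, γ ω = 0}

/-- A signal followed by an optimal plan is not better than an optimal plan. -/
lemma sum_integral_le_optimalValue (hOne : OneSignalSuffices κ) (hs : IsScoringRule X s)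
    {C : Set Ω} {γ : Ω → ℝ} (hγ : γ ∈ face C) {R : E} (hR : κ.K R ≠ ∞) {G : Ω → T → ℝ}
    (hG : ∀ ω, Measurable (G ω)) {B : ℝ} (hB : ∀ ω τ, |G ω τ| ≤ B)
    (hdom : ∀ τ, ∀ γ' ∈ face C, ∑ ω, γ' ω * G ω τ ≤ optimalValue κ X s γ') :
    ∑ ω, γ ω * ∫ τ, G ω τ ∂(law E R ω) ≤ optimalValue κ X s γ + κ.c * (κ.K R).toReal := by
  obtain ⟨A, hA0, hA⟩ := hs.exists_bound
  have hγs := hγ.1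
  have := isProbabilityMeasure_marginal (R := law E R) hγs
  refine le_of_forall_pos_le_add fun ε hε => ?_
  obtain ⟨θ, N, hN, hcost, hsel⟩ := exists_measurable_selection (κ := κ) hA hε
  set p := posterior γ (law E R) with hp
  set M := marginal γ (law E R) with hM
  let N' : T → ℕ := fun τ => N (p τ)
  have hN' : Measurable N' := hN.comp measurable_posterior
  let F : T → E := fun τ => (θ (N' τ)).signal
  have hF : Measurable F :=
    (measurable_from_nat (f := fun k => (θ k).signal)).comp hN'
  have hval : ∀ k ω, |(θ k).value s ω| ≤ 3 * A + ε := fun k ω => by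
    have h1 := (θ k).abs_integral_le hA ω
    have h2 := hcost k
    have h3 : 0 ≤ κ.c * (κ.K (θ k).signal).toReal := mul_nonneg κ.c_pos.le ENNReal.toReal_nonneg
    rw [Plan.value]
    rw [abs_le] at h1 ⊢
    constructor <;> linarith
  have hvalm : ∀ ω, Measurable fun τ => (θ (N' τ)).value s ω := fun ω =>
    (measurable_from_nat (f := fun k => (θ k).value s ω)).comp hN'
  have hinteg : ∀ f : Ω → T → ℝ, (∀ ω, Measurable (f ω)) → ∀ D : ℝ, (∀ ω τ, |f ω τ| ≤ D) →
      Integrable (fun τ => ∑ ω, p τ ω * f ω τ) M := fun f hf D hD =>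
    integrable_finsetSum _ fun ω _ => (integrable_posterior hγs ω).mul_bdd (c := D)
      (hf ω).aestronglyMeasurable (.of_forall (hD ω))
  -- After each realization the continuation `G` is replaced by a nearly optimal plan for the
  -- posterior, which stays concentrated on `C`.
  have hstep1 : ∑ ω, γ ω * ∫ τ, G ω τ ∂(law E R ω) ≤
      ∑ ω, γ ω * ∫ τ, (θ (N' τ)).value s ω ∂(law E R ω) + ε := by
    rw [sum_integral_eq_integral_posterior hγs hG hB,
      sum_integral_eq_integral_posterior hγs hvalm (fun ω τ => hval _ ω)]
    have h1 : ∫ τ, ∑ ω, p τ ω * (θ (N' τ)).value s ω ∂M + ε =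
        ∫ τ, (∑ ω, p τ ω * (θ (N' τ)).value s ω + ε) ∂M := by
      rw [integral_add (hinteg _ hvalm _ fun ω τ => hval _ ω) (integrable_const _)]
      simp
    rw [h1]
    refine integral_mono_ae (hinteg _ hG _ hB)
      ((hinteg _ hvalm _ fun ω τ => hval _ ω).add (integrable_const _)) ?_
    filter_upwards [posterior_mem_stdSimplex (R := law E R) hγs] with τ hτ
    refine (hdom τ (p τ) ⟨hτ, fun ω hω => ?_⟩).trans (hsel _ hτ)
    simp [hp, posterior, hγ.2 ω hω]
  -- `R` followed by the signal of the selected plan is a two-stage experiment; it is replaced by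
  -- the single signal `R'`.
  obtain ⟨R', hpost, hK⟩ := hOne γ hγs R F hF
  have hKbd : ∀ τ, κ.K (F τ) ≤ ENNReal.ofReal ((2 * A + ε) / κ.c) := fun τ => by
    rw [ENNReal.le_ofReal_iff_toReal_le (θ _).cost_ne_top
      (div_nonneg (by linarith) κ.c_pos.le), le_div_iff₀ κ.c_pos, mul_comm]
    exact hcost _
  have hKF : Measurable fun τ => κ.K (F τ) :=
    (measurable_from_nat (f := fun k => κ.K (θ k).signal)).comp hN'
  have hKint : ∫⁻ τ, κ.K (F τ) ∂M ≠ ∞ :=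
    ((lintegral_mono hKbd).trans_lt (by simp)).ne
  have hR' : κ.K R' ≠ ∞ := (hK.trans_lt (ENNReal.add_lt_top.2 ⟨hR.lt_top, hKint.lt_top⟩)).ne
  have hKreal : (κ.K R').toReal ≤
      (κ.K R).toReal + ∑ ω, γ ω * ∫ τ, (κ.K (F τ)).toReal ∂(law E R ω) := by
    have h1 : ∑ ω, γ ω * ∫ τ, (κ.K (F τ)).toReal ∂(law E R ω) = (∫⁻ τ, κ.K (F τ) ∂M).toReal := by
      rw [← integral_toReal hKF.aemeasurable (.of_forall fun τ => (θ _).cost_ne_top.lt_top),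
        sum_integral_eq_integral_posterior hγs (g := fun _ τ => (κ.K (F τ)).toReal)
          (fun _ => hKF.ennreal_toReal) (B := (2 * A + ε) / κ.c)]
      · refine integral_congr_ae ?_
        filter_upwards [posterior_mem_stdSimplex (R := law E R) hγs] with τ hτ
        rw [← Finset.sum_mul, hτ.2, one_mul]
      · intro _ τ
        rw [abs_of_nonneg ENNReal.toReal_nonneg, le_div_iff₀ κ.c_pos, mul_comm]
        exact hcost _
    rw [h1, ← ENNReal.toReal_add hR hKint]
    exact ENNReal.toReal_mono (ENNReal.add_ne_top.2 ⟨hR, hKint⟩) hK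
  let a : T × T → predictions X := fun z => (θ (N' z.1)).announce z.2
  have ha : Measurable a := by
    have h1 : Measurable fun q : ℕ × T => (θ q.1).announce q.2 :=
      measurable_from_prod_countable_right fun k => (θ k).measurable_announce
    exact h1.comp ((hN'.comp measurable_fst).prodMk measurable_snd)
  have : ∀ ω, IsProbabilityMeasure (sequential R F hF ω) := fun ω => by
    unfold sequential
    infer_instance
  have hsplit : ∀ ω, ∫ τ, (θ (N' τ)).value s ω ∂(law E R ω) =
      ∫ z, s (a z) (X ω) ∂(sequential R F hF ω) -
        κ.c * ∫ τ, (κ.K (F τ)).toReal ∂(law E R ω) := fun ω => by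
    have hsa : Measurable fun z => s (a z) (X ω) := (hs.continuous ω).measurable.comp ha
    have hi : Integrable (fun z => s (a z) (X ω)) (sequential R F hF ω) :=
      Integrable.of_bound hsa.aestronglyMeasurable A (.of_forall fun z => hA _ _)
    have hi' := hi
    rw [sequential] at hi' ⊢
    rw [Measure.integral_compProd hi', ← integral_const_mul, ← integral_sub]
    · rfl
    · exact Integrable.integral_compProd (κ := Kernel.const Unit (law E R ω))
        (η := Kernel.prodMkLeft Unit ((realize E ω).comap F hF)) (a := ()) hi'
    · refine Integrable.const_mul (Integrable.of_bound
        hKF.ennreal_toReal.aestronglyMeasurable ((2 * A + ε) / κ.c) (.of_forall fun τ => ?_)) _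
      rw [Real.norm_of_nonneg ENNReal.toReal_nonneg, le_div_iff₀ κ.c_pos, mul_comm]
      exact hcost _
  -- Announcing the mean given both realizations does at least as well as the selected plans. By
  -- `hpost`, `R'` attains the same expected score.
  have hbest := sum_integral_score_le (R := sequential R F hF) hs hγs ha
  have hsame : ∑ ω, γ ω * ∫ z, s (posteriorMean X γ (sequential R F hF) z) (X ω)
      ∂(sequential R F hF ω) =
      ∑ ω, γ ω * ∫ τ, s (posteriorMean X γ (law E R') τ) (X ω) ∂(law E R' ω) := by
    have h1 := integral_randomPosterior (R := sequential R F hF) hs hγs fun _ => 0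
    have h2 := integral_randomPosterior (R := law E R') hs hγs fun _ => 0
    rw [hpost, h2] at h1
    simpa using h1.symm
  have hopt := sum_mul_value_le_optimalValue hA (Plan.bayes X γ R' hR') hγs
  rw [sum_mul_value _ hγs] at hopt
  simp only [Plan.bayes] at hopt
  simp only [hsplit, mul_sub, Finset.sum_sub_distrib] at hstep1
  have hcc : ∑ ω, γ ω * (κ.c * ∫ τ, (κ.K (F τ)).toReal ∂(law E R ω)) =
      κ.c * ∑ ω, γ ω * ∫ τ, (κ.K (F τ)).toReal ∂(law E R ω) := by
    rw [Finset.mul_sum]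
    exact Finset.sum_congr rfl fun ω _ => by ring
  rw [hcc] at hstep1
  have := mul_le_mul_of_nonneg_left hKreal κ.c_pos.le
  linarith

/-- A signal costing more than `L` loses at least `2 * A`, the width of the range of scores, so
truncation does not make it worthwhile. Truncated costs keep all payoffs real and integrable. -/
lemma sum_integral_sub_truncCost_le (hOne : OneSignalSuffices κ) (hs : IsScoringRule X s) {A L : ℝ}
    (hA : ∀ (y : predictions X) (ω : Ω), |s y (X ω)| ≤ A) (hA0 : 0 ≤ A) (hL : 2 * A ≤ κ.c * L)
    {C : Set Ω} {γ : Ω → ℝ} (hγ : γ ∈ face C) (R : E) {G : Ω → T → ℝ}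
    (hG : ∀ ω, Measurable (G ω)) {B : ℝ} (hB : ∀ ω τ, |G ω τ| ≤ B)
    (hdom : ∀ τ, ∀ γ' ∈ face C, ∑ ω, γ' ω * G ω τ ≤ optimalValue κ X s γ') :
    ∑ ω, γ ω * (∫ τ, G ω τ ∂(law E R ω) - κ.c * truncCost κ L R) ≤ optimalValue κ X s γ := by
  classical
  simp only [mul_sub, Finset.sum_sub_distrib, ← Finset.sum_mul, hγ.1.2, one_mul]
  rcases le_or_gt (κ.K R) (ENNReal.ofReal L) with h | h
  · have hR : κ.K R ≠ ∞ := (h.trans_lt ENNReal.ofReal_lt_top).ne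
    have := sum_integral_le_optimalValue hOne hs hγ hR hG hB hdom
    rw [truncCost, min_eq_left h]
    linarith
  · have hL0 : 0 ≤ L := by
      by_contra hneg
      nlinarith [κ.c_pos]
    rw [truncCost, min_eq_right h.le, ENNReal.toReal_ofReal hL0]
    -- The domination is tested at the point mass on `ω`.
    have h1 : ∀ ω ∈ C, ∀ τ, G ω τ ≤ A := fun ω hω τ => by
      have hm : Pi.single ω 1 ∈ face C := ⟨single_mem_stdSimplex ℝ ω, fun ω' hω' => by
        rw [Pi.single_eq_of_ne]
        rintro rfl
        exact hω' hω⟩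
      have h2 := (hdom τ _ hm).trans (optimalValue_le hA hm.1)
      simpa [Pi.single_apply] using h2
    have h3 : ∑ ω, γ ω * ∫ τ, G ω τ ∂(law E R ω) ≤ ∑ ω, γ ω * A := by
      refine Finset.sum_le_sum fun ω _ => ?_
      by_cases hω : ω ∈ C
      · refine mul_le_mul_of_nonneg_left ?_ (hγ.1.1 ω)
        have h4 := integral_mono (μ := law E R ω)
          (Integrable.of_bound (hG ω).aestronglyMeasurable B (.of_forall (hB ω)))
          (integrable_const A) (h1 ω hω)
        simpa using h4
      · simp [hγ.2 ω hω]
    rw [← Finset.sum_mul, hγ.1.2, one_mul] at h3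
    have := neg_le_optimalValue (κ := κ) hA hγ.1
    linarith

end OneStep

/-! ### Backward induction for a single experimenter -/

section DynamicProgramming

variable {Ω T : Type*} [Fintype Ω] [Nonempty Ω] [MeasurableSpace T] [MetricSpace T] [BorelSpace T]
  {E : Set (Ω → ProbabilityMeasure T)} {X : Ω → ℝ} {n : ℕ} [NeZero n] {P : InfoStructure Ω n}
  {κ : CostStructure E} {s : ℝ → ℝ → ℝ}

/-- If all moves are independent of the state within `C`, then acquiring information in several
steps is not better than a single optimal plan, for beliefs concentrated on `C`. -/
lemma sum_integral_hist_sub_cost_le (hOne : OneSignalSuffices κ) (hs : IsScoringRule X s)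
    (hK : Measurable κ.K) {A L : ℝ} (hA : ∀ (y : predictions X) (ω : Ω), |s y (X ω)| ≤ A)
    (hA0 : 0 ≤ A) (hL : 2 * A ≤ κ.c * L) {C : Set Ω} {σ : ∀ i, Strategy E X P i} {ω₀ : Ω}
    (hsignal : ∀ ω ∈ C, ∀ k, chosenSignal σ ω k = chosenSignal σ ω₀ k)
    (hmove : ∀ ω ∈ C, ∀ k, resultingMove σ ω k = resultingMove σ ω₀ k) (k : ℕ)
    {G : Ω → (Fin k → Move E X) → ℝ} (hG : ∀ ω, Measurable (G ω)) {B : ℝ}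
    (hB : ∀ ω g, |G ω g| ≤ B)
    (hdom : ∀ g, ∀ γ ∈ face C, ∑ ω, γ ω * G ω g ≤ optimalValue κ X s γ)
    {ν : Ω → ℝ} (hν : ν ∈ face C) :
    ∑ ω, ν ω * (∫ h, G ω (hist k h) ∂(playLaw σ ω) -
      κ.c * ∑ j ∈ Finset.range k, ∫ h, truncCost κ L (h j).1.1 ∂(playLaw σ ω)) ≤
      optimalValue κ X s ν := by
  have hL0 : 0 ≤ L := by
    by_contra hneg
    nlinarith [κ.c_pos]
  have ht := measurable_truncCost hK L
  have htB : ∀ R : E, |truncCost κ L R| ≤ L := fun R => by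
    rw [abs_of_nonneg (truncCost_nonneg L R)]
    exact truncCost_le hL0 R
  -- The last move is integrated out and its cost charged to the new terminal payoff. Domination for
  -- all beliefs on `C` is preserved, so beliefs along the play need not be tracked. The bound grows
  -- by `κ.c * L` at each step.
  induction k generalizing B with
  | zero =>
    have h0 : ∀ h : ℕ → Move E X, hist 0 h = Fin.elim0 := fun h => Subsingleton.elim _ _
    simpa [h0] using hdom Fin.elim0 ν hν
  | succ k ih =>
    let F : Ω → (Fin k → Move E X) × Move E X → ℝ := fun ω p =>
      G ω (Fin.snoc (α := fun _ => Move E X) p.1 p.2) - κ.c * truncCost κ L p.2.1.1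
    have hF : ∀ ω, Measurable (F ω) := fun ω => by
      have := hG ω
      fun_prop
    have hFB : ∀ ω p, |F ω p| ≤ B + κ.c * L := fun ω p => by
      refine (abs_sub _ _).trans (add_le_add (hB _ _) ?_)
      rw [abs_mul, abs_of_pos κ.c_pos]
      exact mul_le_mul_of_nonneg_left (htB _) κ.c_pos.le
    let G' : Ω → (Fin k → Move E X) → ℝ := fun ω g => ∫ x, F ω (g, x) ∂(stepKernel σ ω k g)
    have hG' : ∀ ω, Measurable (G' ω) := fun ω =>
      (StronglyMeasurable.integral_kernel_prod_right (f := fun a b => F ω (a, b))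
        (hF ω).stronglyMeasurable).measurable
    have hB' : ∀ ω g, |G' ω g| ≤ B + κ.c * L := fun ω g => by
      simpa using norm_integral_le_of_norm_le_const (μ := stepKernel σ ω k g)
        (f := fun x => F ω (g, x)) (.of_forall fun x => hFB ω (g, x))
    have hinteg : ∀ ω, ∫ h, G ω (hist (k + 1) h) ∂(playLaw σ ω) -
        κ.c * ∑ j ∈ Finset.range (k + 1), ∫ h, truncCost κ L (h j).1.1 ∂(playLaw σ ω) =
        ∫ h, G' ω (hist k h) ∂(playLaw σ ω) -
        κ.c * ∑ j ∈ Finset.range k, ∫ h, truncCost κ L (h j).1.1 ∂(playLaw σ ω) := fun ω => by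
      have h1 := integral_playLaw_step σ ω k (hF ω) (hFB ω)
      have h2 : ∫ h, F ω (hist k h, h k) ∂(playLaw σ ω) =
          ∫ h, G ω (hist (k + 1) h) ∂(playLaw σ ω) -
            κ.c * ∫ h, truncCost κ L (h k).1.1 ∂(playLaw σ ω) := by
        simp only [F, ← hist_succ]
        rw [integral_sub, integral_const_mul]
        · exact Integrable.of_bound ((hG ω).comp (measurable_hist _)).aestronglyMeasurable B
            (.of_forall fun h => hB _ _)
        · exact (Integrable.of_bound (Measurable.aestronglyMeasurable (by fun_prop)) L
            (.of_forall fun h => htB _)).const_mul _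
      rw [Finset.sum_range_succ]
      have h3 : ∫ h, G' ω (hist k h) ∂(playLaw σ ω) = _ := h1.symm.trans h2
      rw [h3]
      ring
    simp only [hinteg]
    refine ih hG' hB' fun g γ hγ => ?_
    let R : unitInterval → E := fun u => chosenSignal σ ω₀ k (g, u)
    have hR : Measurable R := (measurable_chosenSignal σ ω₀ k).comp measurable_prodMk_left
    let H : Ω → unitInterval × T → ℝ := fun ω p =>
      G ω (Fin.snoc (α := fun _ => Move E X) g (resultingMove σ ω₀ k (g, p)))
    have hH : ∀ ω, Measurable (H ω) := fun ω => by
      have := hG ω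
      have := measurable_resultingMove σ ω₀ k
      have h3 : Measurable fun p : unitInterval × T => (g, resultingMove σ ω₀ k (g, p)) := by
        fun_prop
      exact (hG ω).comp ((measurable_snoc k).comp h3)
    let I : Ω → unitInterval → ℝ := fun ω u => ∫ τ, H ω (u, τ) ∂(law E (R u) ω)
    have hI : ∀ ω, Measurable (I ω) := fun ω =>
      (StronglyMeasurable.integral_kernel_prod_right (κ := (realize E ω).comap R hR)
        (f := fun a b => H ω (a, b)) (hH ω).stronglyMeasurable).measurable
    have hIB : ∀ ω u, |I ω u| ≤ B := fun ω u => by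
      simpa using norm_integral_le_of_norm_le_const (μ := law E (R u) ω)
        (f := fun τ => H ω (u, τ)) (.of_forall fun τ => hB ω _)
    have hterm : ∀ ω, Integrable (fun u => I ω u - κ.c * truncCost κ L (R u))
        (volume : Measure unitInterval) := fun ω =>
      (Integrable.of_bound (hI ω).aestronglyMeasurable B (.of_forall (hIB ω))).sub
        ((Integrable.of_bound (ht.comp hR).aestronglyMeasurable L
          (.of_forall fun u => htB _)).const_mul _)
    -- On `C` the moves are functions of history, draw and realization as in `ω₀`; only the law of
    -- the realization depends on the state. Thus `R u` is one signal for the whole cell, once `u`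
    -- is fixed.
    have hG'eq : ∀ ω, γ ω * G' ω g = γ ω * ∫ u, (I ω u - κ.c * truncCost κ L (R u)) := fun ω => by
      by_cases hω : ω ∈ C
      · congr 1
        have h1 : Measurable fun x => F ω (g, x) := (hF ω).comp measurable_prodMk_left
        rw [show G' ω g = _ from integral_stepKernel σ ω k g h1 fun x => hFB ω (g, x)]
        refine integral_congr_ae (.of_forall fun u => ?_)
        simp only [hmove ω hω k, hsignal ω hω k]
        change ∫ τ, (H ω (u, τ) - κ.c * truncCost κ L (R u)) ∂(law E (R u) ω) = _
        rw [integral_sub _ (integrable_const _)]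
        · simp [I]
        · exact Integrable.of_bound ((hH ω).comp measurable_prodMk_left).aestronglyMeasurable B
            (.of_forall fun τ => hB ω _)
      · simp [hγ.2 ω hω]
    simp only [hG'eq, ← integral_const_mul]
    rw [← integral_finsetSum _ fun ω _ => (hterm ω).const_mul _]
    have hle : ∀ u, ∑ ω, γ ω * (I ω u - κ.c * truncCost κ L (R u)) ≤ optimalValue κ X s γ :=
      fun u => sum_integral_sub_truncCost_le hOne hs hA hA0 hL hγ (R u)
        (fun ω => (hH ω).comp measurable_prodMk_left) (fun ω τ => hB ω _)
        fun τ γ' hγ' => hdom _ γ' hγ'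
    have := integral_mono (μ := (volume : Measure unitInterval))
      (integrable_finsetSum Finset.univ fun ω _ => (hterm ω).const_mul (γ ω))
      (integrable_const (optimalValue κ X s γ)) hle
    simpa using this

end DynamicProgramming

/-- Discounted increments of a nonpositive sequence starting at `0` have a nonpositive sum. -/
lemma sum_discounted_nonpos {d : ℕ → ℝ} (h0 : d 0 = 0) (hd : ∀ k, d k ≤ 0) {β : ℝ} (hβ : 0 < β)
    (hβ1 : β ≤ 1) (M : ℕ) : ∑ k ∈ Finset.range M, β ^ (k + 1) * (d (k + 1) - d k) ≤ 0 := by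
  have h : ∑ k ∈ Finset.range M, β ^ (k + 1) * (d (k + 1) - d k) ≤ β ^ M * d M := by
    induction M with
    | zero => simp [h0]
    | succ M ih =>
      rw [Finset.sum_range_succ]
      have h1 : β ^ (M + 1) ≤ β ^ M := pow_le_pow_of_le_one hβ.le hβ1 (Nat.le_succ M)
      nlinarith [hd M]
  exact h.trans (mul_nonpos_of_nonneg_of_nonpos (by positivity) (hd M))

/-! ### The profile that never leaves `v` -/

section Follow

variable {Ω T : Type*} [MeasurableSpace T] [MetricSpace T] [BorelSpace T]
  {E : Set (Ω → ProbabilityMeasure T)} {X : Ω → ℝ} {n : ℕ} [NeZero n] {P : InfoStructure Ω n}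

/-- The strategy of never acquiring information, announcing `v` at the start of the game and
repeating the previous announcement afterwards. -/
def follow (κ : CostStructure E) (v : predictions X) (i : Fin n) : Strategy E X P i where
  signal _ _ _ := κ.free
  announce k _ p := lastPrice v k p.1.1.1
  measurable_signal _ _ := measurable_const
  measurable_announce _ _ := by fun_prop

variable (κ : CostStructure E) (v : predictions X)

lemma chosenSignal_follow (ω : Ω) (k : ℕ) (p : (Fin k → Move E X) × unitInterval) :
    chosenSignal (P := P) (follow κ v) ω k p = κ.free := rfl

lemma resultingMove_follow (ω : Ω) (k : ℕ) (g : Fin k → Move E X) (u : unitInterval) (τ : T) :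
    resultingMove (P := P) (follow κ v) ω k (g, (u, τ)) =
      ((κ.free, τ), lastPrice v k (announcements g)) := rfl

variable {i : Fin n} (d : Strategy E X P i)

lemma chosenSignal_update_follow (ω : Ω) {k : ℕ} (hk : turn n k ≠ i)
    (p : (Fin k → Move E X) × unitInterval) :
    chosenSignal (Function.update (follow κ v) i d) ω k p = κ.free := by
  simp [chosenSignal, hk, follow]

lemma resultingMove_update_follow (ω : Ω) {k : ℕ} (hk : turn n k ≠ i) (g : Fin k → Move E X)
    (u : unitInterval) (τ : T) :
    resultingMove (Function.update (follow κ v) i d) ω k (g, (u, τ)) =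
      ((κ.free, τ), lastPrice v k (announcements g)) := by
  rw [resultingMove, chosenSignal_update_follow κ v d ω hk]
  simp only [Function.update_of_ne hk]
  rfl

lemma chosenSignal_update_follow_congr {ω ω' : Ω} (h : P.part i ω ω') (k : ℕ) :
    chosenSignal (Function.update (follow κ v) i d) ω k =
      chosenSignal (Function.update (follow κ v) i d) ω' k := by
  funext p
  by_cases hk : turn n k = i
  · subst hk
    rw [chosenSignal, chosenSignal, Quotient.sound h]
  · simp only [chosenSignal_update_follow κ v d _ hk]

lemma resultingMove_update_follow_congr {ω ω' : Ω} (h : P.part i ω ω') (k : ℕ) :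
    resultingMove (Function.update (follow κ v) i d) ω k =
      resultingMove (Function.update (follow κ v) i d) ω' k := by
  funext ⟨g, u, τ⟩
  by_cases hk : turn n k = i
  · rw [resultingMove, resultingMove, chosenSignal_update_follow_congr κ v d h]
    subst hk
    rw [Quotient.sound h]
  · simp only [resultingMove_update_follow κ v d _ hk]

/-- If the market maker starts at `v`, repetition keeps the price there. Prices from time `1` on do
not involve his announcement, so any `y₀` gives the same conclusion. -/
lemma ae_price_follow (y₀ : ℝ) (ω : Ω) (k : ℕ) :
    ∀ᵐ x ∂(playLaw (P := P) (follow κ v) ω), price y₀ (k + 1) x = v := by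
  have h : ∀ k, ∀ᵐ x ∂(playLaw (P := P) (follow κ v) ω), price (v : ℝ) k x = v := fun k => by
    induction k with
    | zero => exact .of_forall fun _ => rfl
    | succ k ih =>
      filter_upwards [ih, ae_price_succ_of_repeat (σ := follow (P := P) κ v) (ω := ω) (k := k) v
        fun g u τ => by rw [resultingMove_follow]] with x h1 h2
      rw [h2, h1]
  exact h (k + 1)

lemma not_aggregates_follow [Fintype Ω] [MeasurableSpace Ω] (y₀ : ℝ) {μ : Ω → ℝ} {ω : Ω}
    (hω : 0 < μ ω) (hne : X ω ≠ v) : ¬ Aggregates (P := P) y₀ μ (follow κ v) := by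
  intro h
  have hpos : 0 < edist (v : ℝ) (X ω) := edist_pos.2 hne.symm
  -- Time `0` is skipped, because `y₀` need not be `v`.
  have hlim := (tendsto_add_atTop_iff_nat 1).2 (h (edist (v : ℝ) (X ω)) hpos)
  refine (ge_of_tendsto' (b := ENNReal.ofReal (μ ω)) hlim fun k => ?_).not_gt
    (ENNReal.ofReal_pos.2 hω)
  set S : Set (Ω × (ℕ → Move E X)) :=
    {p | edist (v : ℝ) (X ω) ≤ edist (price y₀ (k + 1) p.2) (X p.1)}
  have h1 : (1 : ℝ≥0∞) ≤ (Measure.dirac ω).prod (playLaw (P := P) (follow κ v) ω) S := by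
    rw [Measure.dirac_prod]
    refine le_trans ?_ (Measure.le_map_apply (by fun_prop) S)
    rw [← measure_univ (μ := playLaw (P := P) (follow κ v) ω)]
    refine measure_mono_ae ?_
    filter_upwards [ae_price_follow (P := P) κ v y₀ ω k] with x hx _
    change _ ≤ edist (price y₀ (k + 1) x) (X ω)
    rw [hx]
  rw [gameLaw, Measure.coe_finsetSum, Finset.sum_apply]
  calc ENNReal.ofReal (μ ω) ≤ ENNReal.ofReal (μ ω) *
        (Measure.dirac ω).prod (playLaw (P := P) (follow κ v) ω) S := le_mul_of_one_le_right' h1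
    _ ≤ _ := Finset.single_le_sum (f := fun ω => (ENNReal.ofReal (μ ω) •
        (Measure.dirac ω).prod (playLaw (P := P) (follow κ v) ω)) S)
        (fun _ _ => zero_le) (Finset.mem_univ ω)

end Follow

section NoInformation

variable {Ω T : Type*} [Fintype Ω] [MeasurableSpace T] [MetricSpace T] [BorelSpace T]
  {E : Set (Ω → ProbabilityMeasure T)} {X : Ω → ℝ} {n : ℕ} {P : InfoStructure Ω n}
  {κ : CostStructure E} {s : ℝ → ℝ → ℝ}

/-- Without information acquisition, the best plan is to announce the prior mean. -/
lemma NoInfoAcquisition.optimalValue_le [Nonempty Ω] (hs : IsScoringRule X s) {μ : Ω → ℝ}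
    (hμ : μ ∈ stdSimplex ℝ Ω) (hno : NoInfoAcquisition κ P X s μ) {ω : Ω} (hω : 0 < μ ω)
    (i : Fin n) :
    optimalValue κ X s (condCell μ (P.part i) ω) ≤
      ∑ ω', condCell μ (P.part i) ω ω' *
        s (expect (condCell μ (P.part i) ω) X) (X ω') := by
  have hν := condCell_mem_stdSimplex (P.part i) hμ hω
  have : Nonempty (Plan κ X) := ⟨Plan.const κ ⟨_, mem_predictions X ω⟩⟩
  refine ciSup_le fun θ => ?_
  refine le_trans ?_ ((noInfo_iff hs hν θ.signal).1 (hno ω hω i θ.signal) θ.cost_ne_top)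
  rw [sum_mul_value _ hν, sum_mul_value _ hν]
  exact sub_le_sub_right (sum_integral_score_le hs hν θ.measurable_announce) _

end NoInformation

/-! ### The uninformative equilibrium -/

section Equilibrium

variable {Ω T : Type*} [Fintype Ω] [MeasurableSpace T] [MetricSpace T] [BorelSpace T]
  {E : Set (Ω → ProbabilityMeasure T)} {X : Ω → ℝ} {n : ℕ} [NeZero n] {P : InfoStructure Ω n}
  {κ : CostStructure E} {s : ℝ → ℝ → ℝ}

/-- The expected truncated cost of the signal bought at index `k`. -/
def meanTruncCost (κ : CostStructure E) (L : ℝ) (μ : Ω → ℝ) (σ : ∀ i, Strategy E X P i) (k : ℕ) :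
    ℝ :=
  ∑ ω, μ ω * ∫ h, truncCost κ L (h k).1.1 ∂(playLaw σ ω)

lemma meanTruncCost_nonneg (L : ℝ) {μ : Ω → ℝ} (hμ : μ ∈ stdSimplex ℝ Ω)
    (σ : ∀ i, Strategy E X P i) (k : ℕ) : 0 ≤ meanTruncCost κ L μ σ k :=
  Finset.sum_nonneg fun ω _ => mul_nonneg (hμ.1 ω) (integral_nonneg fun _ => truncCost_nonneg _ _)

lemma ofReal_meanTruncCost_le (hK : Measurable κ.K) {L : ℝ} (hL : 0 ≤ L) {μ : Ω → ℝ}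
    (hμ : μ ∈ stdSimplex ℝ Ω) (σ : ∀ i, Strategy E X P i) (k : ℕ) :
    ENNReal.ofReal (meanTruncCost κ L μ σ k) ≤ meanCost κ μ σ k := by
  have ht := measurable_truncCost hK L
  have hnn : ∀ ω, 0 ≤ ∫ h, truncCost κ L (h k).1.1 ∂(playLaw σ ω) := fun ω =>
    integral_nonneg fun _ => truncCost_nonneg _ _
  rw [meanTruncCost, ENNReal.ofReal_sum_of_nonneg fun ω _ => mul_nonneg (hμ.1 ω) (hnn ω)]
  refine Finset.sum_le_sum fun ω _ => ?_
  rw [ENNReal.ofReal_mul (hμ.1 ω), ofReal_integral_eq_lintegral_ofReal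
    (Integrable.of_bound (Measurable.aestronglyMeasurable (by fun_prop)) L (.of_forall fun h => by
      rw [Real.norm_of_nonneg (truncCost_nonneg _ _)]
      exact truncCost_le hL _)) (.of_forall fun _ => truncCost_nonneg _ _)]
  exact mul_le_mul_right (lintegral_mono fun h => ofReal_truncCost_le _ _) _

/-- If the others never react, then no trader's strategy improves the price, net of the costs. -/
lemma meanScore_update_follow_le (hOne : OneSignalSuffices κ) (hs : IsScoringRule X s)
    (hK : Measurable κ.K) {A L : ℝ} (hA : ∀ (y : predictions X) (ω : Ω), |s y (X ω)| ≤ A)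
    (hA0 : 0 ≤ A) (hL : 2 * A ≤ κ.c * L) {μ : Ω → ℝ} (hμ : μ ∈ stdSimplex ℝ Ω)
    (hno : NoInfoAcquisition κ P X s μ) {v : predictions X} {i : Fin n}
    (hv : ∀ ω, 0 < μ ω → expect (condCell μ (P.part i) ω) X = v) (d : Strategy E X P i) (k : ℕ) :
    meanScore s v μ (Function.update (follow κ v) i d) k -
      κ.c * ∑ j ∈ Finset.range k, meanTruncCost κ L μ (Function.update (follow κ v) i d) j ≤
      ∑ ω, μ ω * s v (X ω) := by
  set σ := Function.update (follow κ v) i d with hσ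
  let f : Ω → ℝ := fun ω => ∫ h, s (price (v : ℝ) k h) (X ω) ∂(playLaw σ ω) -
    κ.c * ∑ j ∈ Finset.range k, ∫ h, truncCost κ L (h j).1.1 ∂(playLaw σ ω)
  have hf : meanScore s v μ σ k - κ.c * ∑ j ∈ Finset.range k, meanTruncCost κ L μ σ j =
      ∑ ω, μ ω * f ω := by
    simp only [f, meanScore, meanTruncCost, mul_sub, Finset.sum_sub_distrib]
    rw [Finset.sum_comm, Finset.mul_sum]
    congr 1
    refine Finset.sum_congr rfl fun ω _ => ?_
    rw [← Finset.mul_sum]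
    ring
  have hcell : ∀ ω₀, 0 < μ ω₀ → ∑ ω, condCell μ (P.part i) ω₀ ω * f ω ≤
      ∑ ω, condCell μ (P.part i) ω₀ ω * s v (X ω) := fun ω₀ hω₀ => by
    have : Nonempty Ω := ⟨ω₀⟩
    have hface : condCell μ (P.part i) ω₀ ∈ face {ω | P.part i ω₀ ω} :=
      ⟨condCell_mem_stdSimplex (P.part i) hμ hω₀, fun ω hω => by
        simp [condCell, Set.indicator_of_notMem hω]⟩
    have h1 := sum_integral_hist_sub_cost_le hOne hs hK hA hA0 hL (σ := σ) (ω₀ := ω₀)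
      (C := {ω | P.part i ω₀ ω})
      (fun ω hω k => chosenSignal_update_follow_congr κ v d ((P.part i).symm hω) k)
      (fun ω hω k => resultingMove_update_follow_congr κ v d ((P.part i).symm hω) k) k
      (G := fun ω g => s (lastPrice v k (announcements g)) (X ω))
      (fun ω => (hs.continuous ω).measurable.comp
        ((measurable_lastPrice v k).comp (measurable_announcements k)))
      (fun ω g => hA _ _)
      (fun g γ hγ => by
        simpa using sum_mul_value_le_optimalValue hA
          (Plan.const κ (lastPrice v k (announcements g))) hγ.1) hface
    have h2 := hno.optimalValue_le hs hμ hω₀ i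
    rw [hv ω₀ hω₀] at h2
    simp only [← price_eq_lastPrice] at h1
    exact h1.trans h2
  rw [hf, ← sum_mul_condCell (P.part i) hμ (G := fun _ => f) fun _ _ _ => rfl,
    ← sum_mul_condCell (P.part i) hμ (G := fun _ ω => s v (X ω)) fun _ _ _ => rfl]
  refine Finset.sum_le_sum fun ω _ => ?_
  rcases (hμ.1 ω).eq_or_lt with h | h
  · simp [← h]
  · exact mul_le_mul_of_nonneg_left (hcell ω h) h.le

variable [MeasurableSpace Ω] [MeasurableSingletonClass Ω] [SecondCountableTopology T]

/-- The effect of the market maker's announcement on the payoffs. -/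
lemma payoffUpTo_change_start (hE : IsCompact E) (hs : IsScoringRule X s) (y₀ v : predictions X)
    (β : ℝ) {μ : Ω → ℝ} (hμ : μ ∈ stdSimplex ℝ Ω) (σ : ∀ i, Strategy E X P i) (i : Fin n)
    (m : ℕ) :
    payoffUpTo κ s y₀ β μ σ i (m + 1) = payoffUpTo κ s v β μ σ i (m + 1) +
      ((if turn n 0 = i then β * (∑ ω, μ ω * s v (X ω) - ∑ ω, μ ω * s y₀ (X ω)) else 0 : ℝ) :
        EReal) := by
  rw [payoffUpTo_eq hE hs y₀ β hμ, payoffUpTo_eq hE hs v β hμ]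
  have h1 : ∀ k, meanScore s y₀ μ σ (k + 1) = meanScore s v μ σ (k + 1) := fun k => rfl
  have h2 := ereal_sub_add_split (C := ∑ k ∈ Finset.range (m + 1) with turn n k = i,
        ENNReal.ofReal (β ^ (k + 1) * κ.c) * meanCost κ μ σ k) (D := 0)
      (a := ∑ k ∈ Finset.range (m + 1) with turn n k = i,
        β ^ (k + 1) * (meanScore s v μ σ (k + 1) - meanScore s v μ σ k))
      (b := if turn n 0 = i then β * (∑ ω, μ ω * s v (X ω) - ∑ ω, μ ω * s y₀ (X ω)) else 0)
      ENNReal.zero_ne_top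
  rw [add_zero, ENNReal.toReal_zero, sub_zero] at h2
  rw [← h2]
  congr 2
  rw [Finset.sum_filter, Finset.sum_filter, Finset.sum_range_succ', Finset.sum_range_succ']
  simp only [h1, meanScore_zero]
  split_ifs <;> ring

lemma payoffUpTo_follow (hE : IsCompact E) (hs : IsScoringRule X s) (v : predictions X) (β : ℝ)
    {μ : Ω → ℝ} (hμ : μ ∈ stdSimplex ℝ Ω) (i : Fin n) (m : ℕ) :
    payoffUpTo (P := P) κ s v β μ (follow κ v) i m = 0 := by
  have hK := κ.measurable_K hE
  rw [payoffUpTo_eq hE hs v β hμ]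
  have h1 : ∀ k, meanScore s v μ (follow (P := P) κ v) (k + 1) =
      meanScore s v μ (follow (P := P) κ v) k := fun k =>
    meanScore_succ_of_repeat s v μ fun ω g u τ => by rw [resultingMove_follow]
  have h2 : ∀ k, meanCost κ μ (follow (P := P) κ v) k = 0 := fun k =>
    meanCost_eq_zero hK μ fun ω p => by rw [chosenSignal_follow, κ.K_free]
  simp [h1, h2]

/-- At the turns of the others neither score nor cost changes. The deviator's payoff is therefore at
most the discounted sum of all increments of the score net of accumulated truncated costs, a
sequence that never exceeds its initial value. -/
lemma payoffUpTo_update_follow_le (hE : IsCompact E) (hOne : OneSignalSuffices κ)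
    (hs : IsScoringRule X s) {β : ℝ} (hβ : 0 < β) (hβ1 : β ≤ 1) {μ : Ω → ℝ}
    (hμ : μ ∈ stdSimplex ℝ Ω) (hno : NoInfoAcquisition κ P X s μ) {v : predictions X} {i : Fin n}
    (hv : ∀ ω, 0 < μ ω → expect (condCell μ (P.part i) ω) X = v) (d : Strategy E X P i) (m : ℕ) :
    payoffUpTo κ s v β μ (Function.update (follow κ v) i d) i m ≤ 0 := by
  have hK := κ.measurable_K hE
  obtain ⟨A, hA0, hA⟩ := hs.exists_bound
  set L := 2 * A / κ.c with hL
  have hL0 : 0 ≤ L := div_nonneg (by positivity) κ.c_pos.le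
  have hAL : 2 * A ≤ κ.c * L := by rw [hL, mul_div_cancel₀ _ κ.c_pos.ne']
  set σ := Function.update (follow κ v) i d with hσ
  set a := meanScore s v μ σ
  set t := meanTruncCost κ L μ σ
  have ht : ∀ k, 0 ≤ t k := meanTruncCost_nonneg L hμ σ
  have htc : ∀ k, ENNReal.ofReal (t k) ≤ meanCost κ μ σ k := ofReal_meanTruncCost_le hK hL0 hμ σ
  have hne : ∀ k, turn n k ≠ i → a (k + 1) - a k - κ.c * t k = 0 := fun k hk => by
    have h1 : a (k + 1) = a k := meanScore_succ_of_repeat s v μ fun ω g u τ => by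
      rw [hσ, resultingMove_update_follow κ v d ω hk]
    have h2 : meanCost κ μ σ k = 0 := meanCost_eq_zero hK μ fun ω p => by
      rw [hσ, chosenSignal_update_follow κ v d ω hk, κ.K_free]
    have h3 := htc k
    rw [h2, nonpos_iff_eq_zero, ENNReal.ofReal_eq_zero] at h3
    rw [h1, le_antisymm h3 (ht k)]
    simp
  have hsum := sum_discounted_nonpos (d := fun k => a k - κ.c * ∑ j ∈ Finset.range k, t j - a 0)
    (by simp) (fun k => by
      have := meanScore_update_follow_le hOne hs hK hA hA0 hAL hμ hno hv d k
      have h0 : a 0 = _ := meanScore_zero s v μ σ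
      linarith) hβ hβ1 m
  have hsum' : ∑ k ∈ Finset.range m with turn n k = i, β ^ (k + 1) * (a (k + 1) - a k) ≤
      ∑ k ∈ Finset.range m with turn n k = i, β ^ (k + 1) * κ.c * t k := by
    rw [← sub_nonpos, ← Finset.sum_sub_distrib, Finset.sum_filter]
    refine le_trans (le_of_eq (Finset.sum_congr rfl fun k _ => ?_)) hsum
    rw [Finset.sum_range_succ]
    split_ifs with hk
    · ring
    · have := hne k hk
      rw [show a (k + 1) - κ.c * (∑ j ∈ Finset.range k, t j + t k) - a 0 -
        (a k - κ.c * ∑ j ∈ Finset.range k, t j - a 0) = a (k + 1) - a k - κ.c * t k by ring, this,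
        mul_zero]
  have hcost : ENNReal.ofReal (∑ k ∈ Finset.range m with turn n k = i, β ^ (k + 1) * κ.c * t k) ≤
      ∑ k ∈ Finset.range m with turn n k = i,
        ENNReal.ofReal (β ^ (k + 1) * κ.c) * meanCost κ μ σ k := by
    have hc := κ.c_pos
    rw [ENNReal.ofReal_sum_of_nonneg fun k _ => mul_nonneg (by positivity) (ht k)]
    refine Finset.sum_le_sum fun k _ => ?_
    rw [ENNReal.ofReal_mul (by positivity)]
    exact mul_le_mul_right (htc k) _
  rw [payoffUpTo_eq hE hs v β hμ]
  refine EReal.sub_nonpos.2 ?_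
  calc _ ≤ ((∑ k ∈ Finset.range m with turn n k = i, β ^ (k + 1) * κ.c * t k : ℝ) : EReal) :=
        EReal.coe_le_coe_iff.2 hsum'
    _ ≤ _ := by rw [EReal.coe_ennreal_ofReal]; exact_mod_cast le_max_left _ _
    _ ≤ _ := EReal.coe_ennreal_le_coe_ennreal_iff.2 hcost

/-- If there is no information acquisition and all traders agree on the value `v`, then it is an
equilibrium to announce `v` forever. -/
lemma isNash_follow (hE : IsCompact E) (hOne : OneSignalSuffices κ) (hs : IsScoringRule X s)
    {β : ℝ} (hβ : 0 < β) (hβ1 : β ≤ 1) {μ : Ω → ℝ} (hμ : μ ∈ stdSimplex ℝ Ω)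
    (hno : NoInfoAcquisition κ P X s μ) (y₀ : predictions X) {v : predictions X}
    (hv : ∀ i ω, 0 < μ ω → expect (condCell μ (P.part i) ω) X = v) :
    IsNash (P := P) κ s y₀ β μ (follow κ v) := by
  intro i
  -- Replacing `y₀` by `v` shifts only the first mover's payoff, by the same amount with and without
  -- the deviation. With start `v` the payoffs to compare are `0` and at most `0`.
  refine ⟨((if turn n 0 = i then β * (∑ ω, μ ω * s v (X ω) - ∑ ω, μ ω * s y₀ (X ω)) else 0 : ℝ) :
    EReal), tendsto_const_nhds.congr' ?_, fun d u' hu' => le_of_tendsto hu' ?_⟩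
  · filter_upwards [eventually_ge_atTop 1] with m hm
    obtain ⟨m, rfl⟩ := Nat.exists_eq_add_of_le' hm
    rw [payoffUpTo_change_start hE hs y₀ v β hμ, payoffUpTo_follow hE hs v β hμ, zero_add]
  · filter_upwards [eventually_ge_atTop 1] with m hm
    obtain ⟨m, rfl⟩ := Nat.exists_eq_add_of_le' hm
    rw [payoffUpTo_change_start hE hs y₀ v β hμ]
    exact (add_le_add_left
      (payoffUpTo_update_follow_le hE hOne hs hβ hβ1 hμ hno (hv i) d (m + 1)) _).trans
      (zero_add _).le

end Equilibrium

end InfoMarket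

end

open InfoMarket in
theorem theorem1 {Ω T : Type*} [Fintype Ω] [MeasurableSpace Ω] [MeasurableSingletonClass Ω]
    [MetricSpace T] [CompleteSpace T] [SecondCountableTopology T] [MeasurableSpace T] [BorelSpace T]
    {n : ℕ} [NeZero n] (P : InfoStructure Ω n) (X : Ω → ℝ)
    (E : Set (Ω → ProbabilityMeasure T)) (hE : IsCompact E) (κ : CostStructure E) :
    (∀ s, IsScoringRule X s → KappaSeparable κ P X s →
      ∀ μ ∈ stdSimplex ℝ Ω, ∀ y₀ ∈ predictions X, ∀ β : ℝ, 0 < β → β ≤ 1 →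
        ∀ σ : ∀ i, Strategy E X P i, IsNash κ s y₀ β μ σ → Aggregates y₀ μ σ) ∧
    (OneSignalSuffices κ →
      ∀ S : Set (ℝ → ℝ → ℝ), (∀ s ∈ S, IsScoringRule X s) → KappaNonSeparable κ P X S →
        ∃ μ ∈ stdSimplex ℝ Ω, ∀ s ∈ S, ∀ y₀ ∈ predictions X, ∀ β : ℝ, 0 < β → β ≤ 1 →
          ∃ σ : ∀ i, Strategy E X P i, IsNash κ s y₀ β μ σ ∧ ¬ Aggregates y₀ μ σ) := by
  refine ⟨fun s hs hsep μ hμ y₀ hy₀ β hβ hβ1 σ hN => ?_, ?_⟩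
  · exact aggregates_of_edge (y₀ := ⟨y₀, hy₀⟩) hE hs
      (fun γ hγ hne => hsep.exists_plan hs hγ hne) hβ hβ1 hμ hN
  · rintro hOne S hS ⟨μ, hμ, ⟨v, ⟨ω, hω, hne⟩, hv⟩, hno⟩
    refine ⟨μ, hμ, fun s hs y₀ hy₀ β hβ hβ1 => ?_⟩
    have hmem : v ∈ predictions X := by
      rw [← hv 0 ω hω]
      exact expect_mem_predictions (condCell_mem_stdSimplex _ hμ hω)
    exact ⟨follow κ ⟨v, hmem⟩,
      isNash_follow hE hOne (hS s hs) hβ hβ1 hμ (hno s hs) ⟨y₀, hy₀⟩ hv,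
      not_aggregates_follow κ ⟨v, hmem⟩ y₀ hω hne⟩
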